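/- There are a deterministic algorithm, a polynomial $p$ and an absolute constant $C$ such that the following holds for all integers $m \ge k \ge 1$. Let $G=(V,E)$ be a unit disk graph on $n \ge 1$ nodes (the nodes can be placed in the Euclidean plane so that two distinct nodes are adjacent if and only if their distance is at most $1$), let $w : V \to \mathbb{R}_{\ge 0}$ be node weights, and let $T \subseteq V$ be a $(k-1,m)$-CDS, i.e. $T$ is $(k-1)$-connected and every node of $V \setminus T$ has at least $m$ neighbours in $T$. (A node set $U$ is called $j$-connected if the induced subgraph $G[U]$ is connected after the removal of any fewer than $j$ of its nodes, where the graph without nodes counts as connected.) Call $S \subseteq V \setminus T$ feasible if $T \cup S$ is $k$-connected, and suppose that a feasible set exists. Then the algorithm, given $n$, $k$, $m$, the adjacency matrix of $G$, $T$ and $w$ (but no placement of the nodes in the plane), halts after at most $p(n)$ steps and outputs a feasible set $S$ with the following two properties. 1. $\sum_{v \in S} w(v) \le C k^2 \sum_{v \in S^*} w(v)$ for every feasible set $S^*$; that is, the algorithm is an $O(k^2)$-approximation algorithm for the problem of finding a feasible set of minimum weight. 2. There is a root $r \in T$ such that $\sum_{v \in S} w(v)$ is at most $C k^2$ times the optimal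 value of the linear program $$\min \sum_{v \in V \setminus T} w(v)\, x(v) \quad \text{subject to} \quad \sum_{v \in \Gamma(X) \setminus T} x(v) \ge 1 \ \ (X \in \mathcal{D}_r), \qquad x(v) \ge 0 \ \ (v \in V \setminus T).$$ Here $\Gamma(X)$ is the set of nodes outside $X$ with a neighbour in $X$, and $\mathcal{D}_r$ consists of all $X \subseteq V$ with $X \cap T \ne \emptyset$, $r \notin X \cup \Gamma(X)$ and $|\Gamma(X) \cap T| = k-1$. A step is one elementary operation of a random access machine that adds, truncatedly subtracts and compares natural numbers and that adds, subtracts and compares real numbers (the weights) and multiplies or divides them by computed natural numbers. -/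

import Mathlib

/-! ### Graphs, connectivity, domination, cuts -/

section Graphs

variable {V : Type*} [Fintype V] [DecidableEq V]

/-- `G` is a unit disk graph: the nodes can be placed in the Euclidean plane so that two distinct
nodes are adjacent if and only if their distance is at most one. -/
def IsUnitDiskGraph (G : SimpleGraph V) : Prop :=
  ∃ p : V → EuclideanSpace ℝ (Fin 2), ∀ u v, G.Adj u v ↔ u ≠ v ∧ dist (p u) (p v) ≤ 1

open Classical in
/-- The neighbour set `Γ(X)`: the nodes outside `X` with a neighbour in `X`. -/
noncomputable def nbrSet (G : SimpleGraph V) (X : Finset V) : Finset V :=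
  Finset.univ.filter fun v => v ∉ X ∧ ∃ u ∈ X, G.Adj u v

/-- The closed neighbourhood `X⁺ = X ∪ Γ(X)`. -/
noncomputable def closedNbr (G : SimpleGraph V) (X : Finset V) : Finset V :=
  X ∪ nbrSet G X

/-- The node set `U` is `k`-connected: `G[U]` stays connected after the removal of any set of
fewer than `k` nodes. A graph without nodes counts as connected here, so that a graph on at most
`k` nodes is `k`-connected exactly if it is complete, and every node set is `0`-connected. -/
def IsKConnected (G : SimpleGraph V) (k : ℕ) (U : Finset V) : Prop :=
  ∀ R : Finset V, R ⊆ U → R.card < k → (G.induce (↑(U \ R) : Set V)).Preconnected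

/-- `U` is an `m`-dominating set: every node outside `U` has at least `m` neighbours in `U`. -/
def IsDominating (G : SimpleGraph V) (m : ℕ) (U : Finset V) : Prop :=
  ∀ v, v ∉ U → m ≤ (nbrSet G {v} ∩ U).card

/-- `U` is a `k`-connected `m`-dominating set, a `(k,m)`-CDS. -/
def IsCDS (G : SimpleGraph V) (k m : ℕ) (U : Finset V) : Prop :=
  IsKConnected G k U ∧ IsDominating G m U

/-- `S` is a feasible solution of the augmentation problem for `T` with requirement `k`. -/
def IsAugmentation (G : SimpleGraph V) (k : ℕ) (T S : Finset V) : Prop :=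
  Disjoint S T ∧ IsKConnected G k (T ∪ S)

/-- `X` is a Steiner `(T,r)`-cut. -/
def IsSteinerCut (G : SimpleGraph V) (T : Finset V) (r : V) (X : Finset V) : Prop :=
  (X ∩ T).Nonempty ∧ (T \ closedNbr G X).Nonempty ∧ r ∉ closedNbr G X

/-- `X` is a demand cut for the root `r`: a Steiner `(T,r)`-cut with `|Γ_T(X)| = k - 1`. -/
def IsDemandCut (G : SimpleGraph V) (k : ℕ) (T : Finset V) (r : V) (X : Finset V) : Prop :=
  IsSteinerCut G T r X ∧ (nbrSet G X ∩ T).card + 1 = k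

/-- `x` is a feasible solution of the cut-covering linear program for the root `r`
(only the values of `x` outside `T` matter). -/
def IsLPFeasible (G : SimpleGraph V) (k : ℕ) (T : Finset V) (r : V) (x : V → ℝ) : Prop :=
  (∀ v, v ∉ T → 0 ≤ x v) ∧ ∀ X, IsDemandCut G k T r X → 1 ≤ ∑ v ∈ nbrSet G X \ T, x v

/-- The objective value of `x` in the cut-covering linear program. -/
def lpCost (w : V → ℝ) (T : Finset V) (x : V → ℝ) : ℝ :=
  ∑ v ∈ Finset.univ \ T, w v * x v

end Graphs

/-! ### Algorithms with a step count

A structured random access machine. Its memory consists of two-dimensional arrays of natural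
numbers and one-dimensional arrays of real numbers; a program refers to finitely many of them by
their names `0, 1, 2, …`. Natural numbers can be added, subtracted (truncated at zero) and
compared. Real numbers, which hold the weights, can be added, subtracted, compared, and multiplied
or divided by natural numbers that the program has computed. There is no product of two
variable real numbers, no product of natural numbers and no rounding, so that within polynomially
many steps all numbers keep polynomial bit length on inputs with rational weights.
Every evaluation of a node of an expression and every executed statement costs one step. -/

namespace Ram

/-- A memory content: `nat a i j` is entry `(i, j)` of the array `a` of natural numbers and
`real a i` is entry `i` of the array `a` of real numbers. -/
@[ext] structure Store where
  nat : ℕ → ℕ → ℕ → ℕ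
  real : ℕ → ℕ → ℝ

/-- Overwrite one entry of an array of natural numbers. -/
def Store.setNat (s : Store) (a i j x : ℕ) : Store where
  nat a' i' j' := if a' = a ∧ i' = i ∧ j' = j then x else s.nat a' i' j'
  real := s.real

/-- Overwrite one entry of an array of real numbers. -/
noncomputable def Store.setReal (s : Store) (a i : ℕ) (x : ℝ) : Store where
  nat := s.nat
  real a' i' := if a' = a ∧ i' = i then x else s.real a' i'

/-- Expressions for natural numbers. `lt e f` is the truth value (0 or 1) of `e < f`, and
`sum x b e` is the sum of the values of `e` with entry `(0, 0)` of array `x` set to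
`0, 1, …, b - 1`. -/
inductive NExpr : Type
  | const (c : ℕ)
  | read (a : ℕ) (i j : NExpr)
  | add (e f : NExpr)
  | sub (e f : NExpr)
  | lt (e f : NExpr)
  | sum (x : ℕ) (b e : NExpr)

def NExpr.eval : NExpr → Store → ℕ
  | const c, _ => c
  | read a i j, s => s.nat a (i.eval s) (j.eval s)
  | add e f, s => e.eval s + f.eval s
  | sub e f, s => e.eval s - f.eval s
  | lt e f, s => if e.eval s < f.eval s then 1 else 0
  | sum x b e, s => ∑ i ∈ Finset.range (b.eval s), e.eval (s.setNat x 0 0 i)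

/-- The number of steps for evaluating an expression; a sum is charged for all its terms. -/
def NExpr.cost : NExpr → Store → ℕ
  | const _, _ => 1
  | read _ i j, s => i.cost s + j.cost s + 1
  | add e f, s => e.cost s + f.cost s + 1
  | sub e f, s => e.cost s + f.cost s + 1
  | lt e f, s => e.cost s + f.cost s + 1
  | sum x b e, s =>
      b.cost s + 1 + ∑ i ∈ Finset.range (b.eval s), (e.cost (s.setNat x 0 0 i) + 1)

/-- Expressions for real numbers. -/
inductive RExpr : Type
  | zero
  | read (a : ℕ) (i : NExpr)
  | add (e f : RExpr)
  | sub (e f : RExpr)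
  | mulNat (e : RExpr) (i : NExpr)
  | divNat (e : RExpr) (i : NExpr)

noncomputable def RExpr.eval : RExpr → Store → ℝ
  | zero, _ => 0
  | read a i, s => s.real a (i.eval s)
  | add e f, s => e.eval s + f.eval s
  | sub e f, s => e.eval s - f.eval s
  | mulNat e i, s => e.eval s * (i.eval s : ℝ)
  | divNat e i, s => e.eval s / (i.eval s : ℝ)

def RExpr.cost : RExpr → Store → ℕ
  | zero, _ => 1
  | read _ i, s => i.cost s + 1
  | add e f, s => e.cost s + f.cost s + 1
  | sub e f, s => e.cost s + f.cost s + 1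
  | mulNat e i, s => e.cost s + i.cost s + 1
  | divNat e i, s => e.cost s + i.cost s + 1

/-- Conditions: a natural number is nonzero, or one real number is at most another. -/
inductive Test : Type
  | nonzero (e : NExpr)
  | le (e f : RExpr)

def Test.Holds : Test → Store → Prop
  | nonzero e, s => e.eval s ≠ 0
  | le e f, s => e.eval s ≤ f.eval s

def Test.cost : Test → Store → ℕ
  | nonzero e, s => e.cost s + 1
  | le e f, s => e.cost s + f.cost s + 1

/-- Programs. -/
inductive Program : Type
  | skip
  | setNat (a : ℕ) (i j e : NExpr)
  | setReal (a : ℕ) (i : NExpr) (e : RExpr)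
  | seq (P Q : Program)
  | ite (b : Test) (P Q : Program)
  | while (b : Test) (P : Program)

/-- `Exec P s t s'`: started on memory `s`, the program `P` halts after exactly `t` steps with
memory `s'`. -/
inductive Exec : Program → Store → ℕ → Store → Prop
  | skip (s : Store) : Exec .skip s 1 s
  | setNat (a : ℕ) (i j e : NExpr) (s : Store) :
      Exec (.setNat a i j e) s (i.cost s + j.cost s + e.cost s + 1)
        (s.setNat a (i.eval s) (j.eval s) (e.eval s))
  | setReal (a : ℕ) (i : NExpr) (e : RExpr) (s : Store) :
      Exec (.setReal a i e) s (i.cost s + e.cost s + 1) (s.setReal a (i.eval s) (e.eval s))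
  | seq {P Q : Program} {s s₁ s₂ : Store} {t₁ t₂ : ℕ} :
      Exec P s t₁ s₁ → Exec Q s₁ t₂ s₂ → Exec (.seq P Q) s (t₁ + t₂) s₂
  | iteTrue {b : Test} {P Q : Program} {s s₁ : Store} {t : ℕ} :
      b.Holds s → Exec P s t s₁ → Exec (.ite b P Q) s (b.cost s + t) s₁
  | iteFalse {b : Test} {P Q : Program} {s s₁ : Store} {t : ℕ} :
      ¬ b.Holds s → Exec Q s t s₁ → Exec (.ite b P Q) s (b.cost s + t) s₁
  | whileFalse {b : Test} {P : Program} {s : Store} :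
      ¬ b.Holds s → Exec (.while b P) s (b.cost s) s
  | whileTrue {b : Test} {P : Program} {s s₁ s₂ : Store} {t₁ t₂ : ℕ} :
      b.Holds s → Exec P s t₁ s₁ → Exec (.while b P) s₁ t₂ s₂ →
        Exec (.while b P) s (b.cost s + t₁ + t₂) s₂

/-- Programs are deterministic. -/
theorem Exec.deterministic {P : Program} {s s₁ s₂ : Store} {t₁ t₂ : ℕ}
    (h₁ : Exec P s t₁ s₁) (h₂ : Exec P s t₂ s₂) : t₁ = t₂ ∧ s₁ = s₂ := by
  induction h₁ generalizing t₂ s₂ with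
  | skip => cases h₂; exact ⟨rfl, rfl⟩
  | setNat => cases h₂; exact ⟨rfl, rfl⟩
  | setReal => cases h₂; exact ⟨rfl, rfl⟩
  | seq _ _ ih₁ ih₂ =>
    cases h₂ with
    | seq k₁ k₂ =>
      obtain ⟨rfl, rfl⟩ := ih₁ k₁
      obtain ⟨rfl, rfl⟩ := ih₂ k₂
      exact ⟨rfl, rfl⟩
  | iteTrue hb _ ih =>
    cases h₂ with
    | iteTrue _ k =>
      obtain ⟨rfl, rfl⟩ := ih k
      exact ⟨rfl, rfl⟩
    | iteFalse hb' _ => exact absurd hb hb'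
  | iteFalse hb _ ih =>
    cases h₂ with
    | iteTrue hb' _ => exact absurd hb' hb
    | iteFalse _ k =>
      obtain ⟨rfl, rfl⟩ := ih k
      exact ⟨rfl, rfl⟩
  | whileFalse hb =>
    cases h₂ with
    | whileFalse _ => exact ⟨rfl, rfl⟩
    | whileTrue hb' _ _ => exact absurd hb' hb
  | whileTrue hb _ _ ih₁ ih₂ =>
    cases h₂ with
    | whileFalse hb' => exact absurd hb hb'
    | whileTrue _ k₁ k₂ =>
      obtain ⟨rfl, rfl⟩ := ih₁ k₁
      obtain ⟨rfl, rfl⟩ := ih₂ k₂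
      exact ⟨rfl, rfl⟩

open Classical in
/-- The initial memory for an instance of the augmentation problem on the nodes `0, …, n - 1`:
arrays `0`, `1`, `2` hold `n`, `k`, `m` in entry `(0, 0)`, array `3` holds the adjacency matrix of
`G`, row `0` of array `4` holds the indicator vector of `T`, and the array `0` of real numbers holds
the weights. All other entries are zero. -/
noncomputable def input (n k m : ℕ) (G : SimpleGraph (Fin n)) (w : Fin n → ℝ)
    (T : Finset (Fin n)) : Store where
  nat a i j :=
    if a = 0 ∧ i = 0 ∧ j = 0 then n
    else if a = 1 ∧ i = 0 ∧ j = 0 then k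
    else if a = 2 ∧ i = 0 ∧ j = 0 then m
    else if a = 3 then
      if ∃ (hi : i < n) (hj : j < n), G.Adj ⟨i, hi⟩ ⟨j, hj⟩ then 1 else 0
    else if a = 4 ∧ i = 0 then
      if ∃ hj : j < n, (⟨j, hj⟩ : Fin n) ∈ T then 1 else 0
    else 0
  real a i := if h : a = 0 ∧ i < n then w ⟨i, h.2⟩ else 0

/-- The output: the nodes whose entry in row `0` of array `5` is nonzero. -/
def output (n : ℕ) (s : Store) : Finset (Fin n) :=
  Finset.univ.filter fun v : Fin n => s.nat 5 0 v ≠ 0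

end Ram

/-!
The algorithm is a primal-dual algorithm that is run for each of the first `k` nodes of `T` as the
root `r`, followed by the union of the sets of nodes bought for the single roots. If `T` has fewer
than `k` nodes, then domination forces `T` to contain all nodes, and nothing has to be bought.
Otherwise a separator of `T ∪ S` with fewer than `k` nodes misses one of the `k` roots, so that it
suffices to meet the neighbourhoods of all demand cuts for each root
(`isKConnected_union_of_roots`).

*Covering by arcs.* For a fixed root, buying a node `v` is modelled by buying arcs `(v, t)` with `t
∈ T`; a set `X` is entered by `(v, t)` if `t ∈ X` and `v ∉ X`. Demand cuts that share a node of `T`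
are closed under intersection and union, by submodularity and since `T` is `(k - 1)`-connected
(`IsViolated.inter_union`). The growth phase repeatedly takes a minimal violated set `C`, i.e. a
demand cut that no arc enters yet, and raises its dual variable until some arc that enters `C`
becomes tight (`IsHistory`, `IsHistory.grow`). Here an arc `(v, t)` stands for a path from `v` to
`t` all of whose nodes except `t` are outside `T`: either an edge, or an edge from `v` to some `u`
followed by the path of an arc `(u, t)` bought before. Its price is the sum of the dual variables of
the sets that contain `t`, which is at least the weight of the path.

*The price of a cover.* Reverse deletion leaves arcs all of which are needed. If two of them entered
the same minimal violated set, then the union of two demand cuts that need them would be entered by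
no arc; so each dual variable is paid for at most once, and the price of the remaining arcs is at
most the dual value (`card_entering_le_one`, `IsReverseDeletion`). The nodes on the paths of these
arcs meet all demand cuts and are paid for by the arcs (`IsPartialRecovery`).

*Weak duality.* For nodes `q ∈ T` and `v ∉ T`, the sets that contain `q` and have `v` as a neighbour
form a chain, and their dual values sum up to at most `w v` (`IsHistory.load_le`). In a unit disk
graph some `81 k` nodes of `T` near `v` meet all demand cuts with `v` as a neighbour, since a cell
of a grid of side length `1/2` induces a clique (`IsUnitDiskGraph.exists_hitting_set`). Hence the
dual value is at most `81 k` times the value of the linear program (`IsHistory.dualValue_le`), and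
the root with the largest dual value bounds the cost of all `k` roots by `81 k ^ 2` times the value
of its linear program. The bound for feasible sets follows, as the indicator vector of a feasible
set is a feasible solution.

*Minimal violated sets.* The smallest violated set with a given node `s ∈ T` consists of the nodes
of `T` that are reachable from `s` by alternating paths for a maximum assignment of neighbours in
`T`, in which `s` may get any number of nodes and every other node one, together with the tails of
the arcs with head in it (`IsSearchState.of_stuck`, `IsSearchState.smallest_violated`).

*Running time.* All programs are built from assignments, case distinctions and loops with exactly
`n` rounds. The number of steps of such a program is at most a polynomial in `n` that is read off
from its text (`Ram.Structured.exec_run`).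
-/

/-! ### Cuts in graphs -/

section Cuts

variable {V : Type*} [Fintype V] [DecidableEq V] {G : SimpleGraph V}

theorem mem_nbrSet {X : Finset V} {v : V} :
    v ∈ nbrSet G X ↔ v ∉ X ∧ ∃ u ∈ X, G.Adj u v := by
  simp [nbrSet]

theorem mem_closedNbr {X : Finset V} {v : V} :
    v ∈ closedNbr G X ↔ v ∈ X ∨ ∃ u ∈ X, G.Adj u v := by
  simp only [closedNbr, Finset.mem_union, mem_nbrSet]
  tauto

theorem mem_nbrSet_singleton {u v : V} : v ∈ nbrSet G {u} ↔ G.Adj u v := by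
  rw [mem_nbrSet]
  simp only [Finset.mem_singleton, exists_eq_left, and_iff_right_iff_imp]
  rintro h rfl
  exact G.loopless.irrefl _ h

theorem nbrSet_subset_closedNbr (X : Finset V) : nbrSet G X ⊆ closedNbr G X :=
  Finset.subset_union_right

theorem closedNbr_mono {X Y : Finset V} (h : X ⊆ Y) : closedNbr G X ⊆ closedNbr G Y := by
  intro v
  rw [mem_closedNbr, mem_closedNbr]
  rintro (hv | ⟨u, hu, ha⟩)
  · exact Or.inl (h hv)
  · exact Or.inr ⟨u, h hu, ha⟩

theorem closedNbr_union (X Y : Finset V) :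
    closedNbr G (X ∪ Y) = closedNbr G X ∪ closedNbr G Y := by
  ext v
  simp only [mem_closedNbr, Finset.mem_union]
  grind

/-- Submodularity of the number of neighbours of a node set inside a fixed set. -/
theorem card_nbrSet_inter_add_le (X Y T : Finset V) :
    (nbrSet G (X ∩ Y) ∩ T).card + (nbrSet G (X ∪ Y) ∩ T).card ≤
      (nbrSet G X ∩ T).card + (nbrSet G Y ∩ T).card := by
  have e : ∀ Z : Finset V, (nbrSet G Z ∩ T).card = ∑ v ∈ T, if v ∈ nbrSet G Z then 1 else 0 := by
    intro Z
    rw [Finset.inter_comm, ← Finset.filter_mem_eq_inter, Finset.card_filter]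
  rw [e, e, e, e, ← Finset.sum_add_distrib, ← Finset.sum_add_distrib]
  refine Finset.sum_le_sum fun v _ => ?_
  have h1 : v ∈ nbrSet G (X ∩ Y) → (v ∈ nbrSet G X ∨ v ∈ X) ∧ (v ∈ nbrSet G Y ∨ v ∈ Y) ∧
      ¬ (v ∈ X ∧ v ∈ Y) := by
    simp only [mem_nbrSet, Finset.mem_inter]
    grind
  have h2 : v ∈ nbrSet G (X ∪ Y) → (v ∈ nbrSet G X ∨ v ∈ nbrSet G Y) ∧ v ∉ X ∧ v ∉ Y := by
    simp only [mem_nbrSet, Finset.mem_union]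
    grind
  have h3 : v ∈ nbrSet G X → v ∉ X := fun h => (mem_nbrSet.1 h).1
  have h4 : v ∈ nbrSet G Y → v ∉ Y := fun h => (mem_nbrSet.1 h).1
  split_ifs <;> first | omega | (exfalso; tauto)

/-- If `U` is `j`-connected and meets both `X` and the complement of the closed neighbourhood of
`X`, then `X` has at least `j` neighbours in `U`. -/
theorem le_card_nbrSet_inter {j : ℕ} {U X : Finset V} (hU : IsKConnected G j U) {a b : V}
    (ha : a ∈ X) (haU : a ∈ U) (hb : b ∉ closedNbr G X) (hbU : b ∈ U) :
    j ≤ (nbrSet G X ∩ U).card := by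
  by_contra hlt
  have hpre := hU _ Finset.inter_subset_right (not_le.1 hlt)
  have ha' : a ∈ (↑(U \ (nbrSet G X ∩ U)) : Set V) := by
    simp [haU, mem_nbrSet, ha]
  have hb' : b ∈ (↑(U \ (nbrSet G X ∩ U)) : Set V) := by
    have : b ∉ nbrSet G X := fun h => hb (nbrSet_subset_closedNbr X h)
    simp [hbU, this]
  obtain ⟨p⟩ := hpre ⟨a, ha'⟩ ⟨b, hb'⟩
  have key : ∀ (x y : (↑(U \ (nbrSet G X ∩ U)) : Set V)),
      (G.induce (↑(U \ (nbrSet G X ∩ U)) : Set V)).Walk x y → x.1 ∈ X → y.1 ∈ X := by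
    intro x y p
    induction p with
    | nil => exact id
    | @cons u v w h p ih =>
      intro hu
      apply ih
      by_contra hv
      have hadj : G.Adj u.1 v.1 := h
      have h1 : v.1 ∈ nbrSet G X := mem_nbrSet.2 ⟨hv, u.1, hu, hadj⟩
      have h2 := v.2
      simp only [Finset.coe_sdiff, Finset.coe_inter, Set.mem_sdiff, Set.mem_inter_iff,
        Finset.mem_coe, not_and] at h2
      exact h2.2 h1 h2.1
  exact hb (mem_closedNbr.2 (Or.inl (key _ _ p ha)))

theorem isKConnected_of_forall_cut {k : ℕ} {U : Finset V}
    (h : ∀ X ⊆ U, ∀ a ∈ X, ∀ b ∈ U, b ∉ closedNbr G X → k ≤ (nbrSet G X ∩ U).card) :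
    IsKConnected G k U := by
  classical
  intro R hRU hR a b
  by_contra hab
  set H := G.induce (↑(U \ R) : Set V)
  let X : Finset V :=
    Finset.univ.filter fun x => ∃ hx : x ∈ (↑(U \ R) : Set V), H.Reachable a ⟨x, hx⟩
  have memX : ∀ x, x ∈ X ↔ ∃ hx : x ∈ (↑(U \ R) : Set V), H.Reachable a ⟨x, hx⟩ := by
    intro x; simp [X]
  have hXU : X ⊆ U := by
    intro x hx
    obtain ⟨h1, _⟩ := (memX x).1 hx
    exact (Finset.mem_sdiff.1 (Finset.mem_coe.1 h1)).1
  have hN : nbrSet G X ∩ U ⊆ R := by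
    intro y hy
    obtain ⟨hy1, hyU⟩ := Finset.mem_inter.1 hy
    obtain ⟨hyX, x, hx, hadj⟩ := mem_nbrSet.1 hy1
    by_contra hyR
    obtain ⟨hx1, hx2⟩ := (memX x).1 hx
    have hy' : y ∈ (↑(U \ R) : Set V) := by simp [hyU, hyR]
    refine hyX ((memX y).2 ⟨hy', hx2.trans ?_⟩)
    exact SimpleGraph.Adj.reachable (show H.Adj ⟨x, hx1⟩ ⟨y, hy'⟩ from hadj)
  have hbU := Finset.mem_sdiff.1 (Finset.mem_coe.1 b.2)
  have hbX : b.1 ∉ X := fun hb => hab ((memX _).1 hb).2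
  have := h X hXU a.1 ((memX _).2 ⟨a.2, SimpleGraph.Reachable.refl _⟩) b.1 hbU.1 (by
    intro hb
    rcases Finset.mem_union.1 hb with hb | hb
    · exact hbX hb
    · exact hbU.2 (hN (Finset.mem_inter.2 ⟨hb, hbU.1⟩)))
  exact absurd (this.trans (Finset.card_le_card hN)) (not_le.2 hR)

/-- In an `m`-dominating set with `m ≥ k`, a node set with fewer than `k` neighbours in `T`
contains a node of `T` in the closed neighbourhood of each of its nodes. -/
theorem exists_terminal_near {m k : ℕ} {T X : Finset V} (hT : IsDominating G m T) (hkm : k ≤ m)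
    (hX : (nbrSet G X ∩ T).card < k) {u : V} (hu : u ∈ X) :
    ∃ t ∈ X ∩ T, t = u ∨ G.Adj u t := by
  by_cases huT : u ∈ T
  · exact ⟨u, Finset.mem_inter.2 ⟨hu, huT⟩, Or.inl rfl⟩
  · have h1 := hT u huT
    have h2 : ¬ nbrSet G {u} ∩ T ⊆ nbrSet G X ∩ T := fun h => by
      have := Finset.card_le_card h
      omega
    obtain ⟨t, ht, ht'⟩ := Finset.not_subset.1 h2
    obtain ⟨ht1, htT⟩ := Finset.mem_inter.1 ht
    have hadj := mem_nbrSet_singleton.1 ht1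
    refine ⟨t, Finset.mem_inter.2 ⟨?_, htT⟩, Or.inr hadj⟩
    by_contra htX
    exact ht' (Finset.mem_inter.2 ⟨mem_nbrSet.2 ⟨htX, u, hu, hadj⟩, htT⟩)

/-- If `T` is a `(k-1,m)`-CDS with `m ≥ k`, then `T ∪ S` is `k`-connected as soon as `S` hits `Γ(X)`
for all demand cuts `X` of at least `k` roots: a separator with fewer than `k` nodes misses one of
the roots. -/
theorem isKConnected_union_of_roots {k m : ℕ} {T S roots : Finset V}
    (hT : IsCDS G (k - 1) m T) (hkm : k ≤ m) (hroots : roots ⊆ T) (hcard : k ≤ roots.card)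
    (hS : Disjoint S T)
    (hcov : ∀ r ∈ roots, ∀ X, (X ∩ T).Nonempty → r ∉ closedNbr G X →
      (nbrSet G X ∩ T).card < k → (nbrSet G X ∩ S).Nonempty) :
    IsKConnected G k (T ∪ S) := by
  apply isKConnected_of_forall_cut
  intro X hXU a ha b hbU hbX
  by_contra hlt
  rw [not_le] at hlt
  have sub : ∀ Z : Finset V, nbrSet G Z ∩ T ⊆ nbrSet G Z ∩ (T ∪ S) := fun Z =>
    Finset.inter_subset_inter_left Finset.subset_union_left
  have main : ∀ Z : Finset V, (nbrSet G Z ∩ (T ∪ S)).card < k → Z.Nonempty →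
      ∀ r ∈ roots, r ∉ closedNbr G Z → False := by
    intro Z hZ hne r hr hrZ
    have hlt' := (Finset.card_le_card (sub Z)).trans_lt hZ
    obtain ⟨u, hu⟩ := hne
    obtain ⟨t, ht, -⟩ := exists_terminal_near hT.2 hkm hlt' hu
    have h1 := le_card_nbrSet_inter hT.1 (Finset.mem_inter.1 ht).1 (Finset.mem_inter.1 ht).2 hrZ
      (hroots hr)
    obtain ⟨s, hs⟩ := hcov r hr Z ⟨t, ht⟩ hrZ hlt'
    have h2 : (nbrSet G Z ∩ T).card < (nbrSet G Z ∩ (T ∪ S)).card := by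
      apply Finset.card_lt_card
      refine ⟨sub Z, fun h => ?_⟩
      have hs1 := Finset.mem_inter.1 hs
      have := h (Finset.mem_inter.2 ⟨hs1.1, Finset.mem_union_right _ hs1.2⟩)
      exact Finset.disjoint_left.1 hS hs1.2 (Finset.mem_inter.1 this).2
    omega
  have hr : ¬ roots ⊆ nbrSet G X ∩ (T ∪ S) := fun h => by
    have := Finset.card_le_card h
    omega
  obtain ⟨r, hr, hr'⟩ := Finset.not_subset.1 hr
  have hrU : r ∈ T ∪ S := Finset.mem_union_left _ (hroots hr)
  have hrN : r ∉ nbrSet G X := fun h => hr' (Finset.mem_inter.2 ⟨h, hrU⟩)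
  by_cases hrX : r ∈ X
  · -- The root is inside `X`, so the other side of the separator is a cut for it.
    let Y := (T ∪ S) \ closedNbr G X
    have hY : nbrSet G Y ∩ (T ∪ S) ⊆ nbrSet G X ∩ (T ∪ S) := by
      intro y hy
      obtain ⟨hy1, hyU⟩ := Finset.mem_inter.1 hy
      obtain ⟨hyY, z, hz, hadj⟩ := mem_nbrSet.1 hy1
      have hyX : y ∈ closedNbr G X := by
        by_contra h
        exact hyY (Finset.mem_sdiff.2 ⟨hyU, h⟩)
      rcases Finset.mem_union.1 hyX with h | h
      · exact absurd (mem_closedNbr.2 (Or.inr ⟨y, h, hadj.symm⟩)) (Finset.mem_sdiff.1 hz).2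
      · exact Finset.mem_inter.2 ⟨h, hyU⟩
    refine main Y ((Finset.card_le_card hY).trans_lt hlt) ⟨b, Finset.mem_sdiff.2 ⟨hbU, hbX⟩⟩ r hr ?_
    rw [mem_closedNbr]
    rintro (h | ⟨z, hz, hadj⟩)
    · exact (Finset.mem_sdiff.1 h).2 (mem_closedNbr.2 (Or.inl hrX))
    · exact (Finset.mem_sdiff.1 hz).2 (mem_closedNbr.2 (Or.inr ⟨r, hrX, hadj.symm⟩))
  · refine main X hlt ⟨a, ha⟩ r hr ?_
    intro h
    rcases Finset.mem_union.1 h with h | h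
    · exact hrX h
    · exact hrN h

/-- A feasible solution hits the neighbourhood of every demand cut. -/
theorem IsAugmentation.nbrSet_inter_nonempty {k : ℕ} {T S X : Finset V} {r : V}
    (hS : IsAugmentation G k T S) (hr : r ∈ T) (hX : (X ∩ T).Nonempty)
    (hrX : r ∉ closedNbr G X) (hlt : (nbrSet G X ∩ T).card < k) : (nbrSet G X ∩ S).Nonempty := by
  obtain ⟨t, ht⟩ := hX
  rw [Finset.mem_inter] at ht
  have h := le_card_nbrSet_inter hS.2 ht.1 (Finset.mem_union_left _ ht.2) hrX
    (Finset.mem_union_left _ hr)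
  rw [Finset.inter_union_distrib_left] at h
  have h2 := Finset.card_union_le (nbrSet G X ∩ T) (nbrSet G X ∩ S)
  exact Finset.card_pos.1 (by omega)

/-- The indicator vector of a feasible solution is feasible for the linear program. -/
theorem IsAugmentation.isLPFeasible_indicator {k : ℕ} {T S : Finset V} {r : V}
    (hS : IsAugmentation G k T S) (hr : r ∈ T) :
    IsLPFeasible G k T r (fun v => if v ∈ S then 1 else 0) := by
  refine ⟨fun v _ => by positivity, fun X hX => ?_⟩
  obtain ⟨v, hv⟩ := hS.nbrSet_inter_nonempty hr hX.1.1 hX.1.2.2 (by have := hX.2; omega)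
  rw [Finset.mem_inter] at hv
  have hvT : v ∉ T := Finset.disjoint_left.1 hS.1 hv.2
  calc (1 : ℝ) = if v ∈ S then 1 else 0 := by simp [hv.2]
    _ ≤ _ := Finset.single_le_sum (f := fun v => if v ∈ S then (1 : ℝ) else 0)
      (fun i _ => by positivity) (Finset.mem_sdiff.2 ⟨hv.1, hvT⟩)

theorem IsAugmentation.lpCost_indicator {k : ℕ} {T S : Finset V} (hS : IsAugmentation G k T S)
    (w : V → ℝ) : lpCost w T (fun v => if v ∈ S then 1 else 0) = ∑ v ∈ S, w v := by
  have h : S ⊆ Finset.univ \ T := fun v hv =>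
    Finset.mem_sdiff.2 ⟨Finset.mem_univ _, Finset.disjoint_left.1 hS.1 hv⟩
  simp only [lpCost, mul_ite, mul_one, mul_zero]
  rw [Finset.sum_ite_mem, Finset.inter_eq_right.2 h]

end Cuts

/-! ### Violated sets -/

section Violated

variable {V : Type*} [Fintype V] [DecidableEq V] {G : SimpleGraph V} {k : ℕ} {T : Finset V} {r : V}

/-- An arc is a pair `(v, t)` of a node `v ∉ T` and a node `t ∈ T`; it enters `X` if `t ∈ X` and `v
∉ X`. The set `X` is violated with respect to a set `A` of arcs if it is a demand cut for the root
`r` that no arc of `A` enters. The condition `|Γ(X) ∩ T| < k` is the one of a demand cut if `T` is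
`(k - 1)`-connected (`IsViolated.isDemandCut`). -/
def IsViolated (G : SimpleGraph V) (k : ℕ) (T : Finset V) (r : V) (A : Finset (V × V))
    (X : Finset V) : Prop :=
  (X ∩ T).Nonempty ∧ r ∉ closedNbr G X ∧ (nbrSet G X ∩ T).card < k ∧ ∀ p ∈ A, p.2 ∈ X → p.1 ∈ X

/-- `C` is inclusion-minimal among the violated sets. -/
def IsMinViolated (G : SimpleGraph V) (k : ℕ) (T : Finset V) (r : V) (A : Finset (V × V))
    (C : Finset V) : Prop :=
  IsViolated G k T r A C ∧ ∀ X, IsViolated G k T r A X → X ⊆ C → X = C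

theorem IsViolated.mono {A B : Finset (V × V)} {X : Finset V} (h : IsViolated G k T r B X)
    (hAB : A ⊆ B) : IsViolated G k T r A X :=
  ⟨h.1, h.2.1, h.2.2.1, fun p hp => h.2.2.2 p (hAB hp)⟩

theorem IsViolated.le_card (hT : IsKConnected G (k - 1) T) (hr : r ∈ T) {A : Finset (V × V)}
    {X : Finset V} (h : IsViolated G k T r A X) : k - 1 ≤ (nbrSet G X ∩ T).card := by
  obtain ⟨t, ht⟩ := h.1
  rw [Finset.mem_inter] at ht
  exact le_card_nbrSet_inter hT ht.1 ht.2 h.2.1 hr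

theorem IsViolated.isDemandCut (hT : IsKConnected G (k - 1) T) (hr : r ∈ T)
    {A : Finset (V × V)} {X : Finset V} (h : IsViolated G k T r A X) :
    IsDemandCut G k T r X := by
  refine ⟨⟨h.1, ⟨r, Finset.mem_sdiff.2 ⟨hr, h.2.1⟩⟩, h.2.1⟩, ?_⟩
  have := h.le_card hT hr
  have := h.2.2.1
  omega

/-- Violated sets that share a node of `T` are closed under intersection and union. -/
theorem IsViolated.inter_union (hT : IsKConnected G (k - 1) T) (hr : r ∈ T)
    {A : Finset (V × V)} {X Y : Finset V} (hX : IsViolated G k T r A X)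
    (hY : IsViolated G k T r A Y) {t : V} (htX : t ∈ X) (htY : t ∈ Y) (htT : t ∈ T) :
    IsViolated G k T r A (X ∩ Y) ∧ IsViolated G k T r A (X ∪ Y) := by
  have hr1 : r ∉ closedNbr G (X ∩ Y) := fun h => hX.2.1 (closedNbr_mono Finset.inter_subset_left h)
  have hr2 : r ∉ closedNbr G (X ∪ Y) := by
    rw [closedNbr_union, Finset.mem_union]
    exact fun h => h.elim hX.2.1 hY.2.1
  have h1 := le_card_nbrSet_inter hT (Finset.mem_inter.2 ⟨htX, htY⟩) htT hr1 hr
  have h2 := le_card_nbrSet_inter hT (Finset.mem_union_left Y htX) htT hr2 hr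
  have h3 := card_nbrSet_inter_add_le (G := G) X Y T
  have h4 := hX.2.2.1
  have h5 := hY.2.2.1
  refine ⟨⟨⟨t, by simp [htX, htY, htT]⟩, hr1, by omega, fun p hp hpt => ?_⟩,
    ⟨⟨t, by simp [htX, htT]⟩, hr2, by omega, fun p hp hpt => ?_⟩⟩
  · rw [Finset.mem_inter] at hpt ⊢
    exact ⟨hX.2.2.2 p hp hpt.1, hY.2.2.2 p hp hpt.2⟩
  · rw [Finset.mem_union] at hpt ⊢
    exact hpt.imp (hX.2.2.2 p hp) (hY.2.2.2 p hp)

theorem IsMinViolated.subset (hT : IsKConnected G (k - 1) T) (hr : r ∈ T)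
    {A : Finset (V × V)} {C X : Finset V} (hC : IsMinViolated G k T r A C)
    (hX : IsViolated G k T r A X) {t : V} (htC : t ∈ C) (htX : t ∈ X) (htT : t ∈ T) : C ⊆ X := by
  have h := hC.2 _ (hC.1.inter_union hT hr hX htC htX htT).1 Finset.inter_subset_left
  rw [← h]
  exact Finset.inter_subset_right

/-- A minimal violated set consists of nodes of `T` and of tails of arcs with head in it. -/
theorem IsMinViolated.mem_terminal_or_tail {A : Finset (V × V)} {C : Finset V}
    (hC : IsMinViolated G k T r A C) {u : V} (hu : u ∈ C) :
    u ∈ T ∨ ∃ t ∈ C, (u, t) ∈ A := by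
  by_contra! hne
  have hsub : C.erase u ⊆ C := Finset.erase_subset _ _
  have hterm : ∀ t ∈ C, t ∈ T → t ∈ C.erase u := fun t ht htT =>
    Finset.mem_erase.2 ⟨fun h => hne.1 (h ▸ htT), ht⟩
  have hv : IsViolated G k T r A (C.erase u) := by
    obtain ⟨t, ht⟩ := hC.1.1
    rw [Finset.mem_inter] at ht
    refine ⟨⟨t, Finset.mem_inter.2 ⟨hterm t ht.1 ht.2, ht.2⟩⟩,
      fun h => hC.1.2.1 (closedNbr_mono hsub h), ?_, fun p hp hpt => ?_⟩
    · refine (Finset.card_le_card fun y hy => ?_).trans_lt hC.1.2.2.1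
      obtain ⟨hy1, hyT⟩ := Finset.mem_inter.1 hy
      obtain ⟨hyX, z, hz, hadj⟩ := mem_nbrSet.1 hy1
      exact Finset.mem_inter.2 ⟨mem_nbrSet.2 ⟨fun h => hyX (hterm y h hyT), z, hsub hz, hadj⟩, hyT⟩
    · refine Finset.mem_erase.2 ⟨fun h => ?_, hC.1.2.2.2 p hp (hsub hpt)⟩
      exact hne.2 p.2 (hsub hpt) (by rw [← h]; exact hp)
  have := hC.2 _ hv hsub
  rw [← this] at hu
  exact Finset.notMem_erase u C hu

/-- The exactness of covering by arcs: if every arc of a cover `B` is needed, then at most one of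
them enters a given minimal violated set. For two such arcs `a` and `b`, sets `X` and `Y` that
are entered only by `a` and only by `b` would both contain `C`, so that no arc at all would enter
`X ∪ Y`, which would be violated. -/
theorem card_entering_le_one (hT : IsKConnected G (k - 1) T) (hr : r ∈ T)
    {A B : Finset (V × V)} {C : Finset V} (hC : IsMinViolated G k T r A C)
    (hcov : ∀ X, ¬ IsViolated G k T r (A ∪ B) X)
    (hmin : ∀ b ∈ B, ∃ X, IsViolated G k T r (A ∪ B.erase b) X) (hBT : ∀ b ∈ B, b.2 ∈ T) :
    (B.filter fun b => b.2 ∈ C ∧ b.1 ∉ C).card ≤ 1 := by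
  rw [Finset.card_le_one]
  intro a ha b hb
  rw [Finset.mem_filter] at ha hb
  by_contra hab
  have aux : ∀ c ∈ B, c.2 ∈ C → ∃ X, IsViolated G k T r (A ∪ B.erase c) X ∧ C ⊆ X ∧ c.1 ∉ X := by
    intro c hc hcC
    obtain ⟨X, hX⟩ := hmin c hc
    have hent : c.2 ∈ X ∧ c.1 ∉ X := by
      by_contra hne
      refine hcov X ⟨hX.1, hX.2.1, hX.2.2.1, fun p hp hpX => ?_⟩
      by_cases hpc : p = c
      · subst hpc
        by_contra h
        exact hne ⟨hpX, h⟩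
      · refine hX.2.2.2 p ?_ hpX
        simp only [Finset.mem_union, Finset.mem_erase] at hp ⊢
        tauto
    exact ⟨X, hX, hC.subset hT hr (hX.mono Finset.subset_union_left) hcC hent.1 (hBT c hc), hent.2⟩
  obtain ⟨X, hX, hCX, haX⟩ := aux a ha.1 ha.2.1
  obtain ⟨Y, hY, hCY, hbY⟩ := aux b hb.1 hb.2.1
  have haY : a.1 ∈ Y := hY.2.2.2 a
    (Finset.mem_union_right _ (Finset.mem_erase.2 ⟨hab, ha.1⟩)) (hCY ha.2.1)
  have hbX : b.1 ∈ X := hX.2.2.2 b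
    (Finset.mem_union_right _ (Finset.mem_erase.2 ⟨Ne.symm hab, hb.1⟩)) (hCX hb.2.1)
  have hU := ((hX.mono Finset.subset_union_left).inter_union hT hr
    (hY.mono Finset.subset_union_left) (hCX ha.2.1) (hCY ha.2.1) (hBT a ha.1)).2
  refine hcov (X ∪ Y) ⟨hU.1, hU.2.1, hU.2.2.1, fun p hp hpU => ?_⟩
  by_cases hpa : p = a
  · subst hpa; exact Finset.mem_union_right _ haY
  by_cases hpb : p = b
  · subst hpb; exact Finset.mem_union_left _ hbX
  have hpX : p ∈ A ∪ B.erase a := by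
    simp only [Finset.mem_union, Finset.mem_erase] at hp ⊢; tauto
  have hpY : p ∈ A ∪ B.erase b := by
    simp only [Finset.mem_union, Finset.mem_erase] at hp ⊢; tauto
  rw [Finset.mem_union] at hpU ⊢
  exact hpU.imp (hX.2.2.2 p hpX) (hY.2.2.2 p hpY)

end Violated

/-! ### Histories of the growth phase -/

section History

set_option linter.unusedSectionVars false

variable {V : Type*} [Fintype V] [DecidableEq V]

/-- One step of the growth phase: the dual variable of the minimal violated set `core` is raised by
`eps`, and then the arc `arc` is bought, at the price `cost`. The node `par` is the next node on the
path from the tail of the arc to its head that is bought with the arc. -/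
structure Step (V : Type*) where
  core : Finset V
  eps : ℝ
  arc : V × V
  par : V
  cost : ℝ

/-- The height of `t`: the sum of the dual variables of the sets that contain `t`. -/
def height : List (Step V) → V → ℝ
  | [], _ => 0
  | s :: L, t => height L t + if t ∈ s.core then s.eps else 0

/-- The arcs bought in a list of steps. -/
def arcs : List (Step V) → Finset (V × V)
  | [] => ∅
  | s :: L => insert s.arc (arcs L)

/-- A list of steps, the last one first, is a possible history of the growth phase: in each step the
set is minimal violated and its dual variable is raised until some arc `(v, t)` that enters the set
becomes tight, either since `v` is adjacent to `t` and the dual variables of the sets containing `t`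
sum up to the weight of `v`, or since `v` is adjacent to `u` for an arc `(u, t)` bought before and
this sum exceeds the price of `(u, t)` by the weight of `v`. -/
def IsHistory (G : SimpleGraph V) (k : ℕ) (T : Finset V) (w : V → ℝ) (r : V) :
    List (Step V) → Prop
  | [] => True
  | s :: L =>
    IsHistory G k T w r L ∧ IsMinViolated G k T r (arcs L) s.core ∧ 0 ≤ s.eps ∧
    s.arc.2 ∈ s.core ∧ s.arc.2 ∈ T ∧ s.arc.1 ∉ s.core ∧ s.arc.1 ∉ T ∧
    (∀ v ∉ T, v ∉ s.core → ∀ t ∈ T, t ∈ s.core → G.Adj v t → height (s :: L) t ≤ w v) ∧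
    (∀ v ∉ T, v ∉ s.core → ∀ b ∈ L, b.arc.2 ∈ s.core → G.Adj v b.arc.1 →
      height (s :: L) b.arc.2 ≤ w v + b.cost) ∧
    s.cost = height (s :: L) s.arc.2 ∧ G.Adj s.arc.1 s.par ∧
    ((s.par = s.arc.2 ∧ w s.arc.1 ≤ s.cost) ∨
      ∃ b ∈ L, b.arc = (s.par, s.arc.2) ∧ w s.arc.1 + b.cost ≤ s.cost)

variable {G : SimpleGraph V} {k : ℕ} {T : Finset V} {w : V → ℝ} {r : V}

theorem mem_arcs {L : List (Step V)} {p : V × V} : p ∈ arcs L ↔ ∃ b ∈ L, b.arc = p := by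
  induction L with
  | nil => simp [arcs]
  | cons s L ih => simp [arcs, ih, eq_comm]

theorem IsHistory.head_mem {L : List (Step V)} (h : IsHistory G k T w r L) {b : Step V}
    (hb : b ∈ L) : b.arc.2 ∈ T ∧ b.arc.1 ∉ T := by
  induction L with
  | nil => simp at hb
  | cons s L ih =>
    rcases List.mem_cons.1 hb with rfl | hb
    · exact ⟨h.2.2.2.2.1, h.2.2.2.2.2.2.1⟩
    · exact ih h.1 hb

theorem IsHistory.arc_mem {L : List (Step V)} (h : IsHistory G k T w r L) {p : V × V}
    (hp : p ∈ arcs L) : p.2 ∈ T ∧ p.1 ∉ T := by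
  obtain ⟨b, hb, rfl⟩ := mem_arcs.1 hp
  exact h.head_mem hb

theorem IsHistory.notMem_arcs {s : Step V} {L : List (Step V)} (h : IsHistory G k T w r (s :: L)) :
    s.arc ∉ arcs L := fun hmem =>
  h.2.2.2.2.2.1 (h.2.1.1.2.2.2 _ hmem h.2.2.2.1)

theorem IsHistory.card_arcs {L : List (Step V)} (h : IsHistory G k T w r L) :
    (arcs L).card = L.length := by
  induction L with
  | nil => rfl
  | cons s L ih => rw [arcs, Finset.card_insert_of_notMem h.notMem_arcs, ih h.1, List.length_cons]

/-- Distinct arcs from outside `T` to `T` are fewer than all pairs. -/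
theorem IsHistory.length_lt {L : List (Step V)} (h : IsHistory G k T w r L) (hr : r ∈ T) :
    L.length < Fintype.card V * Fintype.card V := by
  rw [← h.card_arcs, ← Fintype.card_prod]
  refine Finset.card_lt_univ_of_notMem (x := (r, r)) fun hmem => ?_
  exact (h.arc_mem hmem).2 hr

theorem IsHistory.height_nonneg {L : List (Step V)} (h : IsHistory G k T w r L) (t : V) :
    0 ≤ height L t := by
  induction L with
  | nil => exact le_rfl
  | cons s L ih =>
    have := ih h.1
    have := h.2.2.1
    simp only [height]
    split_ifs <;> linarith

theorem IsHistory.height_le_cons {s : Step V} {L : List (Step V)}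
    (h : IsHistory G k T w r (s :: L)) (t : V) : height L t ≤ height (s :: L) t := by
  have := h.2.2.1
  simp only [height]
  split_ifs <;> linarith

theorem IsHistory.cost_le_height {L : List (Step V)} (h : IsHistory G k T w r L) {b : Step V}
    (hb : b ∈ L) : b.cost ≤ height L b.arc.2 := by
  induction L with
  | nil => simp at hb
  | cons s L ih =>
    rcases List.mem_cons.1 hb with rfl | hb
    · exact h.2.2.2.2.2.2.2.2.2.1.le
    · exact (ih h.1 hb).trans (h.height_le_cons _)

/-- A set of the history is contained in every later violated set that shares a node of `T`
with it. -/
theorem IsHistory.core_subset (hT : IsKConnected G (k - 1) T) (hr : r ∈ T) {L : List (Step V)}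
    (h : IsHistory G k T w r L) {X : Finset V} (hX : IsViolated G k T r (arcs L) X) {l : Step V}
    (hl : l ∈ L) {t : V} (htl : t ∈ l.core) (htX : t ∈ X) (htT : t ∈ T) : l.core ⊆ X := by
  induction L with
  | nil => simp at hl
  | cons s L ih =>
    have hX' : IsViolated G k T r (arcs L) X := hX.mono (Finset.subset_insert _ _)
    rcases List.mem_cons.1 hl with rfl | hl
    · exact h.2.1.subset hT hr hX' htl htX htT
    · exact ih h.1 hX' hl

/-- No arc that could be bought next is overpaid, so that the next increase is nonnegative. -/
theorem IsHistory.height_le_of_isViolated (hT : IsKConnected G (k - 1) T) (hr : r ∈ T)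
    (hw : ∀ v, 0 ≤ w v) {L : List (Step V)} (h : IsHistory G k T w r L) {X : Finset V}
    (hX : IsViolated G k T r (arcs L) X) {v : V} (hvT : v ∉ T) (hvX : v ∉ X) :
    (∀ t ∈ T, t ∈ X → G.Adj v t → height L t ≤ w v) ∧
    (∀ b ∈ L, b.arc.2 ∈ X → G.Adj v b.arc.1 → height L b.arc.2 ≤ w v + b.cost) := by
  induction L with
  | nil => exact ⟨fun _ _ _ _ => hw v, by simp⟩
  | cons s L ih =>
    have hX' : IsViolated G k T r (arcs L) X := hX.mono (Finset.subset_insert _ _)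
    have hsub : ∀ t ∈ T, t ∈ X → t ∈ s.core → v ∉ s.core := fun t htT htX hts hv =>
      hvX (h.core_subset hT hr hX List.mem_cons_self hts htX htT hv)
    constructor
    · intro t htT htX hadj
      by_cases hts : t ∈ s.core
      · exact h.2.2.2.2.2.2.2.1 v hvT (hsub t htT htX hts) t htT hts hadj
      · simpa [height, hts] using (ih h.1 hX').1 t htT htX hadj
    · intro b hb hbX hadj
      have hbT := (h.head_mem hb).1
      rcases List.mem_cons.1 hb with rfl | hb
      · have := h.2.2.2.2.2.2.2.2.2.1
        have := hw v
        linarith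
      · by_cases hts : b.arc.2 ∈ s.core
        · exact h.2.2.2.2.2.2.2.2.1 v hvT (hsub _ hbT hbX hts) b hb hts hadj
        · simpa [height, hts] using (ih h.1 hX').2 b hb hbX hadj

open Classical in
/-- The sum of the dual variables of the sets that contain `q` and have `v` as a neighbour. -/
noncomputable def load (G : SimpleGraph V) (q v : V) : List (Step V) → ℝ
  | [] => 0
  | s :: L => load G q v L + if q ∈ s.core ∧ v ∈ nbrSet G s.core then s.eps else 0

/-- The sets that contain `q` and have `v` as a neighbour have a total dual value of at most `w v`.
They form a chain; for the smallest of them there is a node `t ∈ T` in it and a path from `v` to `t`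
on which all nodes but `v` have been paid for by `t`, and from then on each increase of the dual
variables in question increases the height of `t`. -/
theorem IsHistory.load_le (hT : IsKConnected G (k - 1) T) (hr : r ∈ T) (hw : ∀ v, 0 ≤ w v)
    {L : List (Step V)} (h : IsHistory G k T w r L) {q v : V} (hq : q ∈ T) (hv : v ∉ T) :
    load G q v L ≤ w v := by
  suffices hs : load G q v L ≤ w v ∧ ((load G q v L = 0) ∨
      ∃ t ∈ T, ∃ β : ℝ, ((β = 0 ∧ G.Adj v t) ∨
        ∃ b ∈ L, b.arc.2 = t ∧ G.Adj v b.arc.1 ∧ b.cost = β) ∧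
        load G q v L + β ≤ height L t ∧ ∃ l ∈ L, q ∈ l.core ∧ t ∈ l.core) from hs.1
  induction L with
  | nil => exact ⟨hw v, Or.inl rfl⟩
  | cons s L ih =>
    obtain ⟨ih1, ih2⟩ := ih h.1
    by_cases hs : q ∈ s.core ∧ v ∈ nbrSet G s.core
    · have hload : load G q v (s :: L) = load G q v L + s.eps := by simp [load, hs]
      have hvs := (mem_nbrSet.1 hs.2).1
      have key : ∃ t ∈ T, t ∈ s.core ∧ ∃ β : ℝ, ((β = 0 ∧ G.Adj v t) ∨
          ∃ b ∈ L, b.arc.2 = t ∧ G.Adj v b.arc.1 ∧ b.cost = β) ∧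
          load G q v L + β ≤ height L t := by
        have fresh : load G q v L = 0 → ∃ t ∈ T, t ∈ s.core ∧ ∃ β : ℝ, ((β = 0 ∧ G.Adj v t) ∨
            ∃ b ∈ L, b.arc.2 = t ∧ G.Adj v b.arc.1 ∧ b.cost = β) ∧
            load G q v L + β ≤ height L t := by
          intro h0
          obtain ⟨-, u, hu, hadj⟩ := mem_nbrSet.1 hs.2
          by_cases huT : u ∈ T
          · exact ⟨u, huT, hu, 0, Or.inl ⟨rfl, hadj.symm⟩, by
              rw [h0, add_zero]; exact h.1.height_nonneg u⟩
          · obtain ⟨t, ht, hut⟩ := (h.2.1.mem_terminal_or_tail hu).resolve_left huT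
            obtain ⟨b, hb, hbut⟩ := mem_arcs.1 hut
            refine ⟨t, (h.1.arc_mem hut).1, ht, b.cost,
              Or.inr ⟨b, hb, by rw [hbut], by rw [hbut]; exact hadj.symm, rfl⟩, ?_⟩
            have := h.1.cost_le_height hb
            rw [hbut] at this
            linarith
        rcases ih2 with h0 | ⟨t, htT, β, hβ, hle, l, hl, hql, htl⟩
        · exact fresh h0
        · exact ⟨t, htT, h.1.core_subset hT hr h.2.1.1 hl hql hs.1 hq htl, β, hβ, hle⟩
      obtain ⟨t, htT, hts, β, hβ, hle⟩ := key
      have hheight : height (s :: L) t = height L t + s.eps := by simp [height, hts]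
      have hfin : height (s :: L) t ≤ w v + β := by
        rcases hβ with ⟨rfl, hadj⟩ | ⟨b, hb, rfl, hadj, rfl⟩
        · rw [add_zero]
          exact h.2.2.2.2.2.2.2.1 v hv hvs t htT hts hadj
        · exact h.2.2.2.2.2.2.2.2.1 v hv hvs b hb hts hadj
      refine ⟨by linarith, Or.inr ⟨t, htT, β, ?_, by linarith, s, List.mem_cons_self, hs.1, hts⟩⟩
      exact hβ.imp id fun ⟨b, hb, h'⟩ => ⟨b, List.mem_cons_of_mem _ hb, h'⟩
    · have hload : load G q v (s :: L) = load G q v L := by simp [load, hs]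
      rw [hload]
      refine ⟨ih1, ih2.imp id ?_⟩
      rintro ⟨t, htT, β, hβ, hle, l, hl, hl'⟩
      refine ⟨t, htT, β, hβ.imp id fun ⟨b, hb, h'⟩ => ⟨b, List.mem_cons_of_mem _ hb, h'⟩,
        hle.trans (h.height_le_cons t), l, List.mem_cons_of_mem _ hl, hl'⟩

/-- The dual value of a history. -/
def dualValue (L : List (Step V)) : ℝ := (L.map Step.eps).sum

/-- Weak duality: if for every node `v` there are at most `K` nodes of `T` that meet all demand cuts
with `v` as a neighbour, then the dual value is at most `K` times the cost of a fractional cover. -/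
theorem IsHistory.dualValue_le (hT : IsKConnected G (k - 1) T) (hr : r ∈ T) (hw : ∀ v, 0 ≤ w v)
    {L : List (Step V)} (h : IsHistory G k T w r L) {K : ℝ}
    (hQ : ∀ v ∉ T, ∃ Q ⊆ T, (Q.card : ℝ) ≤ K ∧
      ∀ X, IsDemandCut G k T r X → v ∈ nbrSet G X → (X ∩ Q).Nonempty)
    {x : V → ℝ} (hx : IsLPFeasible G k T r x) : dualValue L ≤ K * lpCost w T x := by
  classical
  let F : List (Step V) → V → ℝ := fun L v =>
    (L.map fun s => if v ∈ nbrSet G s.core then s.eps else 0).sum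
  have h1 : dualValue L ≤ ∑ v ∈ Finset.univ \ T, x v * F L v := by
    clear hQ
    induction L with
    | nil => simp [dualValue, F]
    | cons s L ih =>
      have hd := h.2.1.1.isDemandCut hT hr
      have h2 := hx.2 _ hd
      have h3 : s.eps ≤ ∑ v ∈ Finset.univ \ T, x v * if v ∈ nbrSet G s.core then s.eps else 0 := by
        have h4 : ∑ v ∈ Finset.univ \ T, x v * (if v ∈ nbrSet G s.core then s.eps else 0) =
            (∑ v ∈ nbrSet G s.core \ T, x v) * s.eps := by
          rw [Finset.sum_mul]
          symm
          have h5 : nbrSet G s.core \ T ⊆ Finset.univ \ T :=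
            Finset.sdiff_subset_sdiff (Finset.subset_univ _) subset_rfl
          rw [← Finset.sum_subset h5]
          · refine Finset.sum_congr rfl fun v hv => ?_
            rw [if_pos (Finset.mem_sdiff.1 hv).1]
          · intro v hv hv'
            have h6 : v ∉ nbrSet G s.core := fun h' =>
              hv' (Finset.mem_sdiff.2 ⟨h', (Finset.mem_sdiff.1 hv).2⟩)
            simp [h6]
        rw [h4]
        nlinarith [h.2.2.1]
      have h7 := ih h.1
      simp only [dualValue, F, List.map_cons, List.sum_cons, mul_add, Finset.sum_add_distrib]
        at h7 ⊢
      linarith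
  have h2 : ∀ v ∉ T, F L v ≤ K * w v := by
    intro v hv
    obtain ⟨Q, hQT, hQK, hQ'⟩ := hQ v hv
    have h3 : F L v ≤ ∑ q ∈ Q, load G q v L := by
      clear h1
      induction L with
      | nil => simp [F, load]
      | cons s L ih =>
        have h7 := ih h.1
        simp only [F, List.map_cons, List.sum_cons, load, Finset.sum_add_distrib] at h7 ⊢
        have h8 : (if v ∈ nbrSet G s.core then s.eps else 0) ≤
            ∑ q ∈ Q, if q ∈ s.core ∧ v ∈ nbrSet G s.core then s.eps else 0 := by
          have h0 := h.2.2.1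
          split_ifs with hvs
          · obtain ⟨q, hq⟩ := hQ' _ (h.2.1.1.isDemandCut hT hr) hvs
            rw [Finset.mem_inter] at hq
            refine le_trans ?_ (Finset.single_le_sum (fun i _ => by split_ifs <;> simp [h0]) hq.2)
            simp [hq.1, hvs]
          · simp [hvs]
        linarith
    calc F L v ≤ ∑ q ∈ Q, load G q v L := h3
      _ ≤ ∑ q ∈ Q, w v := Finset.sum_le_sum fun q hq => h.load_le hT hr hw (hQT hq) hv
      _ = Q.card * w v := by simp
      _ ≤ K * w v := mul_le_mul_of_nonneg_right hQK (hw v)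
  calc dualValue L ≤ ∑ v ∈ Finset.univ \ T, x v * F L v := h1
    _ ≤ ∑ v ∈ Finset.univ \ T, x v * (K * w v) := Finset.sum_le_sum fun v hv =>
        mul_le_mul_of_nonneg_left (h2 v (Finset.mem_sdiff.1 hv).2)
          (hx.1 v (Finset.mem_sdiff.1 hv).2)
    _ = K * lpCost w T x := by
        rw [lpCost, Finset.mul_sum]
        exact Finset.sum_congr rfl fun v _ => by ring

end History

/-! ### Unit disk graphs -/

section UnitDisk

variable {V : Type*} [Fintype V] [DecidableEq V] {G : SimpleGraph V}

/-- The cell of `x` in a square grid of side length `1/2` with the origin `o`. -/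
noncomputable def cell (o x : EuclideanSpace ℝ (Fin 2)) : ℤ × ℤ :=
  (⌊2 * (x 0 - o 0)⌋, ⌊2 * (x 1 - o 1)⌋)

theorem abs_coord_sub_le_dist (x y : EuclideanSpace ℝ (Fin 2)) (i : Fin 2) :
    |x i - y i| ≤ dist x y := by
  rw [← Real.dist_eq, EuclideanSpace.dist_eq]
  apply Real.le_sqrt_of_sq_le
  exact Finset.single_le_sum (f := fun i => dist (x i) (y i) ^ 2) (fun i _ => by positivity)
    (Finset.mem_univ i)

theorem dist_le_one_of_cell_eq {o x y : EuclideanSpace ℝ (Fin 2)} (h : cell o x = cell o y) :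
    dist x y ≤ 1 := by
  simp only [cell, Prod.mk.injEq] at h
  have h0 := Int.abs_sub_lt_one_of_floor_eq_floor h.1
  have h1 := Int.abs_sub_lt_one_of_floor_eq_floor h.2
  rw [abs_lt] at h0 h1
  rw [EuclideanSpace.dist_eq, Fin.sum_univ_two, Real.dist_eq, Real.dist_eq, sq_abs, sq_abs,
    Real.sqrt_le_iff]
  constructor
  · norm_num
  · nlinarith

theorem cell_mem_of_dist_le_two {o x : EuclideanSpace ℝ (Fin 2)} (h : dist x o ≤ 2) :
    cell o x ∈ (Finset.Icc (-4) 4 ×ˢ Finset.Icc (-4) 4 : Finset (ℤ × ℤ)) := by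
  have h0 := (abs_coord_sub_le_dist x o 0).trans h
  have h1 := (abs_coord_sub_le_dist x o 1).trans h
  rw [abs_le] at h0 h1
  simp only [cell, Finset.mem_product, Finset.mem_Icc]
  refine ⟨⟨Int.le_floor.2 ?_, Int.floor_le_iff.2 ?_⟩, ⟨Int.le_floor.2 ?_, Int.floor_le_iff.2 ?_⟩⟩
    <;> push_cast <;> linarith

/-- In a unit disk graph, `81 k` nodes of `T` suffice to meet all demand cuts with a given neighbour
`v`. Such a cut contains a node of `T` at distance at most two from `v`. The nodes in a cell of the
grid form a clique, so among `k` nodes of `T` in the cell of that node one is in the cut. -/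
theorem IsUnitDiskGraph.exists_hitting_set (hG : IsUnitDiskGraph G) {k m : ℕ} {T : Finset V}
    (hT : IsDominating G m T) (hkm : k ≤ m) (r v : V) :
    ∃ Q ⊆ T, (Q.card : ℝ) ≤ 81 * k ∧
      ∀ X, IsDemandCut G k T r X → v ∈ nbrSet G X → (X ∩ Q).Nonempty := by
  classical
  obtain ⟨p, hp⟩ := hG
  let cells : Finset (ℤ × ℤ) := Finset.Icc (-4) 4 ×ˢ Finset.Icc (-4) 4
  let P : ℤ × ℤ → Finset V := fun c => T.filter fun t => cell (p v) (p t) = c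
  have hsel : ∀ c, ∃ Q ⊆ P c, Q.card ≤ k ∧ (Q = P c ∨ Q.card = k) := by
    intro c
    rcases le_total (P c).card k with h | h
    · exact ⟨P c, subset_rfl, h, Or.inl rfl⟩
    · obtain ⟨Q, hQ, hQk⟩ := Finset.exists_subset_card_eq h
      exact ⟨Q, hQ, hQk.le, Or.inr hQk⟩
  choose Q hQP hQk hQ using hsel
  refine ⟨cells.biUnion Q, ?_, ?_, ?_⟩
  · exact Finset.biUnion_subset.2 fun c _ => (hQP c).trans (Finset.filter_subset _ _)
  · have h1 : (cells.biUnion Q).card ≤ cells.card * k := Finset.card_biUnion_le_card_mul _ _ _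
      fun c _ => hQk c
    have h2 : cells.card = 81 := by simp [cells]
    rw [h2] at h1
    exact_mod_cast h1
  · intro X hX hvX
    have hXk : (nbrSet G X ∩ T).card < k := by have := hX.2; omega
    obtain ⟨-, u, huX, huv⟩ := mem_nbrSet.1 hvX
    obtain ⟨t, ht, htu⟩ := exists_terminal_near hT hkm hXk huX
    rw [Finset.mem_inter] at ht
    have hd : dist (p t) (p v) ≤ 2 := by
      have h1 := ((hp u v).1 huv).2
      have h2 : dist (p t) (p u) ≤ 1 := by
        rcases htu with rfl | htu
        · simp
        · rw [dist_comm]; exact ((hp u t).1 htu).2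
      linarith [dist_triangle (p t) (p u) (p v)]
    set c := cell (p v) (p t) with hc
    have hcell : c ∈ cells := cell_mem_of_dist_le_two hd
    have htP : t ∈ P c := Finset.mem_filter.2 ⟨ht.2, rfl⟩
    suffices h : ∃ q ∈ Q c, q ∈ X by
      obtain ⟨q, hq, hqX⟩ := h
      exact ⟨q, Finset.mem_inter.2 ⟨hqX, Finset.mem_biUnion.2 ⟨c, hcell, hq⟩⟩⟩
    rcases hQ c with h | h
    · exact ⟨t, h ▸ htP, ht.1⟩
    · by_contra! hno
      have hsub : Q c ⊆ nbrSet G X ∩ T := by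
        intro q hq
        obtain ⟨hqT, hqc⟩ := Finset.mem_filter.1 (hQP c hq)
        have hne : t ≠ q := fun h => hno q hq (h ▸ ht.1)
        refine Finset.mem_inter.2 ⟨mem_nbrSet.2 ⟨hno q hq, t, ht.1, (hp t q).2 ⟨hne, ?_⟩⟩, hqT⟩
        exact dist_le_one_of_cell_eq (o := p v) (by rw [hqc, hc])
      have := Finset.card_le_card hsub
      omega

end UnitDisk

/-! ### Reverse deletion -/

section ReverseDelete

set_option linter.unusedSectionVars false

variable {V : Type*} [Fintype V] [DecidableEq V] {G : SimpleGraph V} {k : ℕ} {T : Finset V}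
  {w : V → ℝ} {r : V} {c : V × V → ℝ}

/-- The prices of a history as a function of the arcs. -/
theorem IsHistory.exists_cost {L : List (Step V)} (h : IsHistory G k T w r L) :
    ∃ c : V × V → ℝ, ∀ s ∈ L, c s.arc = s.cost := by
  induction L with
  | nil => exact ⟨fun _ => 0, by simp⟩
  | cons s L ih =>
    obtain ⟨c, hc⟩ := ih h.1
    refine ⟨Function.update c s.arc s.cost, fun b hb => ?_⟩
    rcases List.mem_cons.1 hb with rfl | hb
    · simp
    · have : b.arc ≠ s.arc := fun he => h.notMem_arcs (he ▸ mem_arcs.2 ⟨b, hb, rfl⟩)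
      rw [Function.update_of_ne this, hc b hb]

theorem IsHistory.cost_nonneg {L : List (Step V)} (h : IsHistory G k T w r L) {b : Step V}
    (hb : b ∈ L) : 0 ≤ b.cost := by
  induction L with
  | nil => simp at hb
  | cons s L ih =>
    rcases List.mem_cons.1 hb with rfl | hb
    · rw [h.2.2.2.2.2.2.2.2.2.1]
      exact h.height_nonneg _
    · exact ih h.1 hb

/-- The state of the reverse deletion when the steps `L` have not been examined yet and the arcs `B`
have been kept: `arcs L ∪ B` is a cover, every arc of `B` is needed, and the price of `B` is at most
the dual value `E` of the full history less the dual value of `L`, plus the part of the price of `B`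
that the sets of `L` account for. -/
structure IsReverseDeletion (G : SimpleGraph V) (k : ℕ) (T : Finset V) (w : V → ℝ) (r : V)
    (c : V × V → ℝ) (E : ℝ) (L : List (Step V)) (B : Finset (V × V)) : Prop where
  history : IsHistory G k T w r L
  cost : ∀ s ∈ L, c s.arc = s.cost
  cover : ∀ X, ¬ IsViolated G k T r (arcs L ∪ B) X
  needed : ∀ b ∈ B, ∃ X, IsViolated G k T r (arcs L ∪ B.erase b) X
  head_mem : ∀ b ∈ B, b.2 ∈ T
  fresh : ∀ b ∈ B, b ∉ arcs L
  tail_notMem : ∀ b ∈ B, ∀ l ∈ L, b.2 ∈ l.core → b.1 ∉ l.core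
  price : ∑ b ∈ B, c b + dualValue L ≤ ∑ b ∈ B, height L b.2 + E

theorem IsHistory.isReverseDeletion {L : List (Step V)} (h : IsHistory G k T w r L)
    (hc : ∀ s ∈ L, c s.arc = s.cost) (hcov : ∀ X, ¬ IsViolated G k T r (arcs L) X) :
    IsReverseDeletion G k T w r c (dualValue L) L ∅ where
  history := h
  cost := hc
  cover X := by rw [Finset.union_empty]; exact hcov X
  needed := by simp
  head_mem := by simp
  fresh := by simp
  tail_notMem := by simp
  price := by simp

/-- Passing from `L` with the last step `s` to `L` costs at most the dual increase of `s`, because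
at most one of the kept arcs enters the set of `s`. -/
theorem IsReverseDeletion.sum_height_le (hT : IsKConnected G (k - 1) T) (hr : r ∈ T) {s : Step V}
    {L : List (Step V)} {B : Finset (V × V)} (h : IsHistory G k T w r (s :: L))
    (hcov : ∀ X, ¬ IsViolated G k T r (arcs L ∪ B) X)
    (hmin : ∀ b ∈ B, ∃ X, IsViolated G k T r (arcs L ∪ B.erase b) X) (hBT : ∀ b ∈ B, b.2 ∈ T)
    (htail : ∀ b ∈ B, b.2 ∈ s.core → b.1 ∉ s.core) :
    ∑ b ∈ B, height (s :: L) b.2 ≤ ∑ b ∈ B, height L b.2 + s.eps := by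
  have h1 := card_entering_le_one hT hr h.2.1 hcov hmin hBT
  have h2 : (B.filter fun b => b.2 ∈ s.core ∧ b.1 ∉ s.core) = B.filter fun b => b.2 ∈ s.core :=
    Finset.filter_congr fun b hb => ⟨And.left, fun h => ⟨h, htail b hb h⟩⟩
  rw [h2] at h1
  simp only [height, Finset.sum_add_distrib]
  rw [← Finset.sum_filter, Finset.sum_const, nsmul_eq_mul]
  have h3 : ((B.filter fun b => b.2 ∈ s.core).card : ℝ) ≤ 1 := by exact_mod_cast h1
  nlinarith [h.2.2.1]

theorem IsReverseDeletion.keep (hT : IsKConnected G (k - 1) T) (hr : r ∈ T) {E : ℝ} {s : Step V}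
    {L : List (Step V)} {B : Finset (V × V)} (h : IsReverseDeletion G k T w r c E (s :: L) B)
    (hX : ∃ X, IsViolated G k T r (arcs L ∪ B) X) :
    IsReverseDeletion G k T w r c E L (insert s.arc B) := by
  have hs := h.history
  have hsB : s.arc ∉ B := fun hm => h.fresh _ hm (Finset.mem_insert_self _ _)
  have e1 : ∀ B' : Finset (V × V), arcs L ∪ insert s.arc B' = arcs (s :: L) ∪ B' := fun B' => by
    rw [arcs, Finset.insert_union, Finset.union_insert]
  have hcov : ∀ X, ¬ IsViolated G k T r (arcs L ∪ insert s.arc B) X := by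
    rw [e1]; exact h.cover
  have hmin : ∀ b ∈ insert s.arc B,
      ∃ X, IsViolated G k T r (arcs L ∪ (insert s.arc B).erase b) X := by
    intro b hb
    rcases Finset.mem_insert.1 hb with rfl | hb
    · rw [Finset.erase_insert hsB]; exact hX
    · rw [Finset.erase_insert_of_ne (fun he => hsB (by rw [he]; exact hb)), e1]
      exact h.needed b hb
  have hBT : ∀ b ∈ insert s.arc B, b.2 ∈ T := by
    intro b hb
    rcases Finset.mem_insert.1 hb with rfl | hb
    · exact hs.2.2.2.2.1
    · exact h.head_mem b hb
  have htail : ∀ b ∈ insert s.arc B, ∀ l ∈ s :: L, b.2 ∈ l.core → b.1 ∉ l.core := by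
    intro b hb l hl hbl
    rcases Finset.mem_insert.1 hb with rfl | hb
    · rcases List.mem_cons.1 hl with rfl | hl
      · exact hs.2.2.2.2.2.1
      · exact fun hh => hs.2.2.2.2.2.1
          (hs.1.core_subset hT hr hs.2.1.1 hl hbl hs.2.2.2.1 hs.2.2.2.2.1 hh)
    · exact h.tail_notMem b hb l hl hbl
  refine ⟨hs.1, fun l hl => h.cost l (List.mem_cons_of_mem _ hl), hcov, hmin, hBT, ?_,
    fun b hb l hl => htail b hb l (List.mem_cons_of_mem _ hl), ?_⟩
  · intro b hb
    rcases Finset.mem_insert.1 hb with rfl | hb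
    · exact hs.notMem_arcs
    · exact fun hm => h.fresh b hb (Finset.mem_insert_of_mem hm)
  · have h1 := IsReverseDeletion.sum_height_le hT hr hs hcov hmin hBT
      fun b hb => htail b hb s List.mem_cons_self
    have h2 := h.price
    have h3 := h.cost s List.mem_cons_self
    have h4 := hs.2.2.2.2.2.2.2.2.2.1
    rw [Finset.sum_insert hsB] at h1 ⊢
    simp only [dualValue, List.map_cons, List.sum_cons] at h2 ⊢
    linarith

theorem IsReverseDeletion.discard (hT : IsKConnected G (k - 1) T) (hr : r ∈ T) {E : ℝ} {s : Step V}
    {L : List (Step V)} {B : Finset (V × V)} (h : IsReverseDeletion G k T w r c E (s :: L) B)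
    (hX : ∀ X, ¬ IsViolated G k T r (arcs L ∪ B) X) : IsReverseDeletion G k T w r c E L B := by
  have hs := h.history
  have hsub : arcs L ⊆ arcs (s :: L) := Finset.subset_insert _ _
  have hmin : ∀ b ∈ B, ∃ X, IsViolated G k T r (arcs L ∪ B.erase b) X := fun b hb => by
    obtain ⟨X, hX⟩ := h.needed b hb
    exact ⟨X, hX.mono (Finset.union_subset_union_left hsub)⟩
  refine ⟨hs.1, fun l hl => h.cost l (List.mem_cons_of_mem _ hl), hX, hmin, h.head_mem,
    fun b hb hm => h.fresh b hb (hsub hm),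
    fun b hb l hl => h.tail_notMem b hb l (List.mem_cons_of_mem _ hl), ?_⟩
  have h1 := IsReverseDeletion.sum_height_le hT hr hs hX hmin h.head_mem
      fun b hb => h.tail_notMem b hb s List.mem_cons_self
  have h2 := h.price
  simp only [dualValue, List.map_cons, List.sum_cons] at h2 ⊢
  linarith

/-- The state of the recovery of nodes from the kept arcs `B`: the nodes `S` have been bought, and
the paths of the arcs in `N ∩ arcs L` are still to be bought, which the prices of these arcs pay
for. Nodes of weight at most `W` have been bought for other roots. Every set that an arc of `B`
enters has a neighbour in `S` or is entered by an arc whose path is still to be bought. -/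
structure IsPartialRecovery (G : SimpleGraph V) (w : V → ℝ) (c : V × V → ℝ) (W : ℝ)
    (L : List (Step V)) (B N : Finset (V × V)) (S : Finset V) : Prop where
  paid : ∑ v ∈ S, w v + ∑ p ∈ N ∩ arcs L, c p ≤ W + ∑ b ∈ B, c b
  cover : ∀ X : Finset V, (∃ b ∈ B, b.2 ∈ X ∧ b.1 ∉ X) →
    (nbrSet G X ∩ S).Nonempty ∨ ∃ p ∈ N ∩ arcs L, p.2 ∈ X ∧ p.1 ∉ X

theorem IsPartialRecovery.keep {W : ℝ} {L : List (Step V)} {B N : Finset (V × V)} {S : Finset V}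
    (h : IsPartialRecovery G w c W L B N S) {p : V × V} (hp : p ∈ arcs L) (hpB : p ∉ B)
    (hc : 0 ≤ c p) : IsPartialRecovery G w c W L (insert p B) (insert p N) S where
  paid := by
    have h1 := h.paid
    rw [Finset.insert_inter_of_mem hp, Finset.sum_insert hpB]
    by_cases hpN : p ∈ N ∩ arcs L
    · rw [Finset.insert_eq_of_mem hpN]; linarith
    · rw [Finset.sum_insert hpN]; linarith
  cover X := by
    rintro ⟨b, hb, hbX⟩
    rw [Finset.insert_inter_of_mem hp]
    rcases Finset.mem_insert.1 hb with rfl | hb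
    · exact Or.inr ⟨b, Finset.mem_insert_self _ _, hbX⟩
    · exact (h.cover X ⟨b, hb, hbX⟩).imp id
        fun ⟨q, hq, hqX⟩ => ⟨q, Finset.mem_insert_of_mem hq, hqX⟩

theorem IsPartialRecovery.skip {W : ℝ} {s : Step V} {L : List (Step V)} {B N : Finset (V × V)}
    {S : Finset V} (h : IsPartialRecovery G w c W (s :: L) B N S) (hN : s.arc ∉ N) :
    IsPartialRecovery G w c W L B N S := by
  have e : N ∩ arcs (s :: L) = N ∩ arcs L := by rw [arcs, Finset.inter_insert_of_notMem hN]
  have h1 := h.paid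
  have h2 := h.cover
  rw [e] at h1 h2
  exact ⟨h1, h2⟩

theorem IsPartialRecovery.buy (hw : ∀ v, 0 ≤ w v) {W : ℝ} {s : Step V} {L : List (Step V)}
    {B N : Finset (V × V)} {S : Finset V} (h : IsPartialRecovery G w c W (s :: L) B N S)
    (hL : IsHistory G k T w r (s :: L)) (hc : ∀ b ∈ s :: L, c b.arc = b.cost) (hN : s.arc ∈ N) :
    IsPartialRecovery G w c W L B (insert (s.par, s.arc.2) N) (insert s.arc.1 S) := by
  obtain ⟨hL', -, -, -, htT, -, -, -, -, -, hadj, htight⟩ := id hL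
  have e : N ∩ arcs (s :: L) = insert s.arc (N ∩ arcs L) := by
    rw [arcs, Finset.inter_insert_of_mem hN]
  have hfresh : s.arc ∉ N ∩ arcs L := fun hm => hL.notMem_arcs (Finset.mem_inter.1 hm).2
  have hcs := hc s List.mem_cons_self
  constructor
  · have h1 := h.paid
    rw [e, Finset.sum_insert hfresh] at h1
    have hS : ∑ v ∈ insert s.arc.1 S, w v ≤ w s.arc.1 + ∑ v ∈ S, w v := by
      by_cases hv : s.arc.1 ∈ S
      · rw [Finset.insert_eq_of_mem hv]
        linarith [hw s.arc.1]
      · rw [Finset.sum_insert hv]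
    rcases htight with ⟨hpar, hle⟩ | ⟨b, hb, hbarc, hle⟩
    · have hnot : (s.par, s.arc.2) ∉ arcs L := fun hm => by
        have := (hL'.arc_mem hm).2
        rw [hpar] at this
        exact this htT
      rw [Finset.insert_inter_of_notMem hnot]
      linarith
    · have hmem : (s.par, s.arc.2) ∈ arcs L := mem_arcs.2 ⟨b, hb, hbarc⟩
      have hcb := hc b (List.mem_cons_of_mem _ hb)
      have hb0 := hL'.cost_nonneg hb
      rw [Finset.insert_inter_of_mem hmem]
      rw [hbarc] at hcb
      by_cases hq : (s.par, s.arc.2) ∈ N ∩ arcs L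
      · rw [Finset.insert_eq_of_mem hq]; linarith
      · rw [Finset.sum_insert hq]; linarith
  · intro X hX
    rcases h.cover X hX with ⟨y, hy⟩ | ⟨p, hp, hpX⟩
    · rw [Finset.mem_inter] at hy
      exact Or.inl ⟨y, Finset.mem_inter.2 ⟨hy.1, Finset.mem_insert_of_mem hy.2⟩⟩
    · rw [e, Finset.mem_insert] at hp
      rcases hp with rfl | hp
      · by_cases hpar : s.par ∈ X
        · exact Or.inl ⟨s.arc.1, Finset.mem_inter.2
            ⟨mem_nbrSet.2 ⟨hpX.2, s.par, hpar, hadj.symm⟩, Finset.mem_insert_self _ _⟩⟩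
        · rcases htight with ⟨hpar', -⟩ | ⟨b, hb, hbarc, -⟩
          · exact absurd (hpar' ▸ hpX.1) hpar
          · exact Or.inr ⟨(s.par, s.arc.2), Finset.mem_inter.2
              ⟨Finset.mem_insert_self _ _, mem_arcs.2 ⟨b, hb, hbarc⟩⟩, hpX.1, hpar⟩
      · rw [Finset.mem_inter] at hp
        exact Or.inr ⟨p, Finset.mem_inter.2 ⟨Finset.mem_insert_of_mem hp.1, hp.2⟩, hpX⟩

end ReverseDelete

/-! ### Minimal violated sets by alternating paths -/

section Matching

/-- The assignment `m` of nodes `a` to codes of nodes of `W`, where `0` stands for an unassigned `a`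
and `u + 1` for the node `u`, uses only pairs of the relation `N`, and each node `u` of `W` other
than `s` gets exactly one node `a`, except that the node `x`, if `x ≠ s`, gets none. The node `s`
may get any number of nodes. -/
structure IsAssignment {n : ℕ} (N : Fin n → Fin n → Prop) (W : Finset (Fin n)) (s x : Fin n)
    (m : Fin n → ℕ) : Prop where
  valid : ∀ a, m a = 0 ∨ ∃ u ∈ W, N u a ∧ m a = u + 1
  count : ∀ u ∈ W, u ≠ s →
    (Finset.univ.filter fun a => m a = (u : ℕ) + 1).card = if u = x then 0 else 1

/-- The state of the search for an augmenting path: `R` is the set of nodes that are known to be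
reachable from `s` by alternating paths, and `M u` is the assignment obtained by shifting along such
a path to `u`. -/
structure IsSearchState {n : ℕ} (N : Fin n → Fin n → Prop) (W : Finset (Fin n)) (s : Fin n)
    (m : Fin n → ℕ) (R : Finset (Fin n)) (M : Fin n → Fin n → ℕ) : Prop where
  assignment : IsAssignment N W s s m
  root_mem : s ∈ R
  subset : R ⊆ W
  shifted : ∀ u ∈ R, IsAssignment N W s u (M u)
  eq_zero : ∀ u ∈ R, ∀ a, M u a = 0 ↔ m a = 0
  changed : ∀ u ∈ R, ∀ a, M u a ≠ m a → ∃ u' ∈ R, m a = (u' : ℕ) + 1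
  minimal : ∀ Z : Finset (Fin n), s ∈ Z →
    (∀ u ∈ Z, ∀ a, N u a → ∀ u' : Fin n, m a = (u' : ℕ) + 1 → u' ∈ Z) → R ⊆ Z

variable {n : ℕ} {N : Fin n → Fin n → Prop} {W : Finset (Fin n)} {s : Fin n}

theorem card_filter_update (m : Fin n → ℕ) (a : Fin n) (c d : ℕ) :
    (Finset.univ.filter fun b => Function.update m a c b = d).card =
      (Finset.univ.filter fun b => m b = d).card + (if d = c then 1 else 0)
        - (if m a = d then 1 else 0) := by
  have e : ∀ f : Fin n → ℕ, (Finset.univ.filter fun b => f b = d).card =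
      (if f a = d then 1 else 0) + ∑ b ∈ Finset.univ.erase a, if f b = d then 1 else 0 := by
    intro f
    rw [Finset.card_filter]
    exact (Finset.add_sum_erase _ (fun b => if f b = d then 1 else 0) (Finset.mem_univ a)).symm
  rw [e, e]
  have e2 : ∑ b ∈ Finset.univ.erase a, (if Function.update m a c b = d then 1 else 0) =
      ∑ b ∈ Finset.univ.erase a, if m b = d then 1 else 0 :=
    Finset.sum_congr rfl fun b hb => by rw [Function.update_of_ne (Finset.ne_of_mem_erase hb)]
  rw [e2, Function.update_self]
  split_ifs <;> omega

/-- Giving the node `a` to `u` moves the gap from `u` to the node that had `a` before. -/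
theorem IsAssignment.update {x : Fin n} {m : Fin n → ℕ} (h : IsAssignment N W s x m)
    (hx : x ∈ W) {a : Fin n} (ha : N x a) (y : Fin n)
    (hm : (m a = 0 ∧ y = s) ∨ (m a = (y : ℕ) + 1 ∧ y ≠ s ∧ y ≠ x)) :
    IsAssignment N W s y (Function.update m a (x + 1)) := by
  constructor
  · intro b
    by_cases hb : b = a
    · subst hb
      exact Or.inr ⟨x, hx, ha, by simp⟩
    · rw [Function.update_of_ne hb]; exact h.valid b
  · intro u hu hus
    rw [card_filter_update, h.count u hu hus]
    have e1 : ∀ u' v' : Fin n, ((u' : ℕ) + 1 = v' + 1) ↔ u' = v' := fun u' v' => by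
      rw [Nat.add_right_cancel_iff, Fin.val_inj]
    rcases hm with ⟨h0, rfl⟩ | ⟨h1, h2, h3⟩
    · simp only [h0, e1, if_neg hus, if_neg (Nat.succ_ne_zero _).symm]
      split_ifs <;> rfl
    · simp only [h1, e1]
      by_cases hux : u = x
      · subst hux; simp [Ne.symm h3, h3]
      · by_cases huy : u = y
        · subst huy; simp [hux]
        · simp [hux, huy, Ne.symm huy]

theorem IsSearchState.init {m : Fin n → ℕ} (h : IsAssignment N W s s m) (hs : s ∈ W)
    {M : Fin n → Fin n → ℕ} (hM : M s = m) : IsSearchState N W s m {s} M where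
  assignment := h
  root_mem := Finset.mem_singleton_self s
  subset := by simpa using hs
  shifted u hu := by rw [Finset.mem_singleton.1 hu, hM]; exact h
  eq_zero u hu a := by rw [Finset.mem_singleton.1 hu, hM]
  changed u hu a hne := by rw [Finset.mem_singleton.1 hu, hM] at hne; exact absurd rfl hne
  minimal Z hZ _ := by simpa using hZ

/-- If `u` is reachable and related to a node that is assigned to `u'`, then `u'` is reachable, and
the path to `u'` shifts that node from `u'` to `u`. -/
theorem IsSearchState.extend {m : Fin n → ℕ} {R : Finset (Fin n)} {M M' : Fin n → Fin n → ℕ}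
    (h : IsSearchState N W s m R M) {u a u' : Fin n} (hu : u ∈ R) (ha : N u a)
    (hm : m a = (u' : ℕ) + 1) (hu' : u' ∉ R) (hM : ∀ x, x ≠ u' → M' x = M x)
    (hM' : M' u' = Function.update (M u) a (u + 1)) : IsSearchState N W s m (insert u' R) M' := by
  have hMua : M u a = m a := by
    by_contra hne
    obtain ⟨u'', h1, h2⟩ := h.changed u hu a hne
    have : u'' = u' := Fin.ext (by omega)
    exact hu' (this ▸ h1)
  have hne : ∀ x ∈ R, x ≠ u' := fun x hx hh => hu' (hh ▸ hx)
  have hu'W : u' ∈ W := by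
    rcases h.assignment.valid a with h0 | ⟨y, hy, -, h1⟩
    · omega
    · have : u' = y := Fin.ext (by omega)
      exact this ▸ hy
  refine ⟨h.assignment, Finset.mem_insert_of_mem h.root_mem,
    Finset.insert_subset hu'W h.subset, ?_, ?_, ?_, ?_⟩
  · intro x hx
    rcases Finset.mem_insert.1 hx with rfl | hx
    · rw [hM']
      exact (h.shifted u hu).update (h.subset hu) ha x
        (Or.inr ⟨hMua.trans hm, (hne s h.root_mem).symm, (hne u hu).symm⟩)
    · rw [hM x (hne x hx)]; exact h.shifted x hx
  · intro x hx b
    rcases Finset.mem_insert.1 hx with rfl | hx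
    · rw [hM']
      by_cases hb : b = a
      · subst hb; rw [Function.update_self, hm]; simp
      · rw [Function.update_of_ne hb]; exact h.eq_zero u hu b
    · rw [hM x (hne x hx)]; exact h.eq_zero x hx b
  · intro x hx b hb
    rcases Finset.mem_insert.1 hx with rfl | hx
    · by_cases hba : b = a
      · subst hba; exact ⟨x, Finset.mem_insert_self _ _, hm⟩
      · rw [hM', Function.update_of_ne hba] at hb
        obtain ⟨y, hy, hy'⟩ := h.changed u hu b hb
        exact ⟨y, Finset.mem_insert_of_mem hy, hy'⟩
    · rw [hM x (hne x hx)] at hb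
      obtain ⟨y, hy, hy'⟩ := h.changed x hx b hb
      exact ⟨y, Finset.mem_insert_of_mem hy, hy'⟩
  · intro Z hsZ hZ
    have := h.minimal Z hsZ hZ
    exact Finset.insert_subset (hZ u (this hu) a ha u' hm) this

/-- If a reachable node is related to an unassigned node, then shifting along the path to it makes
room for that node. -/
theorem IsSearchState.augment {m : Fin n → ℕ} {R : Finset (Fin n)} {M : Fin n → Fin n → ℕ}
    (h : IsSearchState N W s m R M) {u a : Fin n} (hu : u ∈ R) (ha : N u a) (hm : m a = 0) :
    IsAssignment N W s s (Function.update (M u) a (u + 1)) ∧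
      (Finset.univ.filter fun b => Function.update (M u) a ((u : ℕ) + 1) b = 0).card <
        (Finset.univ.filter fun b => m b = 0).card := by
  have h0 : M u a = 0 := (h.eq_zero u hu a).2 hm
  refine ⟨(h.shifted u hu).update (h.subset hu) ha s (Or.inl ⟨h0, rfl⟩), Finset.card_lt_card ?_⟩
  refine ⟨fun b hb => ?_, fun hsub => ?_⟩
  · simp only [Finset.mem_filter, Finset.mem_univ, true_and] at hb ⊢
    by_cases hba : b = a
    · subst hba; simp at hb
    · rw [Function.update_of_ne hba] at hb
      exact (h.eq_zero u hu b).1 hb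
  · have := hsub (Finset.mem_filter.2 ⟨Finset.mem_univ a, hm⟩)
    simp at this

open Classical in
/-- The nodes related to some node of `Z`. -/
noncomputable def relImage (N : Fin n → Fin n → Prop) (Z : Finset (Fin n)) : Finset (Fin n) :=
  Finset.univ.filter fun a => ∃ u ∈ Z, N u a

theorem mem_relImage {Z : Finset (Fin n)} {a : Fin n} : a ∈ relImage N Z ↔ ∃ u ∈ Z, N u a := by
  simp [relImage]

theorem IsAssignment.card_preimage {m : Fin n → ℕ} (h : IsAssignment N W s s m)
    {Z : Finset (Fin n)} (hZ : Z ⊆ W) (hs : s ∈ Z) :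
    (Finset.univ.filter fun a => ∃ u ∈ Z, m a = (u : ℕ) + 1).card + 1 =
      Z.card + (Finset.univ.filter fun a => m a = (s : ℕ) + 1).card := by
  have e : (Finset.univ.filter fun a => ∃ u ∈ Z, m a = (u : ℕ) + 1) =
      Z.biUnion fun u => Finset.univ.filter fun a => m a = (u : ℕ) + 1 := by
    ext a; simp
  rw [e, Finset.card_biUnion]
  · rw [← Finset.add_sum_erase _ _ hs]
    have h1 : ∑ u ∈ Z.erase s, (Finset.univ.filter fun a => m a = (u : ℕ) + 1).card =
        ∑ u ∈ Z.erase s, 1 := Finset.sum_congr rfl fun u hu => by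
      rw [Finset.mem_erase] at hu
      rw [h.count u (hZ hu.2) hu.1, if_neg hu.1]
    rw [h1, Finset.sum_const, Finset.card_erase_of_mem hs, smul_eq_mul, mul_one]
    have := Finset.card_pos.2 ⟨s, hs⟩
    omega
  · intro u _ u' _ hne
    rw [Function.onFun, Finset.disjoint_left]
    intro a ha ha'
    simp only [Finset.mem_filter, Finset.mem_univ, true_and] at ha ha'
    exact hne (Fin.ext (by omega))

theorem IsAssignment.preimage_subset {m : Fin n → ℕ} (h : IsAssignment N W s s m)
    (Z : Finset (Fin n)) :
    (Finset.univ.filter fun a => ∃ u ∈ Z, m a = (u : ℕ) + 1) ⊆ relImage N Z := by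
  intro a ha
  simp only [Finset.mem_filter, Finset.mem_univ, true_and] at ha
  obtain ⟨u, hu, hm⟩ := ha
  rcases h.valid a with h0 | ⟨y, -, hy, h1⟩
  · omega
  · have : u = y := Fin.ext (by omega)
    exact mem_relImage.2 ⟨u, hu, this ▸ hy⟩

/-- A search that cannot be continued proves that `R` has the fewest neighbours, and it is contained
in all sets with as few neighbours. -/
theorem IsSearchState.of_stuck {m : Fin n → ℕ} {R : Finset (Fin n)} {M : Fin n → Fin n → ℕ}
    (h : IsSearchState N W s m R M)
    (hstuck : ∀ u ∈ R, ∀ a, N u a → ∃ u' ∈ R, m a = (u' : ℕ) + 1) :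
    (relImage N R).card + 1 ≤
      R.card + (Finset.univ.filter fun a => m a = (s : ℕ) + 1).card ∧
    ∀ Z ⊆ W, s ∈ Z →
      Z.card + (Finset.univ.filter fun a => m a = (s : ℕ) + 1).card ≤ (relImage N Z).card + 1 ∧
      ((relImage N Z).card + 1 ≤
        Z.card + (Finset.univ.filter fun a => m a = (s : ℕ) + 1).card → R ⊆ Z) := by
  constructor
  · rw [← h.assignment.card_preimage h.subset h.root_mem]
    refine Nat.succ_le_succ (Finset.card_le_card fun a ha => ?_)
    obtain ⟨u, hu, hua⟩ := mem_relImage.1 ha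
    exact Finset.mem_filter.2 ⟨Finset.mem_univ _, hstuck u hu a hua⟩
  · intro Z hZ hs
    rw [← h.assignment.card_preimage hZ hs]
    have hsub := h.assignment.preimage_subset Z
    refine ⟨Nat.succ_le_succ (Finset.card_le_card hsub), fun hle => ?_⟩
    have heq := Finset.eq_of_subset_of_card_le hsub (Nat.le_of_succ_le_succ hle)
    refine h.minimal Z hs fun u hu a hua u' hm => ?_
    have ha : a ∈ relImage N Z := mem_relImage.2 ⟨u, hu, hua⟩
    rw [← heq] at ha
    obtain ⟨y, hy, hy'⟩ := (Finset.mem_filter.1 ha).2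
    have : u' = y := Fin.ext (by omega)
    exact this ▸ hy

end Matching

/-! ### Smallest violated sets -/

section Cores

variable {n : ℕ} {G : SimpleGraph (Fin n)} {k : ℕ} {T : Finset (Fin n)} {r : Fin n}
  {A : Finset (Fin n × Fin n)}

/-- The node `a ∈ T` is in the closed neighbourhood of every set that contains `u ∈ T` and that no
arc of `A` enters, because of `u` and of the arcs with head `u`. -/
def ArcNbr (G : SimpleGraph (Fin n)) (T : Finset (Fin n)) (A : Finset (Fin n × Fin n))
    (u a : Fin n) : Prop :=
  u ∈ T ∧ a ∈ T ∧ (u = a ∨ G.Adj u a ∨ ∃ v, (v, u) ∈ A ∧ G.Adj v a)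

open Classical in
/-- The nodes of `T` that are contained in a set without the root in its closed neighbourhood. -/
noncomputable def freeNodes (G : SimpleGraph (Fin n)) (T : Finset (Fin n)) (r : Fin n)
    (A : Finset (Fin n × Fin n)) : Finset (Fin n) :=
  T.filter fun u => ¬ ArcNbr G T A u r

open Classical in
/-- The set `Z` together with the tails of the arcs with head in `Z`. -/
noncomputable def withTails (A : Finset (Fin n × Fin n)) (Z : Finset (Fin n)) : Finset (Fin n) :=
  Finset.univ.filter fun v => v ∈ Z ∨ ∃ t ∈ Z, (v, t) ∈ A

theorem mem_withTails {Z : Finset (Fin n)} {v : Fin n} :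
    v ∈ withTails A Z ↔ v ∈ Z ∨ ∃ t ∈ Z, (v, t) ∈ A := by
  simp [withTails]

theorem mem_freeNodes {u : Fin n} : u ∈ freeNodes G T r A ↔ u ∈ T ∧ ¬ ArcNbr G T A u r := by
  simp [freeNodes]

theorem withTails_inter (hA : ∀ p ∈ A, p.2 ∈ T ∧ p.1 ∉ T) {Z : Finset (Fin n)} (hZ : Z ⊆ T) :
    withTails A Z ∩ T = Z := by
  ext v
  rw [Finset.mem_inter, mem_withTails]
  constructor
  · rintro ⟨h | ⟨t, -, h⟩, hv⟩
    · exact h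
    · exact absurd hv (hA _ h).2
  · exact fun h => ⟨Or.inl h, hZ h⟩

theorem relImage_arcNbr (hA : ∀ p ∈ A, p.2 ∈ T ∧ p.1 ∉ T) {Z : Finset (Fin n)} (hZ : Z ⊆ T) :
    relImage (ArcNbr G T A) Z = closedNbr G (withTails A Z) ∩ T := by
  ext a
  simp only [mem_relImage, Finset.mem_inter, mem_closedNbr, mem_withTails, ArcNbr]
  constructor
  · rintro ⟨u, hu, huT, haT, rfl | h | ⟨v, hv, hva⟩⟩
    · exact ⟨Or.inl (Or.inl hu), haT⟩
    · exact ⟨Or.inr ⟨u, Or.inl hu, h⟩, haT⟩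
    · exact ⟨Or.inr ⟨v, Or.inr ⟨u, hu, hv⟩, hva⟩, haT⟩
  · rintro ⟨(ha | ⟨t, ht, ha⟩) | ⟨u, hu | ⟨t, ht, hut⟩, hadj⟩, haT⟩
    · exact ⟨a, ha, haT, haT, Or.inl rfl⟩
    · exact absurd haT (hA _ ha).2
    · exact ⟨u, hu, hZ hu, haT, Or.inr (Or.inl hadj)⟩
    · exact ⟨t, ht, hZ ht, haT, Or.inr (Or.inr ⟨u, hut, hadj⟩)⟩

theorem withTails_inter_subset {X : Finset (Fin n)} (hX : IsViolated G k T r A X) :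
    withTails A (X ∩ T) ⊆ X := by
  intro v hv
  rcases mem_withTails.1 hv with h | ⟨t, ht, h⟩
  · exact (Finset.mem_inter.1 h).1
  · exact hX.2.2.2 _ h (Finset.mem_inter.1 ht).1

theorem card_nbrSet_withTails (hA : ∀ p ∈ A, p.2 ∈ T ∧ p.1 ∉ T) {Z : Finset (Fin n)} (hZ : Z ⊆ T) :
    Z.card + (nbrSet G (withTails A Z) ∩ T).card = (relImage (ArcNbr G T A) Z).card := by
  rw [relImage_arcNbr hA hZ, closedNbr, Finset.union_inter_distrib_right, withTails_inter hA hZ,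
    Finset.card_union_of_disjoint]
  rw [Finset.disjoint_left]
  exact fun v hv hv' => (mem_nbrSet.1 (Finset.mem_inter.1 hv').1).1 (mem_withTails.2 (Or.inl hv))

/-- Violated sets in terms of the nodes of `T` in them. -/
theorem isViolated_withTails_iff (hr : r ∈ T) (hA : ∀ p ∈ A, p.2 ∈ T ∧ p.1 ∉ T)
    {Z : Finset (Fin n)} (hZ : Z ⊆ T) :
    IsViolated G k T r A (withTails A Z) ↔ Z.Nonempty ∧ Z ⊆ freeNodes G T r A ∧
      (relImage (ArcNbr G T A) Z).card < Z.card + k := by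
  rw [IsViolated, withTails_inter hA hZ, ← card_nbrSet_withTails hA hZ, Nat.add_lt_add_iff_left]
  refine and_congr_right fun _ => ?_
  have h1 : r ∉ closedNbr G (withTails A Z) ↔ Z ⊆ freeNodes G T r A := by
    have : r ∈ closedNbr G (withTails A Z) ↔ r ∈ relImage (ArcNbr G T A) Z := by
      rw [relImage_arcNbr hA hZ, Finset.mem_inter]
      exact (and_iff_left hr).symm
    rw [this, mem_relImage]
    push Not
    exact forall₂_congr fun u hu => by rw [mem_freeNodes]; exact (and_iff_right (hZ hu)).symm
  rw [h1]
  refine and_congr_right fun _ => and_iff_left fun p hp hpZ => ?_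
  have : p.2 ∈ Z := by
    rw [← withTails_inter hA hZ]
    exact Finset.mem_inter.2 ⟨hpZ, (hA p hp).1⟩
  exact mem_withTails.2 (Or.inr ⟨p.2, this, hp⟩)

theorem IsViolated.withTails_inter (hA : ∀ p ∈ A, p.2 ∈ T ∧ p.1 ∉ T) {X : Finset (Fin n)}
    (hX : IsViolated G k T r A X) : IsViolated G k T r A (withTails A (X ∩ T)) := by
  have hsub := withTails_inter_subset hX
  have hXT := _root_.withTails_inter hA (Finset.inter_subset_right (s₁ := X) (s₂ := T))
  refine ⟨by rw [hXT]; exact hX.1, fun h => hX.2.1 (closedNbr_mono hsub h), ?_, fun p hp hpX => ?_⟩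
  · refine (Finset.card_le_card fun a ha => ?_).trans_lt hX.2.2.1
    obtain ⟨ha1, haT⟩ := Finset.mem_inter.1 ha
    obtain ⟨haX, u, hu, hadj⟩ := mem_nbrSet.1 ha1
    refine Finset.mem_inter.2 ⟨mem_nbrSet.2 ⟨fun h => haX ?_, u, hsub hu, hadj⟩, haT⟩
    exact mem_withTails.2 (Or.inl (Finset.mem_inter.2 ⟨h, haT⟩))
  · exact mem_withTails.2 (Or.inr ⟨p.2, Finset.mem_inter.2 ⟨hsub hpX, (hA p hp).1⟩, hp⟩)

theorem not_mem_of_notMem_freeNodes (hr : r ∈ T) (hA : ∀ p ∈ A, p.2 ∈ T ∧ p.1 ∉ T) {s : Fin n}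
    (hsT : s ∈ T) (hs : s ∉ freeNodes G T r A) {X : Finset (Fin n)}
    (hX : IsViolated G k T r A X) : s ∉ X := fun hsX =>
  hs (((isViolated_withTails_iff hr hA Finset.inter_subset_right).1
    (hX.withTails_inter hA)).2.1 (Finset.mem_inter.2 ⟨hsX, hsT⟩))

/-- The outcome of a finished search from `s`: if at most `k` nodes are assigned to `s`, then the
reachable nodes yield the smallest violated set that contains `s`, and otherwise there is none. -/
theorem IsSearchState.smallest_violated {s : Fin n} (hT : IsKConnected G (k - 1) T) (hr : r ∈ T)
    (hA : ∀ p ∈ A, p.2 ∈ T ∧ p.1 ∉ T) {m : Fin n → ℕ} {R : Finset (Fin n)}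
    {M : Fin n → Fin n → ℕ} (h : IsSearchState (ArcNbr G T A) (freeNodes G T r A) s m R M)
    (hstuck : ∀ u ∈ R, ∀ a, ArcNbr G T A u a → ∃ u' ∈ R, m a = (u' : ℕ) + 1) :
    ((Finset.univ.filter fun a => m a = (s : ℕ) + 1).card ≤ k →
      IsViolated G k T r A (withTails A R) ∧
      ∀ X, IsViolated G k T r A X → s ∈ X → R ⊆ X) ∧
    (k < (Finset.univ.filter fun a => m a = (s : ℕ) + 1).card →
      ∀ X, IsViolated G k T r A X → s ∉ X) := by
  have hRT : R ⊆ T := fun u hu => (mem_freeNodes.1 (h.subset hu)).1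
  have hsT := hRT h.root_mem
  obtain ⟨h1, h2⟩ := h.of_stuck hstuck
  have key : ∀ X, IsViolated G k T r A X → s ∈ X → X ∩ T ⊆ freeNodes G T r A ∧ s ∈ X ∩ T ∧
      (relImage (ArcNbr G T A) (X ∩ T)).card < (X ∩ T).card + k := fun X hX hsX => by
    have := (isViolated_withTails_iff hr hA Finset.inter_subset_right).1 (hX.withTails_inter hA)
    exact ⟨this.2.1, Finset.mem_inter.2 ⟨hsX, hsT⟩, this.2.2⟩
  constructor
  · intro hle
    have hv : IsViolated G k T r A (withTails A R) :=
      (isViolated_withTails_iff hr hA hRT).2 ⟨⟨s, h.root_mem⟩, h.subset, by omega⟩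
    refine ⟨hv, fun X hX hsX => ?_⟩
    obtain ⟨hX1, hX2, hX3⟩ := key X hX hsX
    have h3 := hv.le_card hT hr
    have h4 := card_nbrSet_withTails hA hRT (G := G)
    exact ((h2 _ hX1 hX2).2 (by omega)).trans Finset.inter_subset_left
  · intro hlt X hX hsX
    obtain ⟨hX1, hX2, hX3⟩ := key X hX hsX
    have := (h2 _ hX1 hX2).1
    omega

/-- A violated set that consists of nodes of `T` and of the tails of the arcs entering them is
minimal if no violated set has fewer nodes of `T`. -/
theorem isMinViolated_of_forall_card_le (hA : ∀ p ∈ A, p.2 ∈ T ∧ p.1 ∉ T) {R : Finset (Fin n)}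
    (hRT : R ⊆ T) (hR : IsViolated G k T r A (withTails A R))
    (hmin : ∀ X, IsViolated G k T r A X → R.card ≤ (X ∩ T).card) :
    IsMinViolated G k T r A (withTails A R) := by
  refine ⟨hR, fun X hX hsub => hsub.antisymm ?_⟩
  have h1 : X ∩ T ⊆ R := by
    rw [← withTails_inter hA hRT]
    exact Finset.inter_subset_inter_right hsub
  have h2 := Finset.eq_of_subset_of_card_le h1 (hmin X hX)
  rw [← h2]
  exact withTails_inter_subset hX

end Cores

/-! ### Structured programs with running time bounds -/

namespace Ram

/-- The value of the entry `(0, 0)` of the array `x`. -/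
def NExpr.var (x : ℕ) : NExpr := .read x (.const 0) (.const 0)

/-- Programs whose only loops are counting loops: `loop x P` runs `P` for the values `0, …, n - 1`
of the variable `x`, where `n` is the size of the instance. -/
inductive Structured : Type
  | skip
  | setNat (a : ℕ) (i j e : NExpr)
  | setReal (a : ℕ) (i : NExpr) (e : RExpr)
  | seq (P Q : Structured)
  | ite (b : Test) (P Q : Structured)
  | loop (x : ℕ) (P : Structured)

namespace Structured

/-- The translation to a program of the random access machine. -/
def compile : Structured → Program
  | skip => .skip
  | setNat a i j e => .setNat a i j e
  | setReal a i e => .setReal a i e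
  | seq P Q => .seq P.compile Q.compile
  | ite b P Q => .ite b P.compile Q.compile
  | loop x P =>
    .seq (.setNat x (.const 0) (.const 0) (.const 0))
      (.while (.nonzero (.lt (.var x) (.var 0)))
        (.seq P.compile (.setNat x (.const 0) (.const 0) (.add (.var x) (.const 1)))))

/-- The memory before round `i` of a loop with the variable `x` and the body `f`. -/
noncomputable def iter (x : ℕ) (f : Store → Store) (s : Store) : ℕ → Store
  | 0 => s.setNat x 0 0 0
  | i + 1 => (f (iter x f s i)).setNat x 0 0 (i + 1)

open Classical in
/-- The effect of a structured program on the memory. -/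
noncomputable def run : Structured → Store → Store
  | skip, s => s
  | setNat a i j e, s => s.setNat a (i.eval s) (j.eval s) (e.eval s)
  | setReal a i e, s => s.setReal a (i.eval s) (e.eval s)
  | seq P Q, s => Q.run (P.run s)
  | ite b P Q, s => if b.Holds s then P.run s else Q.run s
  | loop x P, s => iter x P.run s (s.nat 0 0 0)

/-- Whether the program may write to the array `a` of natural numbers. -/
def writes : Structured → ℕ → Bool
  | skip, _ => false
  | setNat a _ _ _, a' => a' == a
  | setReal _ _ _, _ => false
  | seq P Q, a' => P.writes a' || Q.writes a'
  | ite _ P Q, a' => P.writes a' || Q.writes a'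
  | loop x P, a' => a' == x || P.writes a'

/-- Whether the program may write to the array `a` of real numbers. -/
def writesReal : Structured → ℕ → Bool
  | skip, _ => false
  | setNat _ _ _ _, _ => false
  | setReal a _ _, a' => a' == a
  | seq P Q, a' => P.writesReal a' || Q.writesReal a'
  | ite _ P Q, a' => P.writesReal a' || Q.writesReal a'
  | loop _ P, a' => P.writesReal a'

end Structured

@[simp] theorem Store.setNat_nat_self (s : Store) (a i j x : ℕ) :
    (s.setNat a i j x).nat a i j = x := by simp [Store.setNat]

theorem Store.setNat_nat (s : Store) (a i j x a' i' j' : ℕ) :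
    (s.setNat a i j x).nat a' i' j' = if a' = a ∧ i' = i ∧ j' = j then x else s.nat a' i' j' := rfl

theorem Store.setNat_nat_of_ne (s : Store) {a a' : ℕ} (i j x : ℕ) (h : a' ≠ a) :
    (s.setNat a i j x).nat a' = s.nat a' := by
  funext i' j'
  simp [Store.setNat, h]

@[simp] theorem Store.setNat_real (s : Store) (a i j x : ℕ) :
    (s.setNat a i j x).real = s.real := rfl

@[simp] theorem Store.setReal_nat (s : Store) (a i : ℕ) (x : ℝ) :
    (s.setReal a i x).nat = s.nat := rfl

theorem Store.setReal_real (s : Store) (a i : ℕ) (x : ℝ) (a' i' : ℕ) :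
    (s.setReal a i x).real a' i' = if a' = a ∧ i' = i then x else s.real a' i' := rfl

theorem Store.setReal_real_of_ne (s : Store) {a a' : ℕ} (i : ℕ) (x : ℝ) (h : a' ≠ a) :
    (s.setReal a i x).real a' = s.real a' := by
  funext i'
  simp [Store.setReal, h]

namespace Structured

theorem run_nat {P : Structured} {a : ℕ} (h : P.writes a = false) (s : Store) :
    (P.run s).nat a = s.nat a := by
  induction P generalizing s with
  | skip => rfl
  | setNat a' i j e => exact Store.setNat_nat_of_ne _ _ _ _ (by simpa [writes] using h)
  | setReal a' i e => rfl
  | seq P Q ihP ihQ =>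
    simp only [writes, Bool.or_eq_false_iff] at h
    rw [run, ihQ h.2, ihP h.1]
  | ite b P Q ihP ihQ =>
    simp only [writes, Bool.or_eq_false_iff] at h
    rw [run]
    split_ifs
    · exact ihP h.1 s
    · exact ihQ h.2 s
  | loop x P ih =>
    simp only [writes, Bool.or_eq_false_iff, beq_eq_false_iff_ne] at h
    rw [run]
    generalize s.nat 0 0 0 = N
    induction N with
    | zero => exact Store.setNat_nat_of_ne _ _ _ _ h.1
    | succ N ihN => rw [iter, Store.setNat_nat_of_ne _ _ _ _ h.1, ih h.2, ihN]

theorem run_real {P : Structured} {a : ℕ} (h : P.writesReal a = false) (s : Store) :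
    (P.run s).real a = s.real a := by
  induction P generalizing s with
  | skip => rfl
  | setNat a' i j e => rfl
  | setReal a' i e => exact Store.setReal_real_of_ne _ _ _ (by simpa [writesReal] using h)
  | seq P Q ihP ihQ =>
    simp only [writesReal, Bool.or_eq_false_iff] at h
    rw [run, ihQ h.2, ihP h.1]
  | ite b P Q ihP ihQ =>
    simp only [writesReal, Bool.or_eq_false_iff] at h
    rw [run]
    split_ifs
    · exact ihP h.1 s
    · exact ihQ h.2 s
  | loop x P ih =>
    simp only [writesReal] at h
    rw [run]
    generalize s.nat 0 0 0 = N
    induction N with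
    | zero => rfl
    | succ N ihN => rw [iter, Store.setNat_real, ih h, ihN]

end Structured

/-- All sums in the expression range up to the size of the instance. -/
def NExpr.ok : NExpr → Bool
  | const _ => true
  | read _ i j => i.ok && j.ok
  | add e f => e.ok && f.ok
  | sub e f => e.ok && f.ok
  | lt e f => e.ok && f.ok
  | sum x (.read 0 (.const 0) (.const 0)) e => x != 0 && e.ok
  | sum _ _ _ => false

/-- All sums in the expression for a real number range up to the size of the instance. -/
def RExpr.ok : RExpr → Bool
  | zero => true
  | read _ i => i.ok
  | add e f => e.ok && f.ok
  | sub e f => e.ok && f.ok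
  | mulNat e i => e.ok && i.ok
  | divNat e i => e.ok && i.ok

/-- All sums in the condition range up to the size of the instance. -/
def Test.ok : Test → Bool
  | nonzero e => e.ok
  | le e f => e.ok && f.ok

open Polynomial in
/-- A bound on the number of steps for evaluating an expression, as a polynomial in the size of the
instance. -/
noncomputable def NExpr.bound : NExpr → ℕ[X]
  | const _ => 1
  | read _ i j => i.bound + j.bound + 1
  | add e f => e.bound + f.bound + 1
  | sub e f => e.bound + f.bound + 1
  | lt e f => e.bound + f.bound + 1
  | sum _ b e => b.bound + 1 + X * (e.bound + 1)

open Polynomial in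
/-- A bound on the number of steps for evaluating an expression for a real number. -/
noncomputable def RExpr.bound : RExpr → ℕ[X]
  | zero => 1
  | read _ i => i.bound + 1
  | add e f => e.bound + f.bound + 1
  | sub e f => e.bound + f.bound + 1
  | mulNat e i => e.bound + i.bound + 1
  | divNat e i => e.bound + i.bound + 1

open Polynomial in
/-- A bound on the number of steps for evaluating a condition. -/
noncomputable def Test.bound : Test → ℕ[X]
  | nonzero e => e.bound + 1
  | le e f => e.bound + f.bound + 1

theorem NExpr.cost_le {e : NExpr} (h : e.ok = true) {s : Store} {N : ℕ} (hs : s.nat 0 0 0 = N) :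
    e.cost s ≤ e.bound.eval N := by
  induction e generalizing s with
  | const c => simp [cost, bound]
  | read a i j ihi ihj =>
    simp only [ok, Bool.and_eq_true] at h
    simpa [cost, bound] using Nat.add_le_add (ihi h.1 hs) (ihj h.2 hs)
  | add i j ihi ihj =>
    simp only [ok, Bool.and_eq_true] at h
    simpa [cost, bound] using Nat.add_le_add (ihi h.1 hs) (ihj h.2 hs)
  | sub i j ihi ihj =>
    simp only [ok, Bool.and_eq_true] at h
    simpa [cost, bound] using Nat.add_le_add (ihi h.1 hs) (ihj h.2 hs)
  | lt i j ihi ihj =>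
    simp only [ok, Bool.and_eq_true] at h
    simpa [cost, bound] using Nat.add_le_add (ihi h.1 hs) (ihj h.2 hs)
  | sum x b e ihb ihe =>
    have hb : b = .var 0 ∧ x ≠ 0 ∧ e.ok = true := by
      unfold ok at h
      split at h <;> simp_all [NExpr.var]
    obtain ⟨rfl, hx, he⟩ := hb
    have h1 : ∀ i ∈ Finset.range ((NExpr.var 0).eval s), e.cost (s.setNat x 0 0 i) + 1 ≤
        e.bound.eval N + 1 := fun i _ => Nat.succ_le_succ <| ihe he <| by
      rw [Store.setNat_nat_of_ne _ _ _ _ hx.symm, hs]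
    have h2 := Finset.sum_le_sum h1
    have h3 := ihb rfl hs
    have h4 : (NExpr.var 0).eval s = N := hs
    simp only [h4, Finset.sum_const, Finset.card_range, smul_eq_mul] at h2
    simp only [cost, h4, bound, Polynomial.eval_add, Polynomial.eval_mul, Polynomial.eval_X,
      Polynomial.eval_one]
    omega

theorem RExpr.cost_le {e : RExpr} (h : e.ok = true) {s : Store} {N : ℕ} (hs : s.nat 0 0 0 = N) :
    e.cost s ≤ e.bound.eval N := by
  induction e with
  | zero => simp [cost, bound]
  | read a i =>
    simpa [cost, bound] using NExpr.cost_le h hs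
  | add e f ihe ihf =>
    simp only [ok, Bool.and_eq_true] at h
    simpa [cost, bound] using Nat.add_le_add (ihe h.1) (ihf h.2)
  | sub e f ihe ihf =>
    simp only [ok, Bool.and_eq_true] at h
    simpa [cost, bound] using Nat.add_le_add (ihe h.1) (ihf h.2)
  | mulNat e i ih =>
    simp only [ok, Bool.and_eq_true] at h
    simpa [cost, bound] using Nat.add_le_add (ih h.1) (NExpr.cost_le h.2 hs)
  | divNat e i ih =>
    simp only [ok, Bool.and_eq_true] at h
    simpa [cost, bound] using Nat.add_le_add (ih h.1) (NExpr.cost_le h.2 hs)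

theorem Test.cost_le {b : Test} (h : b.ok = true) {s : Store} {N : ℕ} (hs : s.nat 0 0 0 = N) :
    b.cost s ≤ b.bound.eval N := by
  cases b with
  | nonzero e => simpa [cost, bound] using NExpr.cost_le h hs
  | le e f =>
    simp only [ok, Bool.and_eq_true] at h
    simpa [cost, bound] using Nat.add_le_add (RExpr.cost_le h.1 hs) (RExpr.cost_le h.2 hs)

namespace Structured

/-- The size of the instance is not overwritten, the loop variables are not overwritten in the
bodies of the loops, and all sums range up to the size of the instance. -/
def ok : Structured → Bool
  | skip => true
  | setNat a i j e => a != 0 && (i.ok && (j.ok && e.ok))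
  | setReal _ i e => i.ok && e.ok
  | seq P Q => P.ok && Q.ok
  | ite b P Q => b.ok && (P.ok && Q.ok)
  | loop x P => x != 0 && (!P.writes x && P.ok)

open Polynomial in
/-- A bound on the running time of a structured program, as a polynomial in the size of the
instance. -/
noncomputable def bound : Structured → ℕ[X]
  | skip => 1
  | setNat _ i j e => i.bound + j.bound + e.bound + 1
  | setReal _ i e => i.bound + e.bound + 1
  | seq P Q => P.bound + Q.bound
  | ite b P Q => b.bound + (P.bound + Q.bound)
  | loop _ P => 12 + X * (16 + P.bound)

theorem writes_zero {P : Structured} (h : P.ok = true) : P.writes 0 = false := by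
  induction P with
  | skip => rfl
  | setNat a i j e =>
    simp only [ok, Bool.and_eq_true, bne_iff_ne] at h
    simpa [writes] using h.1.symm
  | setReal a i e => rfl
  | seq P Q ihP ihQ =>
    simp only [ok, Bool.and_eq_true] at h
    simp [writes, ihP h.1, ihQ h.2]
  | ite b P Q ihP ihQ =>
    simp only [ok, Bool.and_eq_true] at h
    simp [writes, ihP h.2.1, ihQ h.2.2]
  | loop x P ih =>
    simp only [ok, Bool.and_eq_true, bne_iff_ne] at h
    simpa [writes, ih h.2.2] using h.1.symm

/-- A structured program computes `run` in polynomial time. -/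
theorem exec_run {P : Structured} (h : P.ok = true) {s : Store} {N : ℕ} (hs : s.nat 0 0 0 = N) :
    ∃ t, Exec P.compile s t (P.run s) ∧ t ≤ P.bound.eval N := by
  induction P generalizing s with
  | skip => exact ⟨1, .skip s, by simp [bound]⟩
  | setNat a i j e =>
    simp only [ok, Bool.and_eq_true] at h
    refine ⟨_, .setNat a i j e s, ?_⟩
    have h1 := NExpr.cost_le h.2.1 hs
    have h2 := NExpr.cost_le h.2.2.1 hs
    have h3 := NExpr.cost_le h.2.2.2 hs
    simp only [bound, Polynomial.eval_add, Polynomial.eval_one]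
    omega
  | setReal a i e =>
    simp only [ok, Bool.and_eq_true] at h
    refine ⟨_, .setReal a i e s, ?_⟩
    have h1 := NExpr.cost_le h.1 hs
    have h2 := RExpr.cost_le h.2 hs
    simp only [bound, Polynomial.eval_add, Polynomial.eval_one]
    omega
  | seq P Q ihP ihQ =>
    simp only [ok, Bool.and_eq_true] at h
    obtain ⟨t₁, h1, h1'⟩ := ihP h.1 hs
    obtain ⟨t₂, h2, h2'⟩ := ihQ h.2 (s := P.run s) (by rw [run_nat (writes_zero h.1), hs])
    exact ⟨_, .seq h1 h2, by simpa [bound] using Nat.add_le_add h1' h2'⟩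
  | ite b P Q ihP ihQ =>
    simp only [ok, Bool.and_eq_true] at h
    have h0 := Test.cost_le h.1 hs
    obtain ⟨t₁, h1, h1'⟩ := ihP h.2.1 hs
    obtain ⟨t₂, h2, h2'⟩ := ihQ h.2.2 hs
    simp only [bound, Polynomial.eval_add]
    by_cases hb : b.Holds s
    · exact ⟨b.cost s + t₁, by rw [run, if_pos hb]; exact .iteTrue hb h1, by omega⟩
    · exact ⟨b.cost s + t₂, by rw [run, if_neg hb]; exact .iteFalse hb h2, by omega⟩
  | loop x P ih =>
    simp only [ok, Bool.and_eq_true, bne_iff_ne, Bool.not_eq_true'] at h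
    obtain ⟨hx, hw, hP⟩ := h
    have hiter : ∀ i, (iter x P.run s i).nat x 0 0 = i ∧ (iter x P.run s i).nat 0 0 0 = N := by
      intro i
      induction i with
      | zero => exact ⟨by simp [iter], by rw [iter, Store.setNat_nat_of_ne _ _ _ _ hx.symm, hs]⟩
      | succ i ihi =>
        refine ⟨by simp [iter], ?_⟩
        rw [iter, Store.setNat_nat_of_ne _ _ _ _ hx.symm, run_nat (writes_zero hP), ihi.2]
    have key : ∀ d i, i + d = N → ∃ t, Exec (.while (.nonzero (.lt (.var x) (.var 0)))
        (.seq P.compile (.setNat x (.const 0) (.const 0) (.add (.var x) (.const 1)))))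
        (iter x P.run s i) t (iter x P.run s N) ∧ t ≤ 8 + d * (16 + P.bound.eval N) := by
      intro d
      induction d with
      | zero =>
        intro i hi
        obtain rfl : i = N := by omega
        refine ⟨_, .whileFalse ?_, ?_⟩
        · simp [Test.Holds, NExpr.eval, NExpr.var, hiter]
        · simp [Test.cost, NExpr.cost, NExpr.var]
      | succ d ihd =>
        intro i hi
        obtain ⟨t₁, h1, h1'⟩ := ih hP (hiter i).2
        obtain ⟨t₂, h2, h2'⟩ := ihd (i + 1) (by omega)
        have h3 : Exec (.setNat x (.const 0) (.const 0) (.add (.var x) (.const 1)))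
            (P.run (iter x P.run s i)) 8 (iter x P.run s (i + 1)) := by
          have h4 := Exec.setNat x (.const 0) (.const 0) (.add (.var x) (.const 1))
            (P.run (iter x P.run s i))
          have h5 : (P.run (iter x P.run s i)).nat x 0 0 = i := by rw [run_nat hw, (hiter i).1]
          simpa [NExpr.cost, NExpr.eval, NExpr.var, h5, iter] using h4
        refine ⟨_, .whileTrue ?_ (.seq h1 h3) h2, ?_⟩
        · have : i < N := by omega
          simp [Test.Holds, NExpr.eval, NExpr.var, hiter, this]
        · simp only [Test.cost, NExpr.cost, NExpr.var]
          rw [Nat.add_mul, one_mul]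
          omega
    obtain ⟨t, ht, ht'⟩ := key N 0 (by omega)
    refine ⟨_, .seq (.setNat x (.const 0) (.const 0) (.const 0) s)
      (by rw [run, hs]; exact ht : Exec _ _ t ((loop x P).run s)), ?_⟩
    simp only [bound, Polynomial.eval_add, Polynomial.eval_mul, Polynomial.eval_X,
      Polynomial.eval_ofNat, NExpr.cost]
    omega

/-- Induction over the rounds of a loop. -/
theorem run_loop {x : ℕ} {P : Structured} (hok : (loop x P).ok = true) (s : Store)
    (I : ℕ → Store → Prop) (h0 : I 0 (s.setNat x 0 0 0))
    (hstep : ∀ i s', i < s.nat 0 0 0 → s'.nat x 0 0 = i → s'.nat 0 = s.nat 0 → I i s' →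
      I (i + 1) ((P.run s').setNat x 0 0 (i + 1))) :
    I (s.nat 0 0 0) ((loop x P).run s) := by
  simp only [ok, Bool.and_eq_true, bne_iff_ne, Bool.not_eq_true'] at hok
  obtain ⟨hx, hw, hP⟩ := hok
  rw [run]
  have key : ∀ i, i ≤ s.nat 0 0 0 → I i (iter x P.run s i) ∧ (iter x P.run s i).nat x 0 0 = i ∧
      (iter x P.run s i).nat 0 = s.nat 0 := by
    intro i
    induction i with
    | zero =>
      exact fun _ => ⟨h0, by simp [iter], by rw [iter, Store.setNat_nat_of_ne _ _ _ _ hx.symm]⟩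
    | succ i ih =>
      intro hi
      obtain ⟨h1, h2, h3⟩ := ih (by omega)
      refine ⟨hstep i _ (by omega) h2 h3 h1, by simp [iter], ?_⟩
      rw [iter, Store.setNat_nat_of_ne _ _ _ _ hx.symm, run_nat (writes_zero hP), h3]
  exact (key _ le_rfl).1

/-- A loop that fills row `c` of the array `a` with the values of `f`. -/
theorem run_fill {x a : ℕ} {i e : NExpr} (hok : (loop x (setNat a i (.var x) e)).ok = true)
    (s : Store) (c : ℕ) (f : ℕ → ℕ)
    (h : ∀ j s', j < s.nat 0 0 0 → s'.nat x 0 0 = j → s'.real = s.real →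
      (∀ b, b ≠ x → b ≠ a → s'.nat b = s.nat b) → (∀ i', i' ≠ c → s'.nat a i' = s.nat a i') →
      i.eval s' = c ∧ e.eval s' = f j) (i' j' : ℕ) :
    ((loop x (setNat a i (.var x) e)).run s).nat a i' j' =
      if i' = c ∧ j' < s.nat 0 0 0 then f j' else s.nat a i' j' := by
  have hax : a ≠ x := by
    simp only [ok, writes, Bool.and_eq_true, bne_iff_ne, Bool.not_eq_true',
      beq_eq_false_iff_ne] at hok
    exact hok.2.1.symm
  have key := run_loop hok s (fun j s' => s'.real = s.real ∧
    (∀ b, b ≠ x → b ≠ a → s'.nat b = s.nat b) ∧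
    ∀ i' j', s'.nat a i' j' = if i' = c ∧ j' < j then f j' else s.nat a i' j') ?_ ?_
  · exact key.2.2 i' j'
  · refine ⟨rfl, fun b hb _ => Store.setNat_nat_of_ne _ _ _ _ hb, fun i' j' => ?_⟩
    rw [Store.setNat_nat_of_ne _ _ _ _ hax]
    simp
  · rintro j s' hj hx - ⟨hreal, h1, h2⟩
    obtain ⟨h3, h4⟩ := h j s' hj hx hreal h1 fun i' hi' => by
      funext j'
      rw [h2, if_neg (fun hh => hi' hh.1)]
    have h5 : (NExpr.var x).eval s' = j := hx
    refine ⟨hreal, fun b hb hba => ?_, fun i' j' => ?_⟩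
    · rw [Store.setNat_nat_of_ne _ _ _ _ hb, run, Store.setNat_nat_of_ne _ _ _ _ hba, h1 b hb hba]
    · rw [Store.setNat_nat_of_ne _ _ _ _ hax, run, h3, h4, h5, Store.setNat_nat, h2]
      by_cases hi : i' = c
      · by_cases hj' : j' = j
        · subst hj'; simp [hi]
        · have : (j' < j + 1) ↔ j' < j := by omega
          simp [hi, hj', this]
      · simp [hi]

end Structured

/-! ### Boolean expressions -/

namespace NExpr

/-- Conjunction, where nonzero numbers count as true. -/
def and (e f : NExpr) : NExpr := .lt (.const 1) (.add (.lt (.const 0) e) (.lt (.const 0) f))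

/-- Negation, where nonzero numbers count as true. -/
def not (e : NExpr) : NExpr := .lt e (.const 1)

/-- Equality. -/
def eq (e f : NExpr) : NExpr := .not (.add (.sub e f) (.sub f e))

/-- Whether `e` is nonzero for some value less than `n` of the variable `x`. -/
def ex (x : ℕ) (e : NExpr) : NExpr := .sum x (.var 0) e

/-- Entry `(0, i)` of the array `a`, where `i` is the value of the variable `x`. -/
def row (a x : ℕ) : NExpr := .read a (.const 0) (.var x)

/-- Entry `(i, j)` of the array `a`, where `i` and `j` are the values of the variables `x`, `y`. -/
def entry (a x y : ℕ) : NExpr := .read a (.var x) (.var y)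

variable (s : Store) (e f : NExpr)

@[simp] theorem eval_var (x : ℕ) : (var x).eval s = s.nat x 0 0 := rfl

@[simp] theorem eval_const (c : ℕ) : (const c).eval s = c := rfl

@[simp] theorem eval_row (a x : ℕ) : (row a x).eval s = s.nat a 0 (s.nat x 0 0) := rfl

@[simp] theorem eval_entry (a x y : ℕ) :
    (entry a x y).eval s = s.nat a (s.nat x 0 0) (s.nat y 0 0) := rfl

@[simp] theorem eval_add : (add e f).eval s = e.eval s + f.eval s := rfl

@[simp] theorem eval_sub : (sub e f).eval s = e.eval s - f.eval s := rfl

@[simp] theorem eval_read (a : ℕ) : (read a e f).eval s = s.nat a (e.eval s) (f.eval s) := rfl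

@[simp] theorem eval_lt_eq_zero : (lt e f).eval s = 0 ↔ f.eval s ≤ e.eval s := by
  simp [eval]

@[simp] theorem eval_and_eq_zero : (and e f).eval s = 0 ↔ e.eval s = 0 ∨ f.eval s = 0 := by
  by_cases h : e.eval s = 0 <;> by_cases h' : f.eval s = 0 <;>
    simp [and, eval, h, h', Nat.pos_iff_ne_zero]

@[simp] theorem eval_not_eq_zero : (not e).eval s = 0 ↔ e.eval s ≠ 0 := by
  by_cases h : e.eval s = 0 <;> simp [not, eval, h]

@[simp] theorem eval_eq_eq_zero : (eq e f).eval s = 0 ↔ e.eval s ≠ f.eval s := by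
  simp only [eq, eval_not_eq_zero, eval_add, eval_sub]
  omega

theorem eval_not : (not e).eval s = if e.eval s = 0 then 1 else 0 := by
  simp [not, eval]

theorem eval_eq : (eq e f).eval s = if e.eval s = f.eval s then 1 else 0 := by
  rw [eq, eval_not]
  refine if_congr ?_ rfl rfl
  simp only [eval_add, eval_sub]
  omega

@[simp] theorem eval_ex_eq_zero (x : ℕ) : (ex x e).eval s = 0 ↔
    ∀ i < s.nat 0 0 0, e.eval (s.setNat x 0 0 i) = 0 := by
  simp [ex, eval]

end NExpr

end Ram

/-! ### The search for minimal violated sets as a program -/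

/- The arrays of natural numbers are used as follows; a variable is the entry `(0, 0)` of an array.
`0`, `1`, `3`, `4`: the instance (number of nodes, requirement, graph, set `T`).
`5`: row `0` marks the nodes that have been bought.
`6`: entry `(v, t)` is nonzero for an arc `(v, t)`; in the growth phase it is its order number.
`7`, `8`: the next node on the path of the arc `(v, t)`, and whether the path has to be bought.
`9`, `10`: tail and head of the arc with a given order number. Variable `11`: the number of arcs.
Variable `12`: the root.
`13`, `14`, `15`: assignment, reachable nodes and shifted assignments of the search.
`16`, `17`, `18`: results of `findPair`. Variable `21`: the starting node of the search.
Variable `19` and row `0` of `20`: the best set found by `findCore`.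
`34`, `35`, `36`, `37`: results of `findMin`. Variables `44`, `45`: the arc under examination.
All others are auxiliary variables.
The arrays of real numbers hold the weights (`0`), the heights (`1`), the prices of the arcs by
order number (`2`) and the minimum found by `findMin` (`3`). -/

namespace Ram

open NExpr Structured

/-- The memory holds the instance: the arrays `0`, `1`, `3`, `4` and the array `0` of real numbers
contain the number of nodes, the requirement, the graph, the set `T` and the weights. -/
structure IsInstance {n : ℕ} (k : ℕ) (G : SimpleGraph (Fin n)) (w : Fin n → ℝ)
    (T : Finset (Fin n)) (s : Store) : Prop where
  size : s.nat 0 0 0 = n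
  req : s.nat 1 0 0 = k
  adj : ∀ u v : Fin n, s.nat 3 u v ≠ 0 ↔ G.Adj u v
  terminal : ∀ v : Fin n, s.nat 4 0 v ≠ 0 ↔ v ∈ T
  weight : ∀ v : Fin n, s.real 0 v = w v

/-- The arcs with a nonzero entry in array `6`. -/
def arcSet (n : ℕ) (s : Store) : Finset (Fin n × Fin n) :=
  Finset.univ.filter fun p => s.nat 6 p.1 p.2 ≠ 0

/-- The nodes with a nonzero entry in row `0` of the array `a`. -/
def rowSet (n a : ℕ) (s : Store) : Finset (Fin n) :=
  Finset.univ.filter fun v => s.nat a 0 v ≠ 0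

theorem mem_arcSet {n : ℕ} {s : Store} {p : Fin n × Fin n} :
    p ∈ arcSet n s ↔ s.nat 6 p.1 p.2 ≠ 0 := by simp [arcSet]

theorem mem_rowSet {n a : ℕ} {s : Store} {v : Fin n} : v ∈ rowSet n a s ↔ s.nat a 0 v ≠ 0 := by
  simp [rowSet]

theorem arcSet_congr {n : ℕ} {s s' : Store} (h : s'.nat 6 = s.nat 6) :
    arcSet n s' = arcSet n s := by
  simp only [arcSet, h]

theorem rowSet_congr {n a : ℕ} {s s' : Store} (h : s'.nat a = s.nat a) :
    rowSet n a s' = rowSet n a s := by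
  simp only [rowSet, h]

variable {n k : ℕ} {G : SimpleGraph (Fin n)} {w : Fin n → ℝ} {T : Finset (Fin n)}

theorem IsInstance.congr {s s' : Store} (h : IsInstance k G w T s) (h0 : s'.nat 0 = s.nat 0)
    (h1 : s'.nat 1 = s.nat 1) (h3 : s'.nat 3 = s.nat 3) (h4 : s'.nat 4 = s.nat 4)
    (hw : s'.real 0 = s.real 0) : IsInstance k G w T s' :=
  ⟨by rw [h0, h.size], by rw [h1, h.req], fun u v => by rw [h3, h.adj],
    fun v => by rw [h4, h.terminal], fun v => by rw [hw, h.weight]⟩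

theorem IsInstance.run {s : Store} (h : IsInstance k G w T s) {P : Structured}
    (h0 : P.writes 0 = false) (h1 : P.writes 1 = false) (h3 : P.writes 3 = false)
    (h4 : P.writes 4 = false) (hw : P.writesReal 0 = false) : IsInstance k G w T (P.run s) :=
  h.congr (run_nat h0 s) (run_nat h1 s) (run_nat h3 s) (run_nat h4 s) (run_real hw s)

/-- The relation `ArcNbr` between the values of two variables. -/
def nbrExpr (x y : ℕ) : NExpr :=
  and (row 4 x) (and (row 4 y) (.add (eq (var x) (var y)) (.add (entry 3 x y)
    (ex 27 (and (entry 6 27 x) (entry 3 27 y))))))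

theorem eval_nbrExpr {s : Store} (h : IsInstance k G w T s) {x y : ℕ} (hx : x ≠ 27) (hy : y ≠ 27)
    {u a : Fin n} (hu : s.nat x 0 0 = u) (ha : s.nat y 0 0 = a) :
    (nbrExpr x y).eval s = 0 ↔ ¬ ArcNbr G T (arcSet n s) u a := by
  have e1 : (∀ i < s.nat 0 0 0, (and (entry 6 27 x) (entry 3 27 y)).eval (s.setNat 27 0 0 i) = 0) ↔
      ∀ v : Fin n, ¬ ((v, u) ∈ arcSet n s ∧ G.Adj v a) := by
    rw [h.size, Fin.forall_iff]
    refine forall₂_congr fun i hi => ?_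
    have h3 := h.adj ⟨i, hi⟩ a
    have h6 := mem_arcSet (s := s) (p := (⟨i, hi⟩, u))
    simp only at h3 h6
    rw [← h3, h6]
    simp [Store.setNat_nat_of_ne, hx, hy, hu, ha]
    tauto
  have h4u := h.terminal u
  have h4a := h.terminal a
  have h3 := h.adj u a
  rw [nbrExpr, eval_and_eq_zero, eval_and_eq_zero, eval_add, eval_add, Nat.add_eq_zero_iff,
    Nat.add_eq_zero_iff, eval_eq_eq_zero, eval_ex_eq_zero, e1, ArcNbr, ← h4u, ← h4a, ← h3]
  simp only [eval_row, eval_var, eval_entry, hu, ha, ne_eq, Fin.val_inj]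
  push Not
  tauto

/-- Whether the value of `x` is a node of `T` without the root, the value of variable `12`, as a
neighbour. -/
def freeExpr (x : ℕ) : NExpr := and (row 4 x) (not (nbrExpr x 12))

theorem eval_freeExpr {s : Store} (h : IsInstance k G w T s) {x : ℕ} (hx : x ≠ 27)
    {r u : Fin n} (hr : s.nat 12 0 0 = r) (hu : s.nat x 0 0 = u) :
    (freeExpr x).eval s ≠ 0 ↔ u ∈ freeNodes G T r (arcSet n s) := by
  have h1 := eval_nbrExpr h hx (show 12 ≠ 27 by norm_num) hu hr
  rw [mem_freeNodes, ← h.terminal u, ← h1, freeExpr, Ne, eval_and_eq_zero, eval_row, hu,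
    eval_not_eq_zero, not_or, not_not]

/-- Assignment to a variable. -/
def assign (x : ℕ) (e : NExpr) : Structured := .setNat x (.const 0) (.const 0) e

/-- Search for values of the variables `24` and `25` that satisfy `c`; variable `16` tells whether
such values exist, and they are stored in the variables `17` and `18`. -/
def findPair (c : NExpr) : Structured :=
  .seq (assign 16 (.const 0)) (.loop 24 (.loop 25 (.ite (.nonzero c)
    (.seq (assign 16 (.const 1)) (.seq (assign 17 (var 24)) (assign 18 (var 25)))) .skip)))

theorem findPair_frame (c : NExpr) {b : ℕ} (hb : b ∉ [16, 17, 18, 24, 25]) (s : Store) :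
    ((findPair c).run s).nat b = s.nat b := by
  apply run_nat
  simp at hb
  simp [findPair, writes, assign, hb]

theorem run_findPair {c : NExpr} (hok : c.ok = true) (s : Store) (Φ : ℕ → ℕ → Prop)
    (hc : ∀ s' : Store, ∀ u a, u < s.nat 0 0 0 → a < s.nat 0 0 0 → s'.real = s.real →
      (∀ b, b ∉ [16, 17, 18, 24, 25] → s'.nat b = s.nat b) → s'.nat 24 0 0 = u →
      s'.nat 25 0 0 = a → (c.eval s' ≠ 0 ↔ Φ u a)) :
    (((findPair c).run s).nat 16 0 0 = 0 ∧
      ∀ u < s.nat 0 0 0, ∀ a < s.nat 0 0 0, ¬ Φ u a) ∨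
    (((findPair c).run s).nat 16 0 0 ≠ 0 ∧ ∃ u < s.nat 0 0 0, ∃ a < s.nat 0 0 0,
      ((findPair c).run s).nat 17 0 0 = u ∧ ((findPair c).run s).nat 18 0 0 = a ∧ Φ u a) := by
  let I : (ℕ → ℕ → Prop) → Store → Prop := fun D s' =>
    (s'.real = s.real ∧ ∀ b, b ∉ [16, 17, 18, 24, 25] → s'.nat b = s.nat b) ∧
    ((s'.nat 16 0 0 = 0 ∧ ∀ u < s.nat 0 0 0, ∀ a < s.nat 0 0 0, D u a → ¬ Φ u a) ∨
    (s'.nat 16 0 0 ≠ 0 ∧ ∃ u < s.nat 0 0 0, ∃ a < s.nat 0 0 0,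
      s'.nat 17 0 0 = u ∧ s'.nat 18 0 0 = a ∧ Φ u a))
  have hI : ∀ D s' x v, (x = 24 ∨ x = 25) → I D s' → I D (s'.setNat x 0 0 v) := by
    rintro D s' x v hx ⟨h1, h2⟩
    refine ⟨⟨h1.1, fun b hb => ?_⟩, ?_⟩
    · rw [Store.setNat_nat_of_ne, h1.2 b hb]
      rintro rfl
      rcases hx with rfl | rfl <;> simp at hb
    · rcases hx with rfl | rfl <;> simpa [Store.setNat_nat_of_ne] using h2
  have hmono : ∀ (D D' : ℕ → ℕ → Prop) s',
      (∀ u < s.nat 0 0 0, ∀ a < s.nat 0 0 0, D' u a → D u a) → I D s' → I D' s' := by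
    rintro D D' s' hD ⟨h1, h2⟩
    exact ⟨h1, h2.imp (fun h => ⟨h.1, fun u hu a ha hd => h.2 u hu a ha (hD u hu a ha hd)⟩) id⟩
  have hok2 : (Structured.loop 25 (.ite (.nonzero c)
    (.seq (assign 16 (.const 1)) (.seq (assign 17 (var 24)) (assign 18 (var 25)))) .skip)).ok
      = true := by
    simp [Structured.ok, assign, writes, Test.ok, NExpr.ok, hok, var]
  have hok1 : (Structured.loop 24 (.loop 25 (.ite (.nonzero c)
    (.seq (assign 16 (.const 1)) (.seq (assign 17 (var 24)) (assign 18 (var 25)))) .skip))).ok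
      = true := by
    simp [Structured.ok, assign, writes, Test.ok, NExpr.ok, hok, var]
  have key := run_loop hok1 (s.setNat 16 0 0 0) (fun i s' => I (fun u _ => u < i) s') ?_ ?_
  · obtain ⟨-, h2⟩ := key
    refine h2.imp (fun h => ⟨h.1, fun u hu a ha => h.2 u hu a ha ?_⟩) id
    simpa [Store.setNat_nat_of_ne] using hu
  · refine hI _ _ _ _ (Or.inl rfl)
      ⟨⟨rfl, fun b hb => ?_⟩, Or.inl ⟨by simp, fun u _ a _ h => by omega⟩⟩
    rw [Store.setNat_nat_of_ne]
    rintro rfl; simp at hb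
  · intro i s' hi h24 h0 hIi
    have hsz : s'.nat 0 0 0 = s.nat 0 0 0 := by rw [h0]; simp [Store.setNat_nat_of_ne]
    have key2 := run_loop hok2 s' (fun j s'' => s''.nat 24 0 0 = i ∧
      I (fun u a => u < i ∨ (u = i ∧ a < j)) s'') ?_ ?_
    · refine hI _ _ _ _ (Or.inl rfl) (hmono _ _ _ (fun u _ a ha h => ?_) key2.2)
      omega
    · refine ⟨by simpa [Store.setNat_nat_of_ne] using h24,
        hI _ _ _ _ (Or.inr rfl) (hmono _ _ _ (fun u _ a ha h => ?_) hIi)⟩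
      omega
    · rintro j s'' hj h25 - ⟨h24', hIj⟩
      rw [Store.setNat_nat_of_ne _ _ _ _ (by decide)] at hi
      rw [hsz] at hj
      have hcj := hc s'' i j hi hj hIj.1.1 hIj.1.2 h24' h25
      rw [Structured.run]
      by_cases hcz : c.eval s'' = 0
      · rw [if_neg (by simpa [Test.Holds] using hcz), Structured.run]
        refine ⟨by simpa [Store.setNat_nat_of_ne] using h24', hI _ _ _ _ (Or.inr rfl) ?_⟩
        obtain ⟨h1, h2⟩ := hIj
        refine ⟨h1, h2.imp (fun h => ⟨h.1, fun u hu a ha hd => ?_⟩) id⟩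
        by_cases hua : u = i ∧ a = j
        · obtain ⟨rfl, rfl⟩ := hua
          exact fun hΦ => hcj.2 hΦ hcz
        · exact h.2 u hu a ha (by omega)
      · rw [if_pos (by simpa [Test.Holds] using hcz)]
        refine ⟨by simpa [Structured.run, assign, Store.setNat_nat_of_ne] using h24',
          hI _ _ _ _ (Or.inr rfl)
            ⟨⟨hIj.1.1, fun b hb => ?_⟩, Or.inr ⟨?_, i, hi, j, hj, ?_, ?_, hcj.1 hcz⟩⟩⟩
        · rw [← hIj.1.2 b hb]
          simp only [List.mem_cons, List.not_mem_nil, or_false, not_or] at hb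
          simp only [Structured.run, assign]
          rw [Store.setNat_nat_of_ne _ _ _ _ hb.2.2.1, Store.setNat_nat_of_ne _ _ _ _ hb.2.1,
            Store.setNat_nat_of_ne _ _ _ _ hb.1]
        · simp [Structured.run, assign, Store.setNat_nat_of_ne]
        · simpa [Structured.run, assign, Store.setNat_nat_of_ne] using h24'
        · simpa [Structured.run, assign, Store.setNat_nat_of_ne] using h25

end Ram

namespace Ram

open NExpr Structured

variable {n k : ℕ} {G : SimpleGraph (Fin n)} {w : Fin n → ℝ} {T : Finset (Fin n)}

/-- Restart of the search: only the value of variable `21` is reachable. -/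
def resetSearch : Structured :=
  .seq (.loop 26 (.setNat 14 (.const 0) (var 26) (eq (var 26) (var 21))))
    (.loop 26 (.setNat 15 (var 21) (var 26) (row 13 26)))

/-- The initial assignment gives each node that is contained in a set without the root in its closed
neighbourhood to itself. -/
def initAssignment : Structured :=
  .loop 26 (.setNat 13 (.const 0) (var 26)
    (.sub (.add (var 26) (.const 1)) (.sum 28 (var 0) (not (freeExpr 26)))))

/-- Some node that is related to a reachable node is unassigned or assigned to a node that is not
known to be reachable. -/
def canContinue : NExpr :=
  and (row 14 24) (and (nbrExpr 24 25) (.add (not (row 13 25))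
    (not (.read 14 (.const 0) (.sub (row 13 25) (.const 1))))))

/-- The node `u'` that has the found node assigned to it becomes reachable. -/
def extendSearch : Structured :=
  .seq (assign 43 (.sub (row 13 18) (.const 1)))
    (.seq (.loop 26 (.setNat 15 (var 43) (var 26) (entry 15 17 26)))
      (.seq (.setNat 15 (var 43) (var 18) (.add (var 17) (.const 1)))
        (.setNat 14 (.const 0) (var 43) (.const 1))))

/-- The found node, which is unassigned, is assigned after a shift of the assignment, and the search
is restarted. -/
def augment : Structured :=
  .seq (.loop 26 (.setNat 13 (.const 0) (var 26) (entry 15 17 26)))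
    (.seq (.setNat 13 (.const 0) (var 18) (.add (var 17) (.const 1))) resetSearch)

/-- One extension of the search or one augmentation of the assignment, if possible. -/
def searchStep : Structured :=
  .seq (findPair canContinue) (.ite (.nonzero (var 16))
    (.ite (.nonzero (row 13 18)) extendSearch augment) .skip)

/-- The search for the smallest violated set that contains the value of variable `21`. -/
def search : Structured :=
  .seq initAssignment (.seq resetSearch (.loop 22 (.loop 23 searchStep)))

theorem run_resetSearch {s : Store} (hs : s.nat 0 0 0 = n) {s₀ : Fin n} (h21 : s.nat 21 0 0 = s₀) :
    rowSet n 14 (resetSearch.run s) = {s₀} ∧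
      ∀ a : Fin n, (resetSearch.run s).nat 15 s₀ a = s.nat 13 0 a := by
  rw [resetSearch, Structured.run]
  set P := Structured.loop 26 (.setNat 14 (.const 0) (var 26) (eq (var 26) (var 21)))
  set Q := Structured.loop 26 (.setNat 15 (var 21) (var 26) (row 13 26))
  have hP : ∀ b, b ≠ 26 → b ≠ 14 → (P.run s).nat b = s.nat b := fun b h1 h2 =>
    run_nat (by simp [P, writes, h1, h2]) s
  have h1 := run_fill (x := 26) (a := 14) (i := .const 0) (e := eq (var 26) (var 21)) rfl s 0
    (fun j => if j = s₀ then 1 else 0) (fun j s' _ hx _ hb _ => by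
      refine ⟨rfl, ?_⟩
      rw [eval_eq, eval_var, eval_var, hx, hb 21 (by decide) (by decide), h21])
  have h2 := run_fill (x := 26) (a := 15) (i := var 21) (e := row 13 26) rfl (P.run s) s₀
    (fun j => s.nat 13 0 j) (fun j s' _ hx _ hb _ => by
      refine ⟨?_, ?_⟩
      · rw [eval_var, hb 21 (by decide) (by decide), hP 21 (by decide) (by decide), h21]
      · rw [eval_row, hb 13 (by decide) (by decide), hP 13 (by decide) (by decide), hx])
  have h0 : (P.run s).nat 0 0 0 = n := by rw [hP 0 (by decide) (by decide), hs]
  constructor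
  · ext v
    rw [mem_rowSet, run_nat (P := Q) rfl, h1, hs]
    simp [Fin.val_inj]
  · intro a
    rw [h2, h0]
    simp

theorem run_extendSearch {s : Store} (hs : s.nat 0 0 0 = n) {u a u' : Fin n} (hu : s.nat 17 0 0 = u)
    (ha : s.nat 18 0 0 = a) (hm : s.nat 13 0 a = u' + 1) (hne : u ≠ u') :
    rowSet n 14 (extendSearch.run s) = insert u' (rowSet n 14 s) ∧
      (∀ x : Fin n, x ≠ u' → (extendSearch.run s).nat 15 x = s.nat 15 x) ∧
      ∀ b : Fin n, (extendSearch.run s).nat 15 u' b =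
        if b = a then (u : ℕ) + 1 else s.nat 15 u b := by
  simp only [extendSearch, Structured.run.eq_4, assign]
  set s₁ := (Structured.setNat 43 (.const 0) (.const 0) (.sub (row 13 18) (.const 1))).run s
    with hs1
  have e1 : s₁.nat 43 0 0 = u' := by
    simp [hs1, Structured.run, ha, hm]
  have e2 : ∀ b, b ≠ 43 → s₁.nat b = s.nat b := fun b hb => run_nat (by simp [writes, hb]) s
  set Q := Structured.loop 26 (.setNat 15 (var 43) (var 26) (entry 15 17 26)) with hQ
  have h2 := run_fill (x := 26) (a := 15) (i := var 43) (e := entry 15 17 26) rfl s₁ u'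
    (fun j => s.nat 15 u j) (fun j s' _ hx _ hb hrow => by
      refine ⟨?_, ?_⟩
      · rw [eval_var, hb 43 (by decide) (by decide), e1]
      · rw [eval_entry, hb 17 (by decide) (by decide), hx, e2 17 (by decide), hu,
          hrow u (fun h => hne (Fin.ext h)), e2 15 (by decide)])
  have e3 : ∀ b, b ≠ 43 → b ≠ 26 → b ≠ 15 → (Q.run s₁).nat b = s.nat b := fun b h1 h2 h3 => by
    rw [run_nat (by simp [hQ, writes, h2, h3]), e2 b h1]
  have e4 : (Q.run s₁).nat 43 0 0 = u' := by rw [run_nat (by rfl), e1]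
  have e5 : s₁.nat 0 0 0 = n := by rw [e2 0 (by decide), hs]
  rw [← hQ, e5, e2 15 (by decide)] at h2
  simp only [Structured.run.eq_2, eval_var, eval_const, eval_add, e3 18 (by decide) (by decide)
    (by decide), e3 17 (by decide) (by decide) (by decide), e4, hu, ha,
    Store.setNat_nat_of_ne _ _ _ _ (by decide : 43 ≠ 15)]
  refine ⟨?_, ?_, ?_⟩
  · ext v
    rw [mem_rowSet, Finset.mem_insert, mem_rowSet, Store.setNat_nat,
      Store.setNat_nat_of_ne _ _ _ _ (by decide), e3 14 (by decide) (by decide) (by decide)]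
    by_cases hv : v = u'
    · simp [hv]
    · have : (v : ℕ) ≠ u' := fun h => hv (Fin.ext h)
      simp [hv, this]
  · intro x hx
    have hx' : (x : ℕ) ≠ u' := fun h => hx (Fin.ext h)
    funext b
    rw [Store.setNat_nat_of_ne _ _ _ _ (by decide), Store.setNat_nat, h2]
    simp [hx']
  · intro b
    rw [Store.setNat_nat_of_ne _ _ _ _ (by decide), Store.setNat_nat, h2]
    simp [Fin.val_inj]

theorem run_augment {s : Store} (hs : s.nat 0 0 0 = n) {u a s₀ : Fin n} (hu : s.nat 17 0 0 = u)
    (ha : s.nat 18 0 0 = a) (h21 : s.nat 21 0 0 = s₀) :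
    rowSet n 14 (augment.run s) = {s₀} ∧
      (∀ b : Fin n, (augment.run s).nat 13 0 b = if b = a then (u : ℕ) + 1 else s.nat 15 u b) ∧
      ∀ b : Fin n, (augment.run s).nat 15 s₀ b = (augment.run s).nat 13 0 b := by
  simp only [augment, Structured.run.eq_4]
  set Q := Structured.loop 26 (.setNat 13 (.const 0) (var 26) (entry 15 17 26)) with hQ
  have h2 := run_fill (x := 26) (a := 13) (i := .const 0) (e := entry 15 17 26) rfl s 0
    (fun j => s.nat 15 u j) (fun j s' _ hx _ hb hrow => by
      refine ⟨rfl, ?_⟩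
      rw [eval_entry, hb 17 (by decide) (by decide), hx, hu, hb 15 (by decide) (by decide)])
  have e3 : ∀ b, b ≠ 26 → b ≠ 13 → (Q.run s).nat b = s.nat b := fun b h1 h2 =>
    run_nat (by simp [hQ, writes, h1, h2]) s
  rw [← hQ, hs] at h2
  set s₁ := (Structured.setNat 13 (.const 0) (var 18) (.add (var 17) (.const 1))).run (Q.run s)
    with hs1
  have e4 : ∀ b, b ≠ 26 → b ≠ 13 → s₁.nat b = s.nat b := fun b h1 h2 => by
    rw [hs1, run_nat (by simp [writes, h2]), e3 b h1 h2]
  have e5 : ∀ b : Fin n, s₁.nat 13 0 b = if b = a then (u : ℕ) + 1 else s.nat 15 u b := by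
    intro b
    rw [hs1, Structured.run, Store.setNat_nat, eval_var, eval_add, eval_var,
      e3 18 (by decide) (by decide), e3 17 (by decide) (by decide), hu, ha, h2]
    simp [Fin.val_inj]
  obtain ⟨h3, h4⟩ := run_resetSearch (s := s₁) (by rw [e4 0 (by decide) (by decide), hs])
    (by rw [e4 21 (by decide) (by decide), h21])
  refine ⟨h3, fun b => ?_, fun b => ?_⟩
  · rw [run_nat (by rfl), e5]
  · rw [h4, run_nat (P := resetSearch) (a := 13) (by rfl)]

/-- The memory during the search from `s₀`, for the root `r` and the arcs `A`. -/
structure IsSearching (k : ℕ) (G : SimpleGraph (Fin n)) (w : Fin n → ℝ) (T : Finset (Fin n))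
    (r : Fin n) (A : Finset (Fin n × Fin n)) (s₀ : Fin n) (s : Store) : Prop where
  inst : IsInstance k G w T s
  root : s.nat 12 0 0 = r
  arcs : arcSet n s = A
  start : s.nat 21 0 0 = s₀
  state : IsSearchState (ArcNbr G T A) (freeNodes G T r A) s₀ (fun a => s.nat 13 0 a)
    (rowSet n 14 s) (fun u a => s.nat 15 u a)

/-- The search cannot be continued. -/
def IsStuck (G : SimpleGraph (Fin n)) (T : Finset (Fin n)) (A : Finset (Fin n × Fin n))
    (s : Store) : Prop :=
  ∀ u ∈ rowSet n 14 s, ∀ a, ArcNbr G T A u a → ∃ u' ∈ rowSet n 14 s, s.nat 13 0 a = (u' : ℕ) + 1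

/-- A bound on the number of remaining steps of the search: an augmentation lowers the number of
unassigned nodes, and an extension lowers the number of unreachable nodes. -/
def potential (n : ℕ) (s : Store) : ℕ :=
  (Finset.univ.filter fun a : Fin n => s.nat 13 0 a = 0).card * n + (n - (rowSet n 14 s).card)

theorem IsSearching.congr {r s₀ : Fin n} {A : Finset (Fin n × Fin n)} {s s' : Store}
    (h : IsSearching k G w T r A s₀ s)
    (hb : ∀ b ∈ [0, 1, 3, 4, 6, 12, 13, 14, 15, 21], s'.nat b = s.nat b)
    (hw : s'.real 0 = s.real 0) : IsSearching k G w T r A s₀ s' := by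
  simp only [List.mem_cons, List.not_mem_nil, or_false, forall_eq_or_imp, forall_eq] at hb
  obtain ⟨h0, h1, h3, h4, h6, h12, h13, h14, h15, h21⟩ := hb
  refine ⟨h.inst.congr h0 h1 h3 h4 hw, by rw [h12, h.root], by rw [arcSet_congr h6, h.arcs],
    by rw [h21, h.start], ?_⟩
  rw [rowSet_congr h14, h13, h15]
  exact h.state

theorem eval_canContinue {r s₀ : Fin n} {A : Finset (Fin n × Fin n)} {s s' : Store}
    (h : IsSearching k G w T r A s₀ s) (hw : s'.real = s.real)
    (hb : ∀ b, b ∉ [16, 17, 18, 24, 25] → s'.nat b = s.nat b) {u a : Fin n}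
    (h24 : s'.nat 24 0 0 = u) (h25 : s'.nat 25 0 0 = a) :
    canContinue.eval s' ≠ 0 ↔ u ∈ rowSet n 14 s ∧ ArcNbr G T A u a ∧
      (s.nat 13 0 a = 0 ∨ s.nat 14 0 (s.nat 13 0 a - 1) = 0) := by
  have hinst : IsInstance k G w T s' := h.inst.congr (hb 0 (by simp)) (hb 1 (by simp))
    (hb 3 (by simp)) (hb 4 (by simp)) (by rw [hw])
  have hn := eval_nbrExpr hinst (show 24 ≠ 27 by norm_num) (show 25 ≠ 27 by norm_num) h24 h25
  rw [arcSet_congr (hb 6 (by simp)), h.arcs] at hn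
  rw [canContinue, Ne, eval_and_eq_zero, eval_and_eq_zero, hn, eval_row, h24, eval_add,
    Nat.add_eq_zero_iff, eval_not_eq_zero, eval_not_eq_zero, eval_row, h25, eval_read, eval_sub,
    eval_row, h25, hb 14 (by simp), hb 13 (by simp), mem_rowSet, eval_const, eval_const, not_or,
    not_or, not_not, ← Ne, not_and_or, not_not, not_not]

theorem run_searchStep {r s₀ : Fin n} {A : Finset (Fin n × Fin n)} {s : Store}
    (h : IsSearching k G w T r A s₀ s) :
    IsSearching k G w T r A s₀ (searchStep.run s) ∧
      (IsStuck G T A s → IsStuck G T A (searchStep.run s)) ∧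
      (IsStuck G T A (searchStep.run s) ∨ potential n (searchStep.run s) < potential n s) := by
  have hsz := h.inst.size
  have hfind := run_findPair (c := canContinue) rfl s
    (fun u a => ∃ u' a' : Fin n, (u' : ℕ) = u ∧ (a' : ℕ) = a ∧ u' ∈ rowSet n 14 s ∧
      ArcNbr G T A u' a' ∧ (s.nat 13 0 a' = 0 ∨ s.nat 14 0 (s.nat 13 0 a' - 1) = 0)) (by
    intro s' u a hu ha hw hb h24 h25
    rw [hsz] at hu ha
    rw [eval_canContinue h hw hb (u := ⟨u, hu⟩) (a := ⟨a, ha⟩) h24 h25]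
    constructor
    · exact fun hh => ⟨_, _, rfl, rfl, hh⟩
    · rintro ⟨u', a', rfl, rfl, hh⟩
      exact hh)
  rw [hsz] at hfind
  set s₁ := (findPair canContinue).run s with hs₁
  have hb : ∀ b, b ∉ [16, 17, 18, 24, 25] → s₁.nat b = s.nat b := fun b hb =>
    findPair_frame _ hb s
  have hw : s₁.real = s.real := by
    funext i
    exact run_real (by rfl) s
  have h₁ : IsSearching k G w T r A s₀ s₁ := h.congr (fun b hb' => hb b (by
    simp only [List.mem_cons, List.not_mem_nil, or_false] at hb' ⊢
    omega)) (by rw [hw])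
  have hrun : searchStep.run s = (Structured.ite (.nonzero (var 16))
    (.ite (.nonzero (row 13 18)) extendSearch augment) .skip).run s₁ := rfl
  have hst : IsStuck G T A s₁ ↔ IsStuck G T A s := by
    rw [IsStuck, IsStuck, rowSet_congr (hb 14 (by simp)), hb 13 (by simp)]
  have hpot : potential n s₁ = potential n s := by
    rw [potential, potential, rowSet_congr (hb 14 (by simp)), hb 13 (by simp)]
  have hvalid : ∀ a : Fin n, s.nat 13 0 a ≠ 0 → ∃ u' : Fin n, s.nat 13 0 a = u' + 1 := by
    intro a ha
    rcases h.state.assignment.valid a with h0 | ⟨u', -, -, hu'⟩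
    · exact absurd h0 ha
    · exact ⟨u', hu'⟩
  rcases hfind with ⟨h16, hno⟩ | ⟨h16, u, hu, a, ha, h17, h18, u, a, rfl, rfl, huR, hN, hm⟩
  · have hskip : searchStep.run s = s₁ := by
      rw [hrun, Structured.run, if_neg (by simpa [Test.Holds] using h16), Structured.run]
    have hstuck : IsStuck G T A s := by
      intro u hu a hN
      have h1 := hno u u.2 a a.2
      have h2 : ¬ (s.nat 13 0 a = 0 ∨ s.nat 14 0 (s.nat 13 0 a - 1) = 0) := fun hh =>
        h1 ⟨u, a, rfl, rfl, hu, hN, hh⟩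
      rw [not_or] at h2
      obtain ⟨u', hu'⟩ := hvalid a h2.1
      refine ⟨u', mem_rowSet.2 ?_, hu'⟩
      rw [hu', Nat.add_sub_cancel] at h2
      exact h2.2
    rw [hskip, hst]
    exact ⟨h₁, id, Or.inl hstuck⟩
  · have hns : ¬ IsStuck G T A s := by
      intro hstuck
      obtain ⟨u', hu', hmu'⟩ := hstuck u huR a hN
      rw [hmu', Nat.add_sub_cancel] at hm
      exact hm.elim (Nat.succ_ne_zero _) (mem_rowSet.1 hu')
    have hrun' : searchStep.run s =
        (Structured.ite (.nonzero (row 13 18)) extendSearch augment).run s₁ := by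
      rw [hrun, Structured.run, if_pos (by simpa [Test.Holds] using h16)]
    have hcardR : ∀ s', (rowSet n 14 s').card ≤ n := fun s' => by
      simpa using Finset.card_le_univ (rowSet n 14 s')
    have h18' : (row 13 18).eval s₁ = s.nat 13 0 a := by rw [eval_row, h18, hb 13 (by simp)]
    suffices hmain : IsSearching k G w T r A s₀ (searchStep.run s) ∧
        potential n (searchStep.run s) < potential n s from
      ⟨hmain.1, fun hh => absurd hh hns, Or.inr hmain.2⟩
    have hsz₁ := h₁.inst.size
    by_cases hma : s.nat 13 0 a = 0
    · rw [hrun', Structured.run, if_neg (by simp only [Test.Holds, h18']; exact not_not.2 hma)]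
      obtain ⟨h1, h2, h3⟩ := run_augment hsz₁ h17 h18 h₁.start
      have hz := h.state.augment huR hN hma
      have e13 : (fun b : Fin n => (augment.run s₁).nat 13 0 b) =
          Function.update (fun b : Fin n => s.nat 15 u b) a (u + 1) := by
        funext b
        rw [h2, hb 15 (by simp), Function.update_apply]
      refine ⟨⟨h₁.inst.run rfl rfl rfl rfl rfl, ?_, ?_, ?_, ?_⟩, ?_⟩
      · rw [run_nat (by rfl), h₁.root]
      · rw [arcSet_congr (run_nat (by rfl) _), h₁.arcs]
      · rw [run_nat (by rfl), h₁.start]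
      · rw [h1, e13]
        refine IsSearchState.init hz.1 (h.state.subset h.state.root_mem) ?_
        funext b
        rw [h3, ← e13]
      · have h4 := hz.2
        have h5 := hcardR s
        have h6 : (Finset.univ.filter fun b : Fin n => (augment.run s₁).nat 13 0 b = 0).card <
            (Finset.univ.filter fun b : Fin n => s.nat 13 0 b = 0).card := by
          have h7 : (Finset.univ.filter fun b : Fin n => (augment.run s₁).nat 13 0 b = 0) =
              Finset.univ.filter fun b : Fin n =>
                Function.update (fun b : Fin n => s.nat 15 u b) a (u + 1) b = 0 := by
            rw [← e13]
          rw [h7]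
          exact h4
        have hn : 0 < n := u.pos
        rw [potential, potential, h1, Finset.card_singleton]
        have h8 := Nat.mul_le_mul_right n (Nat.succ_le_of_lt h6)
        rw [Nat.succ_mul] at h8
        omega
    · obtain ⟨u', hu'⟩ := hvalid a hma
      have hu'R : u' ∉ rowSet n 14 s := by
        rw [hu', Nat.add_sub_cancel] at hm
        rw [mem_rowSet, not_not]
        exact hm.resolve_left (Nat.succ_ne_zero _)
      rw [hrun', Structured.run, if_pos (by simp only [Test.Holds, h18']; exact hma)]
      obtain ⟨h1, h2, h3⟩ := run_extendSearch hsz₁ h17 h18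
        (by rw [hb 13 (by simp), hu']) (fun hh => hu'R (by rw [← hh]; exact huR))
      rw [rowSet_congr (hb 14 (by simp))] at h1
      have e13 : (extendSearch.run s₁).nat 13 = s.nat 13 := by
        rw [run_nat (by rfl), hb 13 (by simp)]
      refine ⟨⟨h₁.inst.run rfl rfl rfl rfl rfl, ?_, ?_, ?_, ?_⟩, ?_⟩
      · rw [run_nat (by rfl), h₁.root]
      · rw [arcSet_congr (run_nat (by rfl) _), h₁.arcs]
      · rw [run_nat (by rfl), h₁.start]
      · rw [h1, e13]
        refine h.state.extend huR hN hu' hu'R (fun x hx => ?_) ?_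
        · funext b
          rw [h2 x hx, hb 15 (by simp)]
        · funext b
          rw [h3, hb 15 (by simp), Function.update_apply]
      · have h5 := hcardR (extendSearch.run s₁)
        rw [potential, potential, e13]
        rw [h1, Finset.card_insert_of_notMem hu'R] at h5 ⊢
        omega

theorem run_initAssignment {r : Fin n} {s : Store} (h : IsInstance k G w T s)
    (hr : s.nat 12 0 0 = r) (a : Fin n) : (initAssignment.run s).nat 13 0 a =
      if a ∈ freeNodes G T r (arcSet n s) then (a : ℕ) + 1 else 0 := by
  have h1 := run_fill (x := 26) (a := 13) (i := .const 0)
    (e := .sub (.add (var 26) (.const 1)) (.sum 28 (var 0) (not (freeExpr 26)))) rfl s 0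
    (fun j => if ∃ a ∈ freeNodes G T r (arcSet n s), (a : ℕ) = j then j + 1 else 0)
    (fun j s' hj hx hw hb _ => by
      refine ⟨rfl, ?_⟩
      rw [h.size] at hj
      have e : ∀ i, (not (freeExpr 26)).eval (s'.setNat 28 0 0 i) =
          if (⟨j, hj⟩ : Fin n) ∈ freeNodes G T r (arcSet n s) then 0 else 1 := by
        intro i
        have hs' : ∀ b, b ≠ 26 → b ≠ 13 → b ≠ 28 → (s'.setNat 28 0 0 i).nat b = s.nat b :=
          fun b h1 h2 h3 => by rw [Store.setNat_nat_of_ne _ _ _ _ h3, hb b h1 h2]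
        have hinst : IsInstance k G w T (s'.setNat 28 0 0 i) :=
          h.congr (hs' 0 (by decide) (by decide) (by decide))
            (hs' 1 (by decide) (by decide) (by decide)) (hs' 3 (by decide) (by decide) (by decide))
            (hs' 4 (by decide) (by decide) (by decide)) (by rw [Store.setNat_real, hw])
        have hf := eval_freeExpr hinst (show 26 ≠ 27 by norm_num) (r := r) (u := ⟨j, hj⟩)
          (by rw [hs' 12 (by decide) (by decide) (by decide), hr])
          (by rw [Store.setNat_nat_of_ne _ _ _ _ (by decide), hx])
        rw [arcSet_congr (hs' 6 (by decide) (by decide) (by decide))] at hf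
        simp only [eval_not, ← hf]
        by_cases h0 : (freeExpr 26).eval (s'.setNat 28 0 0 i) = 0 <;> simp [h0]
      have e2 : (∃ a ∈ freeNodes G T r (arcSet n s), (a : ℕ) = j) ↔
          (⟨j, hj⟩ : Fin n) ∈ freeNodes G T r (arcSet n s) :=
        ⟨by rintro ⟨a, ha, rfl⟩; exact ha, fun hh => ⟨_, hh, rfl⟩⟩
      rw [eval_sub, eval_add, eval_var, eval_const, hx, NExpr.eval, eval_var,
        Finset.sum_congr rfl fun i _ => e i, if_congr e2 rfl rfl, hb 0 (by decide) (by decide),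
        h.size]
      split_ifs
      · simp
      · simp
        omega)
  rw [initAssignment, h1, h.size]
  simp [Fin.val_inj]

theorem arcNbr_self {A : Finset (Fin n × Fin n)} {u : Fin n} (hu : u ∈ T) : ArcNbr G T A u u :=
  ⟨hu, hu, Or.inl rfl⟩

theorem run_search {r s₀ : Fin n} {s : Store} (h : IsInstance k G w T s) (hr : s.nat 12 0 0 = r)
    (hs₀ : s.nat 21 0 0 = s₀) (hfree : s₀ ∈ freeNodes G T r (arcSet n s)) :
    IsSearching k G w T r (arcSet n s) s₀ (search.run s) ∧
      IsStuck G T (arcSet n s) (search.run s) := by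
  set A := arcSet n s with hA
  set s₁ := initAssignment.run s with hs₁
  set s₂ := resetSearch.run s₁ with hs₂
  have hm : ∀ a : Fin n, s₁.nat 13 0 a = if a ∈ freeNodes G T r A then (a : ℕ) + 1 else 0 :=
    run_initAssignment h hr
  have hassign : IsAssignment (ArcNbr G T A) (freeNodes G T r A) s₀ s₀
      (fun a => s₁.nat 13 0 a) := by
    constructor
    · intro a
      rw [hm]
      by_cases ha : a ∈ freeNodes G T r A
      · exact Or.inr ⟨a, ha, arcNbr_self (mem_freeNodes.1 ha).1, by rw [if_pos ha]⟩
      · exact Or.inl (if_neg ha)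
    · intro u hu hne
      rw [if_neg hne, Finset.card_eq_one]
      refine ⟨u, ?_⟩
      ext a
      rw [Finset.mem_filter, hm, Finset.mem_singleton]
      by_cases ha : a ∈ freeNodes G T r A
      · simp [ha, Fin.val_inj]
      · rw [if_neg ha]
        refine ⟨fun hh => absurd hh.2 (Nat.succ_ne_zero _).symm, ?_⟩
        rintro rfl
        exact absurd hu ha
  obtain ⟨h1, h2⟩ := run_resetSearch (s := s₁) (by rw [hs₁, run_nat (by rfl), h.size])
    (by rw [hs₁, run_nat (by rfl), hs₀])
  have e13 : s₂.nat 13 = s₁.nat 13 := run_nat (by rfl) _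
  have hstart : IsSearching k G w T r A s₀ s₂ := by
    refine ⟨(h.run rfl rfl rfl rfl rfl).run rfl rfl rfl rfl rfl, ?_, ?_, ?_, ?_⟩
    · rw [hs₂, run_nat (by rfl), hs₁, run_nat (by rfl), hr]
    · rw [arcSet_congr (s := s) (by rw [hs₂, run_nat (by rfl), hs₁, run_nat (by rfl)])]
    · rw [hs₂, run_nat (by rfl), hs₁, run_nat (by rfl), hs₀]
    · rw [hs₂, h1, ← hs₂, e13]
      refine IsSearchState.init hassign hfree ?_
      funext a
      exact h2 a
  have hpot : potential n s₂ < n * n := by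
    have h3 : (Finset.univ.filter fun a : Fin n => s₂.nat 13 0 a = 0).card < n := by
      calc _ < (Finset.univ : Finset (Fin n)).card := by
            refine Finset.card_lt_card ⟨Finset.filter_subset _ _, fun hsub => ?_⟩
            have := (Finset.mem_filter.1 (hsub (Finset.mem_univ s₀))).2
            rw [e13, hm, if_pos hfree] at this
            omega
        _ = n := by simp
    rw [potential, hs₂, h1, ← hs₂, Finset.card_singleton]
    have h4 := Nat.mul_le_mul_right n (Nat.succ_le_of_lt h3)
    rw [Nat.succ_mul] at h4
    omega
  -- After `j` steps the search is stuck, or the potential has dropped at least `j` times.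
  let J : ℕ → Store → Prop := fun j s' =>
    IsSearching k G w T r A s₀ s' ∧ (IsStuck G T A s' ∨ potential n s' + j < n * n)
  have hJ : ∀ j s' x v, (x = 22 ∨ x = 23) → J j s' → J j (s'.setNat x 0 0 v) := by
    rintro j s' x v hx ⟨h3, h4⟩
    have hne : ∀ b ∈ [0, 1, 3, 4, 6, 12, 13, 14, 15, 21], b ≠ x := by
      intro b hb
      simp only [List.mem_cons, List.not_mem_nil, or_false] at hb
      omega
    have e14 : rowSet n 14 (s'.setNat x 0 0 v) = rowSet n 14 s' :=
      rowSet_congr (Store.setNat_nat_of_ne _ _ _ _ (hne 14 (by simp)))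
    have e13' : (s'.setNat x 0 0 v).nat 13 = s'.nat 13 :=
      Store.setNat_nat_of_ne _ _ _ _ (hne 13 (by simp))
    refine ⟨h3.congr (fun b hb => Store.setNat_nat_of_ne _ _ _ _ (hne b hb)) rfl, ?_⟩
    rw [IsStuck, potential, e14, e13']
    exact h4
  have hrun : search.run s = (Structured.loop 22 (.loop 23 searchStep)).run s₂ := rfl
  have key := run_loop (x := 22) (P := .loop 23 searchStep) (by rfl) s₂ (fun i s' => J (i * n) s')
    (by
      refine hJ _ _ _ _ (Or.inl rfl) ⟨hstart, Or.inr ?_⟩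
      simpa using hpot)
    (by
      intro i s' _ _ _ hi
      have key2 := run_loop (x := 23) (P := searchStep) (by rfl) s' (fun j s' => J (i * n + j) s')
        (hJ _ _ _ _ (Or.inr rfl) hi)
        (by
          rintro j s'' - - - ⟨hj1, hj2⟩
          refine hJ _ _ _ _ (Or.inr rfl) ?_
          obtain ⟨h5, h6, h7⟩ := run_searchStep hj1
          refine ⟨h5, ?_⟩
          rcases hj2 with hj2 | hj2
          · exact Or.inl (h6 hj2)
          · exact h7.imp id fun h7 => by omega)
      rw [hi.1.inst.size] at key2
      refine hJ _ _ _ _ (Or.inl rfl) ?_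
      rw [Nat.succ_mul]
      exact key2)
  rw [hstart.inst.size, ← hrun] at key
  exact ⟨key.1, key.2.resolve_right (by omega)⟩

end Ram

/-! ### Finding a minimal violated set -/

namespace Ram

open NExpr Structured

variable {n k : ℕ} {G : SimpleGraph (Fin n)} {w : Fin n → ℝ} {T : Finset (Fin n)}

/-- The memory holds the instance, the root `r` in variable `12` and the arcs `A` in array `6`. -/
structure IsRooted (k : ℕ) (G : SimpleGraph (Fin n)) (w : Fin n → ℝ) (T : Finset (Fin n))
    (r : Fin n) (A : Finset (Fin n × Fin n)) (s : Store) : Prop where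
  inst : IsInstance k G w T s
  root : s.nat 12 0 0 = r
  arcs : arcSet n s = A

theorem IsRooted.congr {r : Fin n} {A : Finset (Fin n × Fin n)} {s s' : Store}
    (h : IsRooted k G w T r A s) (hb : ∀ b ∈ [0, 1, 3, 4, 6, 12], s'.nat b = s.nat b)
    (hw : s'.real 0 = s.real 0) : IsRooted k G w T r A s' := by
  simp only [List.mem_cons, List.not_mem_nil, or_false, forall_eq_or_imp, forall_eq] at hb
  obtain ⟨h0, h1, h3, h4, h6, h12⟩ := hb
  exact ⟨h.inst.congr h0 h1 h3 h4 hw, by rw [h12, h.root], by rw [arcSet_congr h6, h.arcs]⟩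

theorem IsRooted.setNat {r : Fin n} {A : Finset (Fin n × Fin n)} {s : Store}
    (h : IsRooted k G w T r A s) {a : ℕ} (ha : a ∉ [0, 1, 3, 4, 6, 12]) (i j x : ℕ) :
    IsRooted k G w T r A (s.setNat a i j x) :=
  h.congr (fun _ hb => Store.setNat_nat_of_ne _ _ _ _ fun hh => ha (hh ▸ hb)) rfl

theorem IsRooted.run {r : Fin n} {A : Finset (Fin n × Fin n)} {s : Store}
    (h : IsRooted k G w T r A s) {P : Structured}
    (hP : ∀ b ∈ [0, 1, 3, 4, 6, 12], P.writes b = false)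
    (hw : P.writesReal 0 = false) : IsRooted k G w T r A (P.run s) :=
  h.congr (fun b hb => run_nat (hP b hb) s) (run_real hw s)

theorem eval_sum_eq_card {s : Store} (hs : s.nat 0 0 0 = n) {x : ℕ} {e : NExpr} {Φ : Fin n → Prop}
    [DecidablePred Φ] (he : ∀ v : Fin n, e.eval (s.setNat x 0 0 v) = if Φ v then 1 else 0) :
    (NExpr.sum x (var 0) e).eval s = (Finset.univ.filter Φ).card := by
  rw [NExpr.eval, eval_var, hs, Finset.sum_range, Finset.sum_congr rfl fun v _ => he v,
    Finset.card_filter]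

/-- The number of nodes with a nonzero entry in row `0` of the array `a`. -/
def countExpr (a : ℕ) : NExpr := .sum 28 (var 0) (not (not (row a 28)))

theorem eval_countExpr {s : Store} (hs : s.nat 0 0 0 = n) {a : ℕ} (ha : a ≠ 28) :
    (countExpr a).eval s = (rowSet n a s).card := by
  rw [countExpr, rowSet]
  refine eval_sum_eq_card hs fun v => ?_
  rw [eval_not, eval_not]
  simp [Store.setNat_nat_of_ne, ha]

/-- Whether the search has found a violated set with fewer nodes of `T` than the best one so far, if
any; variable `19` holds the number of nodes of `T` in the latter, and `0` if there is none. -/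
def isBetter : NExpr :=
  and (.lt (.sum 28 (var 0) (eq (row 13 28) (.add (var 21) (.const 1)))) (.add (var 1) (.const 1)))
    (.add (not (var 19)) (.lt (countExpr 14) (var 19)))

/-- A better violated set is stored. -/
def recordCore : Structured :=
  .ite (.nonzero isBetter)
    (.seq (assign 19 (countExpr 14)) (.loop 26 (.setNat 20 (.const 0) (var 26) (row 14 26)))) .skip

/-- Computation of a minimal violated set: its nodes in `T` are stored in array `20`, and variable
`19` is zero if there is no violated set. -/
def findCore : Structured :=
  .seq (assign 19 (.const 0))
    (.loop 21 (.ite (.nonzero (freeExpr 21)) (.seq search recordCore) .skip))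

theorem run_recordCore {s : Store} (hs : s.nat 0 0 0 = n) :
    ((isBetter.eval s = 0 → recordCore.run s = s)) ∧
    (isBetter.eval s ≠ 0 → (recordCore.run s).nat 19 0 0 = (rowSet n 14 s).card ∧
      rowSet n 20 (recordCore.run s) = rowSet n 14 s) := by
  rw [recordCore, Structured.run]
  constructor
  · intro h
    rw [if_neg (by simpa [Test.Holds] using h), Structured.run]
  · intro h
    rw [if_pos (by simpa [Test.Holds] using h), Structured.run]
    set s₁ := (assign 19 (countExpr 14)).run s with hs₁
    have e1 : s₁.nat 19 0 0 = (rowSet n 14 s).card := by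
      rw [hs₁, assign, Structured.run, eval_countExpr hs (by decide), eval_const,
        Store.setNat_nat_self]
    have e2 : ∀ b, b ≠ 19 → s₁.nat b = s.nat b := fun b hb =>
      run_nat (by simp [assign, writes, hb]) s
    have h2 := run_fill (x := 26) (a := 20) (i := .const 0) (e := row 14 26) rfl s₁ 0
      (fun j => s.nat 14 0 j) (fun j s' _ hx _ hb _ =>
        ⟨rfl, by rw [eval_row, hb 14 (by decide) (by decide), hx, e2 14 (by decide)]⟩)
    refine ⟨by rw [run_nat (by rfl), e1], ?_⟩
    ext v
    rw [mem_rowSet, h2, e2 0 (by decide), hs, mem_rowSet]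
    simp

/-- The best violated set found so far by `findCore`, when the starting nodes less than `i` have
been tried. -/
def IsBestCore (G : SimpleGraph (Fin n)) (k : ℕ) (T : Finset (Fin n)) (r : Fin n)
    (A : Finset (Fin n × Fin n)) (i : ℕ) (s : Store) : Prop :=
  (s.nat 19 0 0 = 0 ∧ ∀ X, IsViolated G k T r A X → ∀ v : Fin n, (v : ℕ) < i → v ∈ T → v ∉ X) ∨
  (s.nat 19 0 0 = (rowSet n 20 s).card ∧ rowSet n 20 s ⊆ T ∧
    IsViolated G k T r A (withTails A (rowSet n 20 s)) ∧
    ∀ X, IsViolated G k T r A X → ∀ v : Fin n, (v : ℕ) < i → v ∈ T → v ∈ X →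
      (rowSet n 20 s).card ≤ (X ∩ T).card)

theorem IsBestCore.congr {r : Fin n} {A : Finset (Fin n × Fin n)} {i : ℕ} {s s' : Store}
    (h : IsBestCore G k T r A i s) (h19 : s'.nat 19 = s.nat 19) (h20 : s'.nat 20 = s.nat 20) :
    IsBestCore G k T r A i s' := by
  rwa [IsBestCore, h19, rowSet_congr h20]

/-- A starting node that does not yield a better violated set can be skipped. -/
theorem IsBestCore.skip {r s₀ : Fin n} {A : Finset (Fin n × Fin n)} {s : Store}
    (h : IsBestCore G k T r A s₀ s)
    (h0 : s.nat 19 0 0 = 0 → ∀ X, IsViolated G k T r A X → s₀ ∈ T → s₀ ∉ X)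
    (h1 : s.nat 19 0 0 = (rowSet n 20 s).card → ∀ X, IsViolated G k T r A X → s₀ ∈ T → s₀ ∈ X →
      (rowSet n 20 s).card ≤ (X ∩ T).card) : IsBestCore G k T r A (s₀ + 1) s := by
  have hcases : ∀ v : Fin n, (v : ℕ) < s₀ + 1 → (v : ℕ) < s₀ ∨ v = s₀ := fun v hv => by
    rcases Nat.lt_succ_iff_lt_or_eq.1 hv with hv | hv
    · exact Or.inl hv
    · exact Or.inr (Fin.ext hv)
  rcases h with ⟨h2, h3⟩ | ⟨h2, h3, h4, h5⟩
  · refine Or.inl ⟨h2, fun X hX v hv hvT => ?_⟩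
    rcases hcases v hv with hv | rfl
    · exact h3 X hX v hv hvT
    · exact h0 h2 X hX hvT
  · refine Or.inr ⟨h2, h3, h4, fun X hX v hv hvT hvX => ?_⟩
    rcases hcases v hv with hv | rfl
    · exact h5 X hX v hv hvT hvX
    · exact h1 h2 X hX hvT hvX

theorem run_findCore {r : Fin n} {A : Finset (Fin n × Fin n)} {s : Store}
    (h : IsRooted k G w T r A s) (hT : IsKConnected G (k - 1) T) (hr : r ∈ T)
    (hA : ∀ p ∈ A, p.2 ∈ T ∧ p.1 ∉ T) :
    ((findCore.run s).nat 19 0 0 = 0 ∧ ∀ X, ¬ IsViolated G k T r A X) ∨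
    ((findCore.run s).nat 19 0 0 ≠ 0 ∧ rowSet n 20 (findCore.run s) ⊆ T ∧
      IsMinViolated G k T r A (withTails A (rowSet n 20 (findCore.run s)))) := by
  set s₁ := (assign 19 (.const 0)).run s with hs₁
  have h₁ : IsRooted k G w T r A s₁ := h.setNat (by decide) _ _ _
  have hrun : findCore.run s = (Structured.loop 21
    (.ite (.nonzero (freeExpr 21)) (.seq search recordCore) .skip)).run s₁ := rfl
  have key := run_loop (x := 21) (P := .ite (.nonzero (freeExpr 21)) (.seq search recordCore) .skip)
    rfl s₁ (fun i s' => IsRooted k G w T r A s' ∧ IsBestCore G k T r A i s') ?_ ?_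
  · rw [h₁.inst.size, ← hrun] at key
    rcases key.2 with ⟨h2, h3⟩ | ⟨h2, h3, h4, h5⟩
    · refine Or.inl ⟨h2, fun X hX => ?_⟩
      obtain ⟨v, hv⟩ := hX.1
      rw [Finset.mem_inter] at hv
      exact h3 X hX v v.2 hv.2 hv.1
    · refine Or.inr ⟨?_, h3, isMinViolated_of_forall_card_le hA h3 h4 fun X hX => ?_⟩
      · rw [h2]
        have := h4.1
        rw [withTails_inter hA h3] at this
        exact (Finset.card_pos.2 this).ne'
      · obtain ⟨v, hv⟩ := hX.1
        rw [Finset.mem_inter] at hv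
        exact h5 X hX v v.2 hv.2 hv.1
  · exact ⟨h₁.setNat (by decide) _ _ _, Or.inl ⟨rfl, fun X _ v hv => by omega⟩⟩
  · rintro i s' hi h21 - ⟨h2, h3⟩
    rw [h₁.inst.size] at hi
    obtain ⟨s₀, rfl⟩ : ∃ s₀ : Fin n, (s₀ : ℕ) = i := ⟨⟨i, hi⟩, rfl⟩
    refine (?_ : IsRooted k G w T r A _ ∧ IsBestCore G k T r A (s₀ + 1) _).imp
      (fun hh => hh.setNat (by decide) _ _ _) (fun hh => hh.congr
        (Store.setNat_nat_of_ne _ _ _ _ (by decide)) (Store.setNat_nat_of_ne _ _ _ _ (by decide)))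
    have hfree := eval_freeExpr h2.inst (show 21 ≠ 27 by decide) h2.root h21
    rw [h2.arcs] at hfree
    rw [Structured.run]
    by_cases hf : s₀ ∈ freeNodes G T r A
    · rw [if_pos (by simpa [Test.Holds] using hfree.2 hf), Structured.run]
      have hs := run_search h2.inst h2.root h21 (by rw [h2.arcs]; exact hf)
      rw [h2.arcs] at hs
      obtain ⟨hs1, hs2⟩ := hs
      have h2' : IsRooted k G w T r A (search.run s') := ⟨hs1.inst, hs1.root, hs1.arcs⟩
      have h3' : IsBestCore G k T r A s₀ (search.run s') :=
        h3.congr (run_nat (by rfl) _) (run_nat (by rfl) _)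
      set s'' := search.run s' with hs''
      obtain ⟨h4, h5⟩ := hs1.state.smallest_violated hT hr hA hs2
      obtain ⟨h6, h7⟩ := run_recordCore h2'.inst.size
      have hcount : (NExpr.sum 28 (var 0) (eq (row 13 28) (.add (var 21) (.const 1)))).eval s'' =
          (Finset.univ.filter fun a : Fin n => s''.nat 13 0 a = (s₀ : ℕ) + 1).card := by
        refine eval_sum_eq_card h2'.inst.size fun v => ?_
        rw [eval_eq]
        simp [Store.setNat_nat_of_ne, hs1.start]
      have hbet : isBetter.eval s'' = 0 ↔
          k < (Finset.univ.filter fun a : Fin n => s''.nat 13 0 a = (s₀ : ℕ) + 1).card ∨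
          (s''.nat 19 0 0 ≠ 0 ∧ s''.nat 19 0 0 ≤ (rowSet n 14 s'').card) := by
        rw [isBetter, eval_and_eq_zero, eval_lt_eq_zero, hcount, eval_add, eval_add,
          Nat.add_eq_zero_iff, eval_not_eq_zero, eval_lt_eq_zero,
          eval_countExpr h2'.inst.size (by decide), eval_var, eval_var, h2'.inst.req, eval_const,
          Nat.succ_le_iff]
      refine ⟨h2'.run (by decide) rfl, ?_⟩
      have hRT : rowSet n 14 s'' ⊆ T := fun u hu => (mem_freeNodes.1 (hs1.state.subset hu)).1
      have hcard : ∀ X, IsViolated G k T r A X → rowSet n 14 s'' ⊆ X →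
          (rowSet n 14 s'').card ≤ (X ∩ T).card := fun X _ hX =>
        Finset.card_le_card (Finset.subset_inter hX hRT)
      by_cases hb : isBetter.eval s'' = 0
      · rw [h6 hb]
        rcases hbet.1 hb with hb | hb
        · exact h3'.skip (fun _ X hX _ => h5 hb X hX) (fun _ X hX _ hsX => absurd hsX (h5 hb X hX))
        · refine h3'.skip (fun h0 => absurd h0 hb.1) fun h0 X hX _ hsX => ?_
          by_cases hk : k < (Finset.univ.filter fun a : Fin n => s''.nat 13 0 a = (s₀ : ℕ) + 1).card
          · exact absurd hsX (h5 hk X hX)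
          · rw [← h0]
            exact hb.2.trans (hcard X hX ((h4 (not_lt.1 hk)).2 X hX hsX))
      · obtain ⟨h8, h9⟩ := h7 hb
        rw [hbet, not_or] at hb
        obtain ⟨h10, h11⟩ := h4 (not_lt.1 hb.1)
        refine Or.inr ⟨by rw [h8, h9], by rw [h9]; exact hRT, by rw [h9]; exact h10, ?_⟩
        rw [h9]
        intro X hX v hv hvT hvX
        rcases Nat.lt_succ_iff_lt_or_eq.1 hv with hv | hv
        · rcases h3' with ⟨h12, h13⟩ | ⟨h12, h14, h15, h13⟩
          · exact absurd hvX (h13 X hX v hv hvT)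
          · have := h13 X hX v hv hvT hvX
            have hR0 : s''.nat 19 0 0 ≠ 0 → (rowSet n 14 s'').card < s''.nat 19 0 0 := fun hh =>
              not_le.1 fun hle => hb.2 ⟨hh, hle⟩
            by_cases h0 : s''.nat 19 0 0 = 0
            · rw [h12] at h0
              have h16 := h15.1
              rw [withTails_inter hA h14, ← Finset.card_pos] at h16
              omega
            · have := hR0 h0
              omega
        · obtain rfl : v = s₀ := Fin.ext hv
          exact hcard X hX (h11 X hX hvX)
    · rw [if_neg (by simpa [Test.Holds] using fun hh => hf (hfree.1 hh)), Structured.run]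
      have : ∀ X, IsViolated G k T r A X → s₀ ∈ T → s₀ ∉ X := fun X hX hsT =>
        not_mem_of_notMem_freeNodes hr hA hsT hf hX
      exact ⟨h2, h3.skip (fun _ => this) fun _ X hX hsT hsX => absurd hsX (this X hX hsT)⟩

end Ram

/-! ### The growth phase as a program -/

section Growth

variable {V : Type*} [Fintype V] [DecidableEq V] {G : SimpleGraph V} {k : ℕ} {T : Finset V}
  {w : V → ℝ} {r : V}

/-- The arc `(v, t)` enters `C` and can be bought at a bounded price, either alone, if `u = t`, or
because of the arc `(u, t)` bought before. -/
def IsCandidate (G : SimpleGraph V) (T : Finset V) (A : Finset (V × V)) (C : Finset V)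
    (v t u : V) : Prop :=
  t ∈ C ∧ t ∈ T ∧ v ∉ C ∧ v ∉ T ∧ G.Adj v u ∧ (u = t ∨ (u, t) ∈ A)

/-- Since a feasible solution exists, some arc that enters `C` can be bought. -/
theorem IsMinViolated.exists_isCandidate {S : Finset V} (hS : IsAugmentation G k T S) (hr : r ∈ T)
    {A : Finset (V × V)} (hA : ∀ p ∈ A, p.2 ∈ T) {C : Finset V} (hC : IsMinViolated G k T r A C) :
    ∃ v t u, IsCandidate G T A C v t u := by
  obtain ⟨v, hv⟩ := hS.nbrSet_inter_nonempty hr hC.1.1 hC.1.2.1 hC.1.2.2.1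
  rw [Finset.mem_inter, mem_nbrSet] at hv
  obtain ⟨⟨hvC, u, hu, hadj⟩, hvS⟩ := hv
  have hvT := Finset.disjoint_left.1 hS.1 hvS
  by_cases huT : u ∈ T
  · exact ⟨v, u, u, hu, huT, hvC, hvT, hadj.symm, Or.inl rfl⟩
  · obtain ⟨t, ht, hut⟩ := (hC.mem_terminal_or_tail hu).resolve_left huT
    exact ⟨v, t, u, ht, hA _ hut, hvC, hvT, hadj.symm, Or.inr hut⟩

/-- If the candidate `(v, t, u)` becomes tight first, then it extends the history. The price of an
arc is given by `c`, where the convention `c (t, t) = 0` covers the arcs that are bought alone. -/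
theorem IsHistory.grow (hT : IsKConnected G (k - 1) T) (hr : r ∈ T) (hw : ∀ v, 0 ≤ w v)
    {L : List (Step V)} (h : IsHistory G k T w r L) {C : Finset V}
    (hC : IsMinViolated G k T r (arcs L) C) {c : V × V → ℝ} (hc : ∀ b ∈ L, c b.arc = b.cost)
    (hc0 : ∀ t ∈ T, c (t, t) = 0) {v t u : V} (hcand : IsCandidate G T (arcs L) C v t u)
    (hmin : ∀ v' t' u', IsCandidate G T (arcs L) C v' t' u' →
      w v + c (u, t) - height L t ≤ w v' + c (u', t') - height L t') :
    IsHistory G k T w r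
      (⟨C, w v + c (u, t) - height L t, (v, t), u,
        height L t + (w v + c (u, t) - height L t)⟩ :: L) := by
  obtain ⟨htC, htT, hvC, hvT, hadj, hu⟩ := id hcand
  have hheight : ∀ t' ∈ C, height
      (⟨C, w v + c (u, t) - height L t, (v, t), u,
        height L t + (w v + c (u, t) - height L t)⟩ :: L) t' =
      height L t' + (w v + c (u, t) - height L t) := fun t' ht' => by simp [height, ht']
  refine ⟨h, hC, ?_, htC, htT, hvC, hvT, ?_, ?_, (hheight t htC).symm, hadj, ?_⟩
  · obtain ⟨h1, h2⟩ := h.height_le_of_isViolated hT hr hw hC.1 hvT hvC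
    rcases hu with rfl | hu
    · have := h1 u htT htC hadj
      rw [hc0 u htT]
      linarith
    · obtain ⟨b, hb, hbu⟩ := mem_arcs.1 hu
      have := h2 b hb (by rw [hbu]; exact htC) (by rw [hbu]; exact hadj)
      rw [← hc b hb, hbu] at this
      exact sub_nonneg.2 this
  · intro v' hv'T hv'C t' ht'T ht'C hadj'
    rw [hheight t' ht'C]
    have := hmin v' t' t' ⟨ht'C, ht'T, hv'C, hv'T, hadj', Or.inl rfl⟩
    rw [hc0 t' ht'T] at this
    linarith
  · intro v' hv'T hv'C b hb hbC hadj'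
    rw [hheight _ hbC]
    have := hmin v' b.arc.2 b.arc.1 ⟨hbC, (h.head_mem hb).1, hv'C, hv'T, hadj',
      Or.inr (mem_arcs.2 ⟨b, hb, rfl⟩)⟩
    have h1 := hc b hb
    rw [← Prod.mk.eta (p := b.arc)] at h1
    linarith
  · rcases hu with rfl | hu
    · left
      refine ⟨rfl, ?_⟩
      rw [hc0 u htT]
      simp
    · right
      obtain ⟨b, hb, hbu⟩ := mem_arcs.1 hu
      refine ⟨b, hb, hbu, ?_⟩
      rw [← hc b hb, hbu]
      simp

end Growth

namespace Ram

open NExpr Structured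

variable {n k : ℕ} {G : SimpleGraph (Fin n)} {w : Fin n → ℝ} {T : Finset (Fin n)}

/-- Store the values of the variables `31`, `32` and `33` and the value of `e`. -/
def recordMin (e : RExpr) : Structured :=
  .seq (assign 34 (.const 1)) (.seq (assign 35 (var 31)) (.seq (assign 36 (var 32))
    (.seq (assign 37 (var 33)) (.setReal 3 (.const 0) e))))

/-- Search for values of the variables `31`, `32` and `33` that minimize `e` subject to `c`;
variable `34` tells whether such values exist, the minimizer is stored in the variables `35`, `36`
and `37` and the minimum in array `3` of real numbers. -/
def findMin (c : NExpr) (e : RExpr) : Structured :=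
  .seq (assign 34 (.const 0)) (.loop 31 (.loop 32 (.loop 33 (.ite (.nonzero c)
    (.ite (.nonzero (var 34)) (.ite (.le (.read 3 (.const 0)) e) .skip (recordMin e))
      (recordMin e)) .skip))))

/-- The memory during `findMin`, when the values that satisfy `D` have been tried. -/
structure IsMinState (s : Store) (Φ : Fin n → Fin n → Fin n → Prop) (f : Fin n → Fin n → Fin n → ℝ)
    (D : ℕ → ℕ → ℕ → Prop) (s' : Store) : Prop where
  nat_eq : ∀ b, b ∉ [31, 32, 33, 34, 35, 36, 37] → s'.nat b = s.nat b
  real_eq : ∀ b, b ≠ 3 → s'.real b = s.real b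
  best : (s'.nat 34 0 0 = 0 ∧ ∀ v t u : Fin n, D v t u → ¬ Φ v t u) ∨
    (s'.nat 34 0 0 ≠ 0 ∧ ∃ v t u : Fin n, s'.nat 35 0 0 = v ∧ s'.nat 36 0 0 = t ∧
      s'.nat 37 0 0 = u ∧ Φ v t u ∧ s'.real 3 0 = f v t u ∧
      ∀ v' t' u' : Fin n, D v' t' u' → Φ v' t' u' → f v t u ≤ f v' t' u')

theorem IsMinState.mono {s s' : Store} {Φ : Fin n → Fin n → Fin n → Prop}
    {f : Fin n → Fin n → Fin n → ℝ} {D D' : ℕ → ℕ → ℕ → Prop} (h : IsMinState s Φ f D s')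
    (hD : ∀ v t u, v < n → t < n → u < n → D' v t u → D v t u) : IsMinState s Φ f D' s' := by
  refine ⟨h.nat_eq, h.real_eq, h.best.imp (fun hb => ⟨hb.1, fun v t u hd => ?_⟩) ?_⟩
  · exact hb.2 v t u (hD _ _ _ v.2 t.2 u.2 hd)
  · rintro ⟨h0, v, t, u, hv, ht, hu, hΦ, hf, hmin⟩
    exact ⟨h0, v, t, u, hv, ht, hu, hΦ, hf, fun v' t' u' hd =>
      hmin v' t' u' (hD _ _ _ v'.2 t'.2 u'.2 hd)⟩

theorem IsMinState.setNat {s s' : Store} {Φ : Fin n → Fin n → Fin n → Prop}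
    {f : Fin n → Fin n → Fin n → ℝ} {D : ℕ → ℕ → ℕ → Prop} (h : IsMinState s Φ f D s') {x : ℕ}
    (hx : x ∈ [31, 32, 33]) (y : ℕ) : IsMinState s Φ f D (s'.setNat x 0 0 y) := by
  have hx' : ∀ b, b ∉ [31, 32, 33] → (s'.setNat x 0 0 y).nat b = s'.nat b := fun b hb =>
    Store.setNat_nat_of_ne _ _ _ _ fun hh => hb (hh ▸ hx)
  refine ⟨fun b hb => ?_, h.real_eq, ?_⟩
  · rw [hx' b (fun hh => hb ?_), h.nat_eq b hb]
    simp only [List.mem_cons, List.not_mem_nil, or_false] at hh ⊢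
    omega
  · rw [hx' 34 (by decide), hx' 35 (by decide), hx' 36 (by decide), hx' 37 (by decide)]
    exact h.best

theorem run_recordMin (e : RExpr) (s : Store) :
    (∀ b, b ∉ [34, 35, 36, 37] → ((recordMin e).run s).nat b = s.nat b) ∧
    ((recordMin e).run s).nat 34 0 0 = 1 ∧ ((recordMin e).run s).nat 35 0 0 = s.nat 31 0 0 ∧
    ((recordMin e).run s).nat 36 0 0 = s.nat 32 0 0 ∧
    ((recordMin e).run s).nat 37 0 0 = s.nat 33 0 0 ∧
    (∀ b, b ≠ 3 → ((recordMin e).run s).real b = s.real b) ∧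
    ∃ s₁ : Store, (∀ b, b ∉ [34, 35, 36, 37] → s₁.nat b = s.nat b) ∧ s₁.real = s.real ∧
      ((recordMin e).run s).real 3 0 = e.eval s₁ := by
  refine ⟨fun b hb => run_nat ?_ s, ?_, ?_, ?_, ?_, fun b hb => run_real ?_ s,
    ((Structured.seq (assign 34 (.const 1)) (.seq (assign 35 (var 31)) (.seq (assign 36 (var 32))
      (assign 37 (var 33))))).run s), fun b hb => run_nat ?_ s, rfl, ?_⟩
  · simp only [List.mem_cons, List.not_mem_nil, or_false, not_or] at hb
    simp [recordMin, assign, writes, hb]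
  · simp [recordMin, assign, Structured.run, Store.setNat_nat_of_ne]
  · simp [recordMin, assign, Structured.run, Store.setNat_nat_of_ne]
  · simp [recordMin, assign, Structured.run, Store.setNat_nat_of_ne]
  · simp [recordMin, assign, Structured.run, Store.setNat_nat_of_ne]
  · simp [recordMin, assign, writesReal, hb]
  · simp only [List.mem_cons, List.not_mem_nil, or_false, not_or] at hb
    simp [assign, writes, hb]
  · simp only [recordMin, Structured.run]
    exact rfl

theorem run_findMin {c : NExpr} {e : RExpr} (hok : c.ok = true) (hok' : e.ok = true) {s : Store}
    (hs : s.nat 0 0 0 = n) (Φ : Fin n → Fin n → Fin n → Prop) (f : Fin n → Fin n → Fin n → ℝ)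
    (hc : ∀ s' : Store, ∀ v t u : Fin n,
      (∀ b, b ∉ [31, 32, 33, 34, 35, 36, 37] → s'.nat b = s.nat b) →
      (∀ b, b ≠ 3 → s'.real b = s.real b) →
      s'.nat 31 0 0 = v → s'.nat 32 0 0 = t → s'.nat 33 0 0 = u → (c.eval s' ≠ 0 ↔ Φ v t u))
    (he : ∀ s' : Store, ∀ v t u : Fin n,
      (∀ b, b ∉ [31, 32, 33, 34, 35, 36, 37] → s'.nat b = s.nat b) →
      (∀ b, b ≠ 3 → s'.real b = s.real b) →
      s'.nat 31 0 0 = v → s'.nat 32 0 0 = t → s'.nat 33 0 0 = u → e.eval s' = f v t u) :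
    IsMinState s Φ f (fun _ _ _ => True) ((findMin c e).run s) := by
  set body := Structured.ite (.nonzero c)
    (.ite (.nonzero (var 34)) (.ite (.le (.read 3 (.const 0)) e) .skip (recordMin e)) (recordMin e))
    .skip with hbody
  have hbok : body.ok = true := by
    simp [hbody, Structured.ok, recordMin, assign, Test.ok, NExpr.ok, RExpr.ok, hok, hok', var]
  have hbw : ∀ x ∈ [31, 32, 33], body.writes x = false := by
    intro x hx
    simp only [List.mem_cons, List.not_mem_nil, or_false] at hx
    rcases hx with rfl | rfl | rfl <;> rfl
  have hrec : ∀ (D : ℕ → ℕ → ℕ → Prop) (s' : Store) (v t u : Fin n), IsMinState s Φ f D s' →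
      s'.nat 31 0 0 = v → s'.nat 32 0 0 = t → s'.nat 33 0 0 = u → Φ v t u →
      (∀ v' t' u' : Fin n, D v' t' u' → Φ v' t' u' → f v t u ≤ f v' t' u') →
      IsMinState s Φ f (fun v' t' u' => D v' t' u' ∨ (v' = v ∧ t' = t ∧ u' = u))
        ((recordMin e).run s') := by
    intro D s' v t u h hv ht hu hΦ hle
    obtain ⟨h1, h34, h35, h36, h37, h2, s₁, h3, h4, h5⟩ := run_recordMin e s'
    have hsub : ∀ b, b ∉ [31, 32, 33, 34, 35, 36, 37] → b ∉ [34, 35, 36, 37] := fun b hb hh =>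
      hb (by simp only [List.mem_cons, List.not_mem_nil, or_false] at hh ⊢; omega)
    refine ⟨fun b hb => by rw [h1 b (hsub b hb), h.nat_eq b hb],
      fun b hb => by rw [h2 b hb, h.real_eq b hb],
      Or.inr ⟨by rw [h34]; exact one_ne_zero, v, t, u, by rw [h35, hv], by rw [h36, ht],
        by rw [h37, hu], hΦ, ?_, ?_⟩⟩
    · rw [h5]
      exact he s₁ v t u (fun b hb => by rw [h3 b (hsub b hb), h.nat_eq b hb])
        (fun b hb => by rw [h4, h.real_eq b hb]) (by rw [h3 31 (by decide), hv])
        (by rw [h3 32 (by decide), ht]) (by rw [h3 33 (by decide), hu])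
    · rintro v' t' u' (hd | ⟨hv', ht', hu'⟩) hΦ'
      · exact hle v' t' u' hd hΦ'
      · rw [Fin.ext hv', Fin.ext ht', Fin.ext hu']
  have hstep : ∀ (D : ℕ → ℕ → ℕ → Prop) (s' : Store) (v t u : Fin n), IsMinState s Φ f D s' →
      s'.nat 31 0 0 = v → s'.nat 32 0 0 = t → s'.nat 33 0 0 = u →
      IsMinState s Φ f (fun v' t' u' => D v' t' u' ∨ (v' = v ∧ t' = t ∧ u' = u)) (body.run s') := by
    intro D s' v t u h hv ht hu
    have hcs := hc s' v t u h.nat_eq h.real_eq hv ht hu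
    have hes := he s' v t u h.nat_eq h.real_eq hv ht hu
    rw [hbody, Structured.run]
    by_cases hΦ : Φ v t u
    · rw [if_pos (by simpa [Test.Holds] using hcs.2 hΦ), Structured.run]
      by_cases h34 : s'.nat 34 0 0 = 0
      · rw [if_neg (by simpa [Test.Holds] using h34)]
        refine hrec D s' v t u h hv ht hu hΦ fun v' t' u' hd hΦ' => ?_
        rcases h.best with ⟨-, hb⟩ | ⟨h0, -⟩
        · exact absurd hΦ' (hb v' t' u' hd)
        · exact absurd h34 h0
      · rw [if_pos (by simpa [Test.Holds] using h34), Structured.run]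
        obtain ⟨-, v₀, t₀, u₀, e1, e2, e3, hΦ₀, hf₀, hmin⟩ := h.best.resolve_left fun hh => h34 hh.1
        have hle : (Test.le (.read 3 (.const 0)) e).Holds s' ↔ f v₀ t₀ u₀ ≤ f v t u := by
          rw [Test.Holds, hes, RExpr.eval, eval_const, hf₀]
        by_cases hl : f v₀ t₀ u₀ ≤ f v t u
        · rw [if_pos (hle.2 hl), Structured.run]
          refine ⟨h.nat_eq, h.real_eq, Or.inr ⟨h34, v₀, t₀, u₀, e1, e2, e3, hΦ₀, hf₀, ?_⟩⟩
          rintro v' t' u' (hd | ⟨hv', ht', hu'⟩) hΦ'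
          · exact hmin v' t' u' hd hΦ'
          · rwa [Fin.ext hv', Fin.ext ht', Fin.ext hu']
        · rw [if_neg fun hh => hl (hle.1 hh)]
          exact hrec D s' v t u h hv ht hu hΦ fun v' t' u' hd hΦ' =>
            (not_le.1 hl).le.trans (hmin v' t' u' hd hΦ')
    · rw [if_neg (by simpa [Test.Holds] using fun hh => hΦ (hcs.1 hh)), Structured.run]
      refine ⟨h.nat_eq, h.real_eq, h.best.imp (fun hb => ⟨hb.1, ?_⟩) ?_⟩
      · rintro v' t' u' (hd | ⟨hv', ht', hu'⟩)
        · exact hb.2 v' t' u' hd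
        · rwa [Fin.ext hv', Fin.ext ht', Fin.ext hu']
      · rintro ⟨h0, v₀, t₀, u₀, e1, e2, e3, hΦ₀, hf₀, hmin⟩
        refine ⟨h0, v₀, t₀, u₀, e1, e2, e3, hΦ₀, hf₀, ?_⟩
        rintro v' t' u' (hd | ⟨hv', ht', hu'⟩) hΦ'
        · exact hmin v' t' u' hd hΦ'
        · rw [Fin.ext hv', Fin.ext ht', Fin.ext hu'] at hΦ'
          exact absurd hΦ' hΦ
  have hok3 : (Structured.loop 33 body).ok = true := by
    simp [Structured.ok, hbok, hbw 33]
  have hok2 : (Structured.loop 32 (.loop 33 body)).ok = true := by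
    simp [Structured.ok, hbok, hbw 33, hbw 32, writes]
  have hok1 : (Structured.loop 31 (.loop 32 (.loop 33 body))).ok = true := by
    simp [Structured.ok, hbok, hbw 33, hbw 32, hbw 31, writes]
  set s₀ := (assign 34 (.const 0)).run s with hs₀
  have hb0 : ∀ b, b ≠ 34 → s₀.nat b = s.nat b := fun b hb => Store.setNat_nat_of_ne _ _ _ _ hb
  have h0 : IsMinState s Φ f (fun v _ _ => v < 0) s₀ :=
    ⟨fun b hb => hb0 b fun hh => hb (by simp [hh]), fun b _ => rfl,
      Or.inl ⟨rfl, fun v t u hd => absurd hd (Nat.not_lt_zero _)⟩⟩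
  have hrun : (findMin c e).run s = (Structured.loop 31 (.loop 32 (.loop 33 body))).run s₀ := rfl
  have hsz : s₀.nat 0 0 0 = n := by rw [hb0 0 (by decide), hs]
  have key := run_loop hok1 s₀ (fun i s' => IsMinState s Φ f (fun v _ _ => v < i) s')
    (h0.setNat (by simp) _) (by
      intro i s₁ hi h31 hsz1 h1
      rw [hsz] at hi
      rw [← hsz1] at hsz
      have key2 := run_loop hok2 s₁ (fun j s' => s'.nat 31 0 0 = i ∧
        IsMinState s Φ f (fun v t _ => v < i ∨ (v = i ∧ t < j)) s')
        ⟨by rw [Store.setNat_nat_of_ne _ _ _ _ (by decide), h31],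
          (h1.mono (by intro v t u _ _ _ h; omega)).setNat (by simp) _⟩ (by
        rintro j s₂ hj h32 hsz2 ⟨h31, h2⟩
        rw [hsz] at hj
        rw [← hsz2] at hsz
        have key3 := run_loop hok3 s₂ (fun l s' => s'.nat 31 0 0 = i ∧ s'.nat 32 0 0 = j ∧
          IsMinState s Φ f (fun v t u => v < i ∨ (v = i ∧ (t < j ∨ (t = j ∧ u < l)))) s')
          ⟨by rw [Store.setNat_nat_of_ne _ _ _ _ (by decide), h31],
            by rw [Store.setNat_nat_of_ne _ _ _ _ (by decide), h32],
            (h2.mono (by intro v t u _ _ _ h; omega)).setNat (by simp) _⟩ (by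
          rintro l s₃ hl h33 hsz3 ⟨h31, h32, h3⟩
          rw [hsz] at hl
          refine ⟨?_, ?_, ((hstep _ s₃ ⟨i, hi⟩ ⟨j, hj⟩ ⟨l, hl⟩ h3 h31 h32 h33).mono ?_).setNat
            (by simp) _⟩
          · rw [Store.setNat_nat_of_ne _ _ _ _ (by decide), run_nat (hbw 31 (by simp)), h31]
          · rw [Store.setNat_nat_of_ne _ _ _ _ (by decide), run_nat (hbw 32 (by simp)), h32]
          · intro v t u _ _ _ h
            simp only
            omega)
        rw [hsz] at key3
        refine ⟨by rw [Store.setNat_nat_of_ne _ _ _ _ (by decide), key3.1],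
          (key3.2.2.mono ?_).setNat (by simp) _⟩
        intro v t u _ _ _ h
        omega)
      rw [hsz] at key2
      refine (key2.2.mono ?_).setNat (by simp) _
      intro v t u _ _ _ h
      omega)
  rw [hsz, ← hrun] at key
  exact key.mono fun v t u hv _ _ _ => hv

end Ram

namespace Ram

open NExpr Structured

variable {n k : ℕ} {G : SimpleGraph (Fin n)} {w : Fin n → ℝ} {T : Finset (Fin n)}

/-- Whether the value of the variable `x` is a node of the set found by `findCore`. -/
def coreExpr (x : ℕ) : NExpr := .add (row 20 x) (ex 38 (and (row 20 38) (entry 6 x 38)))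

/-- Whether the values of the variables `31`, `32` and `33` form a candidate. -/
def candidateExpr : NExpr :=
  and (row 20 32) (and (not (coreExpr 31)) (and (not (row 4 31)) (and (entry 3 31 33)
    (.add (eq (var 33) (var 32)) (entry 6 33 32)))))

/-- The amount by which the dual variable can be raised until the candidate becomes tight. -/
def slackExpr : RExpr :=
  .sub (.add (.read 0 (var 31)) (.read 2 (entry 6 33 32))) (.read 1 (var 32))

/-- The dual variable of the set found by `findCore` is raised. -/
def raise : Structured :=
  .loop 26 (.ite (.nonzero (row 20 26))
    (.setReal 1 (var 26) (.add (.read 1 (var 26)) (.read 3 (.const 0)))) .skip)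

/-- The arc found by `findMin` is bought; its order number becomes its entry in array `6`. -/
def recordArc : Structured :=
  .seq (assign 11 (.add (var 11) (.const 1))) (.seq (.setNat 9 (var 11) (.const 0) (var 35))
    (.seq (.setNat 10 (var 11) (.const 0) (var 36)) (.seq (.setNat 6 (var 35) (var 36) (var 11))
      (.seq (.setNat 7 (var 35) (var 36) (var 37)) (.setReal 2 (var 11) (.read 1 (var 36)))))))

/-- One step of the growth phase, if there is a violated set. -/
def growStep : Structured :=
  .seq findCore (.ite (.nonzero (var 19))
    (.seq (findMin candidateExpr slackExpr) (.seq raise recordArc)) .skip)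

/-- The growth phase: arcs are bought until there is no violated set. -/
def growth : Structured := .loop 29 (.loop 30 growStep)

theorem eval_coreExpr {s : Store} (hs : s.nat 0 0 0 = n) {x : ℕ} (hx : x ≠ 38) {v : Fin n}
    (hv : s.nat x 0 0 = v) :
    (coreExpr x).eval s ≠ 0 ↔ v ∈ withTails (arcSet n s) (rowSet n 20 s) := by
  rw [mem_withTails, mem_rowSet, coreExpr, eval_add, Ne, Nat.add_eq_zero_iff, eval_row, hv,
    not_and_or, eval_ex_eq_zero, hs]
  refine or_congr_right ?_
  push Not
  constructor
  · rintro ⟨t, ht, h⟩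
    refine ⟨⟨t, ht⟩, ?_⟩
    simpa [Store.setNat_nat_of_ne, hx, hv, mem_rowSet, mem_arcSet] using h
  · rintro ⟨t, ht⟩
    refine ⟨t, t.2, ?_⟩
    simpa [Store.setNat_nat_of_ne, hx, hv, mem_rowSet, mem_arcSet] using ht

theorem eval_candidateExpr {r : Fin n} {A : Finset (Fin n × Fin n)} {s : Store}
    (h : IsRooted k G w T r A s) (hRT : rowSet n 20 s ⊆ T) (hA : ∀ p ∈ A, p.2 ∈ T ∧ p.1 ∉ T)
    {v t u : Fin n} (hv : s.nat 31 0 0 = v) (ht : s.nat 32 0 0 = t) (hu : s.nat 33 0 0 = u) :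
    candidateExpr.eval s ≠ 0 ↔ IsCandidate G T A (withTails A (rowSet n 20 s)) v t u := by
  have h1 := eval_coreExpr h.inst.size (show 31 ≠ 38 by decide) hv
  have h2 : t ∈ withTails A (rowSet n 20 s) ∧ t ∈ T ↔ s.nat 20 0 t ≠ 0 := by
    rw [← Finset.mem_inter, withTails_inter hA hRT, mem_rowSet]
  have h3 : (u, t) ∈ A ↔ s.nat 6 u t ≠ 0 := by rw [← h.arcs, mem_arcSet]
  rw [h.arcs] at h1
  rw [IsCandidate, ← and_assoc, h2, ← h1, ← h.inst.terminal v, ← h.inst.adj v u, h3, candidateExpr]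
  simp only [ne_eq, eval_and_eq_zero, eval_not_eq_zero, eval_row, eval_entry, eval_add,
    Nat.add_eq_zero_iff, eval_eq_eq_zero, eval_var, hv, ht, hu, Fin.val_inj]
  tauto

theorem run_raise {s : Store} (hs : s.nat 0 0 0 = n) (v : Fin n) : (raise.run s).real 1 v =
    s.real 1 v + if v ∈ rowSet n 20 s then s.real 3 0 else 0 := by
  have key := run_loop (x := 26) (P := .ite (.nonzero (row 20 26))
    (.setReal 1 (var 26) (.add (.read 1 (var 26)) (.read 3 (.const 0)))) .skip) rfl s
    (fun i s' => s'.nat 20 = s.nat 20 ∧ s'.real 3 = s.real 3 ∧ ∀ v : Fin n, s'.real 1 v =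
      s.real 1 v + if (v : ℕ) < i ∧ v ∈ rowSet n 20 s then s.real 3 0 else 0) ?_ ?_
  · have := key.2.2 v
    simp only [hs, v.2, true_and] at this
    exact this
  · exact ⟨Store.setNat_nat_of_ne _ _ _ _ (by decide), rfl, fun v => by simp⟩
  · rintro i s' hi hx - ⟨h1, h2, h3⟩
    refine ⟨?_, ?_, fun v => ?_⟩
    · rw [Store.setNat_nat_of_ne _ _ _ _ (by decide), run_nat (by rfl), h1]
    · rw [Store.setNat_real, run_real (by rfl), h2]
    · rw [Store.setNat_real, Structured.run]
      have hv := h3 v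
      by_cases h20 : s'.nat 20 0 i = 0
      · rw [if_neg (by simpa [Test.Holds, hx] using h20), Structured.run, hv]
        refine congrArg _ (if_congr ⟨fun h => ⟨h.1.trans (Nat.lt_succ_self _), h.2⟩,
          fun h => ⟨?_, h.2⟩⟩ rfl rfl)
        refine lt_of_le_of_ne (Nat.lt_succ_iff.1 h.1) ?_
        rintro rfl
        rw [h1] at h20
        exact mem_rowSet.1 h.2 h20
      · rw [if_pos (by simpa [Test.Holds, hx] using h20), Structured.run, Store.setReal_real,
          eval_var, hx]
        by_cases hvi : (v : ℕ) = i
        · subst hvi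
          have hvR : v ∈ rowSet n 20 s := mem_rowSet.2 (by rwa [← h1])
          rw [if_pos ⟨rfl, rfl⟩, RExpr.eval, RExpr.eval, RExpr.eval, eval_var, hx, hv, h2,
            eval_const]
          simp [hvR]
        · rw [if_neg fun hh => hvi hh.2, hv]
          refine congrArg _ (if_congr (and_congr_left fun _ => ?_) rfl rfl)
          omega

theorem run_recordArc {s : Store} {c v t u : ℕ} (hc : s.nat 11 0 0 = c) (hv : s.nat 35 0 0 = v)
    (ht : s.nat 36 0 0 = t) (hu : s.nat 37 0 0 = u) :
    (recordArc.run s).nat 11 0 0 = c + 1 ∧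
    (∀ i, (recordArc.run s).nat 9 i 0 = if i = c + 1 then v else s.nat 9 i 0) ∧
    (∀ i, (recordArc.run s).nat 10 i 0 = if i = c + 1 then t else s.nat 10 i 0) ∧
    (∀ i j, (recordArc.run s).nat 6 i j = if i = v ∧ j = t then c + 1 else s.nat 6 i j) ∧
    (∀ i j, (recordArc.run s).nat 7 i j = if i = v ∧ j = t then u else s.nat 7 i j) ∧
    ∀ i, (recordArc.run s).real 2 i = if i = c + 1 then s.real 1 t else s.real 2 i := by
  simp [recordArc, assign, Structured.run, Store.setNat_nat, Store.setReal_real, RExpr.eval, hc, hv,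
    ht, hu]

/-- The steps of the history are stored in the arrays `9`, `10` (tail and head of the arc) and `7`
(next node on the path to the head). -/
def IsRecorded (s : Store) : List (Step (Fin n)) → Prop
  | [] => True
  | b :: L => s.nat 9 (L.length + 1) 0 = b.arc.1 ∧ s.nat 10 (L.length + 1) 0 = b.arc.2 ∧
      s.nat 7 b.arc.1 b.arc.2 = b.par ∧ IsRecorded s L

theorem IsRecorded.congr {s s' : Store} {L : List (Step (Fin n))} (h : IsRecorded s L)
    (h9 : ∀ i ≤ L.length, s'.nat 9 i 0 = s.nat 9 i 0)
    (h10 : ∀ i ≤ L.length, s'.nat 10 i 0 = s.nat 10 i 0)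
    (h7 : ∀ p ∈ arcs L, s'.nat 7 p.1 p.2 = s.nat 7 p.1 p.2) : IsRecorded s' L := by
  induction L with
  | nil => trivial
  | cons b L ih =>
    obtain ⟨h1, h2, h3, h4⟩ := h
    refine ⟨?_, ?_, ?_, ih h4 (fun i hi => h9 i (hi.trans (Nat.le_succ _)))
      (fun i hi => h10 i (hi.trans (Nat.le_succ _)))
      fun p hp => h7 p (Finset.mem_insert_of_mem hp)⟩
    · exact (h9 _ le_rfl).trans h1
    · exact (h10 _ le_rfl).trans h2
    · rw [h7 _ (Finset.mem_insert_self _ _), h3]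

/-- The memory during the growth phase, after the steps `L`. Array `1` of real numbers holds the
heights, and array `2` of real numbers holds the prices of the arcs at their order numbers. Entry
`0` of the latter is the price `0` of the pairs `(t, t)`, which are no arcs. -/
structure IsGrowing (k : ℕ) (G : SimpleGraph (Fin n)) (w : Fin n → ℝ) (T : Finset (Fin n))
    (r : Fin n) (L : List (Step (Fin n))) (s : Store) : Prop where
  rooted : IsRooted k G w T r (arcs L) s
  history : IsHistory G k T w r L
  count : s.nat 11 0 0 = L.length
  recorded : IsRecorded s L
  height_eq : ∀ t ∈ T, s.real 1 t = height L t
  order_le : ∀ p : Fin n × Fin n, s.nat 6 p.1 p.2 ≤ L.length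
  price_zero : s.real 2 0 = 0
  price_eq : ∀ b ∈ L, s.real 2 (s.nat 6 b.arc.1 b.arc.2) = b.cost

theorem IsGrowing.congr {r : Fin n} {L : List (Step (Fin n))} {s s' : Store}
    (h : IsGrowing k G w T r L s)
    (hb : ∀ b ∈ [0, 1, 3, 4, 6, 7, 9, 10, 11, 12], s'.nat b = s.nat b)
    (hw : ∀ b < 3, s'.real b = s.real b) : IsGrowing k G w T r L s' := by
  refine ⟨h.rooted.congr (fun b hb' => hb b ?_) (hw 0 (by decide)), h.history, ?_,
    h.recorded.congr ?_ ?_ ?_, ?_, ?_, ?_, ?_⟩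
  · simp only [List.mem_cons, List.not_mem_nil, or_false] at hb' ⊢
    omega
  · rw [hb 11 (by simp), h.count]
  · simp [hb 9]
  · simp [hb 10]
  · simp [hb 7]
  · rw [hw 1 (by decide)]
    exact h.height_eq
  · rw [hb 6 (by simp)]
    exact h.order_le
  · rw [hw 2 (by decide)]
    exact h.price_zero
  · rw [hb 6 (by simp), hw 2 (by decide)]
    exact h.price_eq

/-- Each step of the growth phase extends the history unless there is no violated set. -/
theorem run_growStep {r : Fin n} {L : List (Step (Fin n))} {s : Store}
    (h : IsGrowing k G w T r L s) (hT : IsKConnected G (k - 1) T) (hr : r ∈ T)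
    (hw : ∀ v, 0 ≤ w v) {S : Finset (Fin n)} (hS : IsAugmentation G k T S) :
    (IsGrowing k G w T r L (growStep.run s) ∧ ∀ X, ¬ IsViolated G k T r (arcs L) X) ∨
    ∃ b, IsGrowing k G w T r (b :: L) (growStep.run s) := by
  have hA : ∀ p ∈ arcs L, p.2 ∈ T ∧ p.1 ∉ T := fun p hp => h.history.arc_mem hp
  have hcore := run_findCore h.rooted hT hr hA
  have h₁ : IsGrowing k G w T r L (findCore.run s) := by
    refine h.congr (fun b hb => run_nat ?_ s) fun b _ => run_real rfl s
    simp only [List.mem_cons, List.not_mem_nil, or_false] at hb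
    rcases hb with rfl | rfl | rfl | rfl | rfl | rfl | rfl | rfl | rfl | rfl <;> rfl
  rw [growStep, Structured.run]
  set s₁ := findCore.run s with hs₁
  rcases hcore with ⟨h19, hno⟩ | ⟨h19, hRT, hC⟩
  · left
    rw [Structured.run, if_neg (by simpa [Test.Holds] using h19), Structured.run]
    exact ⟨h₁, hno⟩
  · right
    rw [Structured.run, if_pos (by simpa [Test.Holds] using h19), Structured.run, Structured.run]
    set R := rowSet n 20 s₁ with hR
    set C := withTails (arcs L) R with hCdef
    let c : Fin n × Fin n → ℝ := fun p => s₁.real 2 (s₁.nat 6 p.1 p.2)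
    have hmin := run_findMin (c := candidateExpr) (e := slackExpr) rfl rfl h₁.rooted.inst.size
      (IsCandidate G T (arcs L) C) (fun v t u => w v + c (u, t) - s₁.real 1 t) ?_ ?_
    rotate_left
    · intro s' v t u hb hb' hv ht hu
      have hroot : IsRooted k G w T r (arcs L) s' := h₁.rooted.congr (fun b hb₁ => hb b (by
        simp only [List.mem_cons, List.not_mem_nil, or_false] at hb₁ ⊢
        omega)) (hb' 0 (by decide))
      have h20 : rowSet n 20 s' = R := rowSet_congr (hb 20 (by decide))
      have := eval_candidateExpr hroot (by rw [h20]; exact hRT) hA hv ht hu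
      rwa [h20] at this
    · intro s' v t u hb hb' hv ht hu
      simp only [slackExpr, RExpr.eval, eval_var, eval_entry, hv, ht, hu, hb 6 (by decide),
        hb' 0 (by decide), hb' 1 (by decide), hb' 2 (by decide), c, h₁.rooted.inst.weight]
    set s₂ := (findMin candidateExpr slackExpr).run s₁ with hs₂
    obtain ⟨v, t, u, h35, h36, h37, hcand, h3, hle⟩ : ∃ v t u : Fin n, s₂.nat 35 0 0 = v ∧
        s₂.nat 36 0 0 = t ∧ s₂.nat 37 0 0 = u ∧ IsCandidate G T (arcs L) C v t u ∧
        s₂.real 3 0 = w v + c (u, t) - height L t ∧ ∀ v' t' u' : Fin n,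
        IsCandidate G T (arcs L) C v' t' u' →
        w v + c (u, t) - height L t ≤ w v' + c (u', t') - height L t' := by
      rcases hmin.best with ⟨-, hb⟩ | ⟨-, v, t, u, e1, e2, e3, hΦ, hf, hle⟩
      · obtain ⟨v, t, u, hcand⟩ := hC.exists_isCandidate hS hr fun p hp => (hA p hp).1
        exact absurd hcand (hb v t u trivial)
      · refine ⟨v, t, u, e1, e2, e3, hΦ, by rw [hf, h₁.height_eq t hΦ.2.1], fun v' t' u' hΦ' => ?_⟩
        have := hle v' t' u' trivial hΦ'
        rwa [h₁.height_eq t hΦ.2.1, h₁.height_eq t' hΦ'.2.1] at this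
    set eps := w v + c (u, t) - height L t with heps
    have hcz : ∀ t ∈ T, c (t, t) = 0 := fun t ht => by
      have h0 : s₁.nat 6 t t = 0 := by
        by_contra hne
        refine (hA (t, t) ?_).2 ht
        rw [← h₁.rooted.arcs]
        exact mem_arcSet.2 hne
      simp only [c, h0, h₁.price_zero]
    have hnew := h.history.grow hT hr hw hC h₁.price_eq hcz hcand hle
    rw [← heps] at hnew
    set s₃ := raise.run s₂ with hs₃
    have hn₃ : ∀ b, b ∉ [26, 31, 32, 33, 34, 35, 36, 37] → s₃.nat b = s₁.nat b := fun b hb => by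
      rw [List.mem_cons, not_or] at hb
      rw [hs₃, run_nat (by simp [raise, writes, hb.1]), hmin.nat_eq b hb.2]
    have hr₃ : ∀ b, b ≠ 1 → b ≠ 3 → s₃.real b = s₁.real b := fun b hb1 hb3 => by
      rw [hs₃, run_real (by simp [raise, writesReal, hb1]), hmin.real_eq b hb3]
    have hh₃ : ∀ v : Fin n, s₃.real 1 v = s₁.real 1 v + if v ∈ R then eps else 0 := fun v => by
      rw [hs₃, run_raise (by rw [hmin.nat_eq 0 (by decide), h₁.rooted.inst.size]), h3,
        hmin.real_eq 1 (by decide), rowSet_congr (hmin.nat_eq 20 (by decide))]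
    obtain ⟨e11, e9, e10, e6, e7, e2⟩ := run_recordArc (s := s₃) (c := L.length) (v := v) (t := t)
      (u := u) (by rw [hn₃ 11 (by decide), h₁.count]) (by rw [hs₃, run_nat (by rfl), h35])
      (by rw [hs₃, run_nat (by rfl), h36]) (by rw [hs₃, run_nat (by rfl), h37])
    set s₄ := recordArc.run s₃ with hs₄
    have hn₄ : ∀ b, b ∉ [26, 31, 32, 33, 34, 35, 36, 37] → b ∉ [6, 7, 9, 10, 11] →
        s₄.nat b = s₁.nat b := fun b hb hb' => by
      simp only [List.mem_cons, List.not_mem_nil, or_false, not_or] at hb'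
      rw [← hn₃ b hb, hs₄, run_nat (by simp [recordArc, assign, writes, hb'])]
    have hr₄ : ∀ b, b ≠ 2 → s₄.real b = s₃.real b := fun b hb =>
      run_real (by simp [recordArc, assign, writesReal, hb]) s₃
    have hcore_iff : ∀ t ∈ T, (t ∈ C ↔ t ∈ R) := fun t ht => by
      rw [← withTails_inter hA hRT, Finset.mem_inter, and_iff_left ht]
    have hfresh : (v, t) ∉ arcs L := hnew.notMem_arcs
    have hne : ∀ p ∈ arcs L, ¬ ((p.1 : ℕ) = v ∧ (p.2 : ℕ) = t) := fun p hp hh =>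
      hfresh (by rwa [← Fin.ext hh.1, ← Fin.ext hh.2])
    have hheight : s₃.real 1 t = height L t + eps := by
      rw [hh₃, h₁.height_eq t hcand.2.1, if_pos ((hcore_iff t hcand.2.1).1 hcand.1)]
    refine ⟨_, ⟨h₁.rooted.inst.congr ?_ ?_ ?_ ?_ ?_, ?_, ?_⟩, hnew, ?_, ⟨?_, ?_, ?_, ?_⟩, ?_, ?_,
      ?_, ?_⟩
    · exact hn₄ 0 (by decide) (by decide)
    · exact hn₄ 1 (by decide) (by decide)
    · exact hn₄ 3 (by decide) (by decide)
    · exact hn₄ 4 (by decide) (by decide)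
    · rw [hr₄ 0 (by decide), hr₃ 0 (by decide) (by decide)]
    · rw [hn₄ 12 (by decide) (by decide), h₁.rooted.root]
    · ext p
      rw [arcs, Finset.mem_insert, ← h₁.rooted.arcs, mem_arcSet, mem_arcSet, e6, hn₃ 6 (by decide)]
      by_cases hp : p = (v, t)
      · simp [hp]
      · rw [if_neg fun hh => hp (Prod.ext (Fin.ext hh.1) (Fin.ext hh.2))]
        simp [hp]
    · rw [e11, List.length_cons]
    · rw [e9, if_pos rfl]
    · rw [e10, if_pos rfl]
    · rw [e7, if_pos ⟨rfl, rfl⟩]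
    · refine h₁.recorded.congr (fun i hi => ?_) (fun i hi => ?_) fun p hp => ?_
      · rw [e9, if_neg (by omega), hn₃ 9 (by decide)]
      · rw [e10, if_neg (by omega), hn₃ 10 (by decide)]
      · rw [e7, if_neg (hne p hp), hn₃ 7 (by decide)]
    · intro t' ht'
      rw [hr₄ 1 (by decide), hh₃, h₁.height_eq t' ht', height]
      exact congrArg _ (if_congr (hcore_iff t' ht').symm rfl rfl)
    · intro p
      have := h₁.order_le p
      rw [e6, hn₃ 6 (by decide), List.length_cons]
      split_ifs <;> omega
    · rw [e2, if_neg (Nat.succ_ne_zero _).symm, hr₃ 2 (by decide) (by decide), h₁.price_zero]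
    · intro b hb
      rcases List.mem_cons.1 hb with rfl | hb
      · rw [e6, if_pos ⟨rfl, rfl⟩, e2, if_pos rfl, hheight]
      · have := h₁.order_le b.arc
        rw [e6, if_neg (hne _ (mem_arcs.2 ⟨b, hb, rfl⟩)), e2, hn₃ 6 (by decide), if_neg (by omega),
          hr₃ 2 (by decide) (by decide), h₁.price_eq b hb]

/-- At the end of the growth phase there is no violated set, since the `n * n` rounds are more than
there are arcs. -/
theorem run_growth {r : Fin n} {s : Store} (h : IsGrowing k G w T r [] s)
    (hT : IsKConnected G (k - 1) T) (hr : r ∈ T) (hw : ∀ v, 0 ≤ w v) {S : Finset (Fin n)}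
    (hS : IsAugmentation G k T S) :
    ∃ L, IsGrowing k G w T r L (growth.run s) ∧ ∀ X, ¬ IsViolated G k T r (arcs L) X := by
  let J : ℕ → Store → Prop := fun j s' => ∃ L, IsGrowing k G w T r L s' ∧
    ((∀ X, ¬ IsViolated G k T r (arcs L) X) ∨ L.length = j)
  have hJ : ∀ j s' x y, (x = 29 ∨ x = 30) → J j s' → J j (s'.setNat x 0 0 y) := by
    rintro j s' x y hx ⟨L, h1, h2⟩
    refine ⟨L, h1.congr (fun b hb => Store.setNat_nat_of_ne _ _ _ _ ?_) fun _ _ => rfl, h2⟩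
    simp only [List.mem_cons, List.not_mem_nil, or_false] at hb
    omega
  have hsz := h.rooted.inst.size
  have key := run_loop (x := 29) (P := .loop 30 growStep) rfl s (fun i s' => J (i * n) s')
    (hJ _ _ _ _ (Or.inl rfl) ⟨[], h, Or.inr (by simp)⟩) (by
      intro i s' _ _ hsz' hi
      have key2 := run_loop (x := 30) (P := growStep) rfl s' (fun j s' => J (i * n + j) s')
        (hJ _ _ _ _ (Or.inr rfl) hi) (by
          rintro j s'' - - - ⟨L, h1, h2⟩
          refine hJ _ _ _ _ (Or.inr rfl) ?_
          rcases run_growStep h1 hT hr hw hS with ⟨h3, h4⟩ | ⟨b, h3⟩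
          · exact ⟨L, h3, Or.inl h4⟩
          · refine ⟨b :: L, h3, h2.imp (fun h2 X hX => h2 X (hX.mono (Finset.subset_insert _ _)))
              fun h2 => ?_⟩
            rw [List.length_cons, h2, Nat.add_assoc])
      rw [hsz', hsz] at key2
      refine hJ _ _ _ _ (Or.inl rfl) ?_
      rw [Nat.succ_mul]
      exact key2)
  rw [hsz, ← growth] at key
  obtain ⟨L, h1, h2⟩ := key
  refine ⟨L, h1, h2.resolve_right fun h3 => ?_⟩
  have := h1.history.length_lt hr
  rw [Fintype.card_fin] at this
  omega

end Ram

/-! ### Reverse deletion and recovery of the nodes as a program -/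

namespace Ram

open NExpr Structured

variable {n k : ℕ} {G : SimpleGraph (Fin n)} {w : Fin n → ℝ} {T : Finset (Fin n)}

/-- The arc that is examined, the pair of the values of the variables `44` and `45`, is kept if
there is a violated set without it. -/
def keepArc : Structured :=
  .ite (.nonzero (var 19)) (.seq (.setNat 6 (var 44) (var 45) (.const 1))
    (.setNat 8 (var 44) (var 45) (.const 1))) .skip

/-- If the arc that is examined is needed, then its tail is bought, and the next arc on the path to
its head is needed. -/
def buyNode : Structured :=
  .ite (.nonzero (entry 8 44 45)) (.seq (.setNat 5 (.const 0) (var 44) (.const 1))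
    (.setNat 8 (entry 7 44 45) (var 45) (.const 1))) .skip

/-- The last arc that has not been examined is removed. -/
def removeArc : Structured :=
  .seq (assign 44 (.read 9 (var 11) (.const 0))) (.seq (assign 45 (.read 10 (var 11) (.const 0)))
    (.seq (assign 11 (.sub (var 11) (.const 1))) (.setNat 6 (var 44) (var 45) (.const 0))))

/-- Examination of one arc, if there is one left. -/
def reverseStep : Structured :=
  .ite (.nonzero (var 11)) (.seq removeArc (.seq findCore (.seq keepArc buyNode))) .skip

/-- Reverse deletion, combined with the recovery of the nodes that the kept arcs stand for. -/
def reverse : Structured := .loop 39 (.loop 40 reverseStep)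

/-- The arcs with a nonzero entry in array `8`: those whose tails have to be bought. -/
def needSet (n : ℕ) (s : Store) : Finset (Fin n × Fin n) :=
  Finset.univ.filter fun p => s.nat 8 p.1 p.2 ≠ 0

theorem mem_needSet {s : Store} {p : Fin n × Fin n} : p ∈ needSet n s ↔ s.nat 8 p.1 p.2 ≠ 0 := by
  simp [needSet]

theorem needSet_congr {s s' : Store} (h : s'.nat 8 = s.nat 8) : needSet n s' = needSet n s := by
  simp only [needSet, h]

theorem needSet_setNat (s : Store) (p : Fin n × Fin n) :
    needSet n (s.setNat 8 p.1 p.2 1) = insert p (needSet n s) := by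
  ext q
  rw [mem_needSet, Finset.mem_insert, mem_needSet, Store.setNat_nat]
  by_cases hq : q = p
  · simp [hq]
  · rw [if_neg fun hh => hq (Prod.ext (Fin.ext hh.2.1) (Fin.ext hh.2.2))]
    simp [hq]

theorem arcSet_setNat_one (s : Store) (p : Fin n × Fin n) :
    arcSet n (s.setNat 6 p.1 p.2 1) = insert p (arcSet n s) := by
  ext q
  rw [mem_arcSet, Finset.mem_insert, mem_arcSet, Store.setNat_nat]
  by_cases hq : q = p
  · simp [hq]
  · rw [if_neg fun hh => hq (Prod.ext (Fin.ext hh.2.1) (Fin.ext hh.2.2))]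
    simp [hq]

theorem arcSet_setNat_zero (s : Store) (p : Fin n × Fin n) :
    arcSet n (s.setNat 6 p.1 p.2 0) = (arcSet n s).erase p := by
  ext q
  rw [mem_arcSet, Finset.mem_erase, mem_arcSet, Store.setNat_nat]
  by_cases hq : q = p
  · simp [hq]
  · rw [if_neg fun hh => hq (Prod.ext (Fin.ext hh.2.1) (Fin.ext hh.2.2))]
    simp [hq]

theorem rowSet_setNat (s : Store) (a : ℕ) (v : Fin n) :
    rowSet n a (s.setNat a 0 v 1) = insert v (rowSet n a s) := by
  ext u
  rw [mem_rowSet, Finset.mem_insert, mem_rowSet, Store.setNat_nat]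
  by_cases hu : u = v
  · simp [hu]
  · rw [if_neg fun hh => hu (Fin.ext hh.2.2)]
    simp [hu]

/-- The memory during the reverse deletion, when the steps `L` have not been examined yet and the
arcs `B` have been kept. The nodes `S₀` of weight at most `W` have been bought before the growth
phase. -/
structure IsReversing (k : ℕ) (G : SimpleGraph (Fin n)) (w : Fin n → ℝ) (T : Finset (Fin n))
    (r : Fin n) (c : Fin n × Fin n → ℝ) (E W : ℝ) (S₀ : Finset (Fin n)) (L : List (Step (Fin n)))
    (B : Finset (Fin n × Fin n)) (s : Store) : Prop where
  rooted : IsRooted k G w T r (arcs L ∪ B) s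
  count : s.nat 11 0 0 = L.length
  recorded : IsRecorded s L
  deletion : IsReverseDeletion G k T w r c E L B
  tail_notMem : ∀ b ∈ B, b.1 ∉ T
  recovery : IsPartialRecovery G w c W L B (needSet n s) (rowSet n 5 s)
  subset : S₀ ⊆ rowSet n 5 s
  disjoint : Disjoint (rowSet n 5 s) T

theorem IsReversing.congr {r : Fin n} {c : Fin n × Fin n → ℝ} {E W : ℝ} {S₀ : Finset (Fin n)}
    {L : List (Step (Fin n))} {B : Finset (Fin n × Fin n)} {s s' : Store}
    (h : IsReversing k G w T r c E W S₀ L B s)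
    (hb : ∀ b ∈ [0, 1, 3, 4, 5, 6, 7, 8, 9, 10, 11, 12], s'.nat b = s.nat b)
    (hw : s'.real 0 = s.real 0) : IsReversing k G w T r c E W S₀ L B s' := by
  have h5 : rowSet n 5 s' = rowSet n 5 s := rowSet_congr (hb 5 (by simp))
  refine ⟨h.rooted.congr (fun b hb' => hb b ?_) hw, ?_, h.recorded.congr ?_ ?_ ?_, h.deletion,
    h.tail_notMem, ?_, ?_, ?_⟩
  · simp only [List.mem_cons, List.not_mem_nil, or_false] at hb' ⊢
    omega
  · rw [hb 11 (by simp), h.count]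
  · simp [hb 9]
  · simp [hb 10]
  · simp [hb 7]
  · rw [needSet_congr (hb 8 (by simp)), h5]
    exact h.recovery
  · rw [h5]
    exact h.subset
  · rw [h5]
    exact h.disjoint

theorem run_removeArc {s : Store} {c v t : ℕ} (hc : s.nat 11 0 0 = c + 1)
    (hv : s.nat 9 (c + 1) 0 = v)
    (ht : s.nat 10 (c + 1) 0 = t) :
    (removeArc.run s).nat 11 0 0 = c ∧ (removeArc.run s).nat 44 0 0 = v ∧
    (removeArc.run s).nat 45 0 0 = t ∧
    (removeArc.run s).nat 6 = (s.setNat 6 v t 0).nat 6 := by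
  refine ⟨?_, ?_, ?_, ?_⟩
  · simp [removeArc, assign, Structured.run, Store.setNat_nat, hc]
  · simp [removeArc, assign, Structured.run, Store.setNat_nat, hc, hv]
  · simp [removeArc, assign, Structured.run, Store.setNat_nat, hc, ht]
  · funext i j
    simp [removeArc, assign, Structured.run, Store.setNat_nat, hc, hv, ht]

theorem run_keepArc {s : Store} {p : Fin n × Fin n} (hv : s.nat 44 0 0 = p.1)
    (ht : s.nat 45 0 0 = p.2) :
    arcSet n (keepArc.run s) = (if s.nat 19 0 0 = 0 then arcSet n s else insert p (arcSet n s)) ∧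
    needSet n (keepArc.run s) =
      (if s.nat 19 0 0 = 0 then needSet n s else insert p (needSet n s)) := by
  rw [keepArc, Structured.run]
  by_cases h : s.nat 19 0 0 = 0
  · rw [if_neg (by simpa [Test.Holds] using h), if_pos h, if_pos h]
    exact ⟨rfl, rfl⟩
  · rw [if_pos (by simpa [Test.Holds] using h), if_neg h, if_neg h]
    simp only [Structured.run, eval_var, eval_const, hv, ht,
      Store.setNat_nat_of_ne _ _ _ _ (by decide : 44 ≠ 6),
      Store.setNat_nat_of_ne _ _ _ _ (by decide : 45 ≠ 6)]
    refine ⟨?_, ?_⟩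
    · rw [← arcSet_setNat_one]
      exact arcSet_congr (Store.setNat_nat_of_ne _ _ _ _ (by decide))
    · rw [needSet_setNat]
      exact congrArg _ (needSet_congr (Store.setNat_nat_of_ne _ _ _ _ (by decide)))

theorem run_buyNode {s : Store} {p : Fin n × Fin n} {u : Fin n} (hv : s.nat 44 0 0 = p.1)
    (ht : s.nat 45 0 0 = p.2) (hu : s.nat 7 p.1 p.2 = u) :
    (p ∉ needSet n s → buyNode.run s = s) ∧
    (p ∈ needSet n s → needSet n (buyNode.run s) = insert (u, p.2) (needSet n s) ∧
      rowSet n 5 (buyNode.run s) = insert p.1 (rowSet n 5 s)) := by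
  rw [buyNode, Structured.run]
  have h8 : (Test.nonzero (entry 8 44 45)).Holds s ↔ p ∈ needSet n s := by
    rw [Test.Holds, eval_entry, hv, ht, mem_needSet]
  refine ⟨fun h => ?_, fun h => ?_⟩
  · rw [if_neg fun hh => h (h8.1 hh), Structured.run]
  · rw [if_pos (h8.2 h)]
    simp only [Structured.run, eval_var, eval_const, eval_entry, hv, ht, hu,
      Store.setNat_nat_of_ne _ _ _ _ (by decide : 44 ≠ 5),
      Store.setNat_nat_of_ne _ _ _ _ (by decide : 7 ≠ 5),
      Store.setNat_nat_of_ne _ _ _ _ (by decide : 45 ≠ 5)]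
    refine ⟨?_, ?_⟩
    · refine (needSet_setNat _ (u, p.2)).trans (congrArg _ (needSet_congr ?_))
      exact Store.setNat_nat_of_ne _ _ _ _ (by decide)
    · rw [← rowSet_setNat]
      exact rowSet_congr (Store.setNat_nat_of_ne _ _ _ _ (by decide))

theorem run_reverseStep {r : Fin n} {c : Fin n × Fin n → ℝ} {E W : ℝ} {S₀ : Finset (Fin n)}
    {b : Step (Fin n)} {L : List (Step (Fin n))} {B : Finset (Fin n × Fin n)} {s : Store}
    (h : IsReversing k G w T r c E W S₀ (b :: L) B s) (hT : IsKConnected G (k - 1) T) (hr : r ∈ T)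
    (hw : ∀ v, 0 ≤ w v) : ∃ B', IsReversing k G w T r c E W S₀ L B' (reverseStep.run s) := by
  have hhist := h.deletion.history
  have hbB : b.arc ∉ B := fun hm => h.deletion.fresh _ hm (Finset.mem_insert_self _ _)
  have hbA : b.arc ∈ arcs (b :: L) := Finset.mem_insert_self _ _
  have hA : ∀ p ∈ arcs L ∪ B, p.2 ∈ T ∧ p.1 ∉ T := fun p hp => by
    rcases Finset.mem_union.1 hp with hp | hp
    · exact hhist.1.arc_mem hp
    · exact ⟨h.deletion.head_mem p hp, h.tail_notMem p hp⟩
  have hcnt : s.nat 11 0 0 = L.length + 1 := h.count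
  obtain ⟨hr9, hr10, hr7, hrec⟩ := h.recorded
  rw [reverseStep, Structured.run,
    if_pos (by rw [Test.Holds, eval_var, hcnt]; exact Nat.succ_ne_zero _)]
  simp only [Structured.run.eq_4]
  obtain ⟨e11, e44, e45, e6⟩ := run_removeArc hcnt hr9 hr10
  set s₁ := removeArc.run s with hs₁
  have hn₁ : ∀ b, b ∉ [6, 11, 44, 45] → s₁.nat b = s.nat b := fun b hb => by
    simp only [List.mem_cons, List.not_mem_nil, or_false, not_or] at hb
    exact run_nat (by simp [removeArc, assign, writes, hb]) s
  have hroot₁ : IsRooted k G w T r (arcs L ∪ B) s₁ := by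
    refine ⟨h.rooted.inst.congr (hn₁ 0 (by decide)) (hn₁ 1 (by decide)) (hn₁ 3 (by decide))
      (hn₁ 4 (by decide)) (run_real rfl s), by rw [hn₁ 12 (by decide), h.rooted.root], ?_⟩
    rw [arcSet_congr e6, arcSet_setNat_zero, h.rooted.arcs, arcs, Finset.insert_union,
      Finset.erase_insert]
    rw [Finset.mem_union, not_or]
    exact ⟨hhist.notMem_arcs, hbB⟩
  have hcore := run_findCore hroot₁ hT hr hA
  have hn₂ : ∀ b ∈ [5, 7, 8, 9, 10], (findCore.run s₁).nat b = s.nat b := fun b hb => by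
    simp only [List.mem_cons, List.not_mem_nil, or_false] at hb
    rcases hb with rfl | rfl | rfl | rfl | rfl <;> rw [run_nat (by rfl), hn₁ _ (by decide)]
  have hroot₂ : IsRooted k G w T r (arcs L ∪ B) (findCore.run s₁) := hroot₁.run (by decide) rfl
  have f11 : (findCore.run s₁).nat 11 0 0 = L.length := by rw [run_nat (by rfl), e11]
  have f44 : (findCore.run s₁).nat 44 0 0 = b.arc.1 := by rw [run_nat (by rfl), e44]
  have f45 : (findCore.run s₁).nat 45 0 0 = b.arc.2 := by rw [run_nat (by rfl), e45]
  set s₂ := findCore.run s₁ with hs₂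
  obtain ⟨g6, g8⟩ := run_keepArc (n := n) f44 f45
  have hn₃ : ∀ b, b ≠ 6 → b ≠ 8 → (keepArc.run s₂).nat b = s₂.nat b := fun b h6 h8 =>
    run_nat (by simp [keepArc, writes, h6, h8]) s₂
  set s₃ := keepArc.run s₂ with hs₃
  obtain ⟨B', hroot₃, hdel, htail, hrecov⟩ : ∃ B', arcSet n s₃ = arcs L ∪ B' ∧
      IsReverseDeletion G k T w r c E L B' ∧ (∀ p ∈ B', p.1 ∉ T) ∧
      IsPartialRecovery G w c W (b :: L) B' (needSet n s₃) (rowSet n 5 s) := by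
    rcases hcore with ⟨h19, hno⟩ | ⟨h19, -, hC⟩
    · rw [if_pos h19] at g6 g8
      refine ⟨B, by rw [g6, hroot₂.arcs], h.deletion.discard hT hr hno, h.tail_notMem, ?_⟩
      rw [g8, needSet_congr (hn₂ 8 (by simp))]
      exact h.recovery
    · rw [if_neg h19] at g6 g8
      refine ⟨insert b.arc B, by rw [g6, hroot₂.arcs, Finset.union_insert],
        h.deletion.keep hT hr ⟨_, hC.1⟩, fun p hp => ?_, ?_⟩
      · rcases Finset.mem_insert.1 hp with rfl | hp
        · exact (hhist.arc_mem hbA).2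
        · exact h.tail_notMem p hp
      · rw [g8, needSet_congr (hn₂ 8 (by simp))]
        refine h.recovery.keep hbA hbB ?_
        rw [h.deletion.cost b List.mem_cons_self]
        exact hhist.cost_nonneg List.mem_cons_self
  have g44 : s₃.nat 44 0 0 = b.arc.1 := by rw [hn₃ 44 (by decide) (by decide), f44]
  have g45 : s₃.nat 45 0 0 = b.arc.2 := by rw [hn₃ 45 (by decide) (by decide), f45]
  obtain ⟨i1, i2⟩ := run_buyNode (n := n) (u := b.par) g44 g45 (by
    rw [hn₃ 7 (by decide) (by decide), hn₂ 7 (by simp), hr7])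
  have i5 : rowSet n 5 s₃ = rowSet n 5 s :=
    rowSet_congr (by rw [hn₃ 5 (by decide) (by decide), hn₂ 5 (by simp)])
  have hn₄ : ∀ b, b ≠ 5 → b ≠ 8 → (buyNode.run s₃).nat b = s₃.nat b := fun b h5 h8 =>
    run_nat (by simp [buyNode, writes, h5, h8]) s₃
  have hfin : IsPartialRecovery G w c W L B' (needSet n (buyNode.run s₃))
      (rowSet n 5 (buyNode.run s₃)) ∧
      (rowSet n 5 (buyNode.run s₃) = rowSet n 5 s ∨
        rowSet n 5 (buyNode.run s₃) = insert b.arc.1 (rowSet n 5 s)) := by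
    by_cases hN : b.arc ∈ needSet n s₃
    · obtain ⟨i3, i4⟩ := i2 hN
      rw [i3, i4, i5]
      exact ⟨hrecov.buy hw hhist h.deletion.cost hN, Or.inr rfl⟩
    · rw [i1 hN, i5]
      exact ⟨hrecov.skip hN, Or.inl rfl⟩
  set s₄ := buyNode.run s₃ with hs₄
  have hn : ∀ b ∈ [9, 10, 7], s₄.nat b = s.nat b := fun b hb => by
    simp only [List.mem_cons, List.not_mem_nil, or_false] at hb
    rw [hn₄ _ (by omega) (by omega), hn₃ _ (by omega) (by omega), hn₂ _ (by
      simp only [List.mem_cons, List.not_mem_nil, or_false]; omega)]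
  refine ⟨B', ⟨?_, ?_, ?_⟩, ?_, hrec.congr ?_ ?_ ?_, hdel, htail, hfin.1, ?_, ?_⟩
  · exact hroot₂.inst.congr (by rw [hn₄ 0 (by decide) (by decide), hn₃ 0 (by decide) (by decide)])
      (by rw [hn₄ 1 (by decide) (by decide), hn₃ 1 (by decide) (by decide)])
      (by rw [hn₄ 3 (by decide) (by decide), hn₃ 3 (by decide) (by decide)])
      (by rw [hn₄ 4 (by decide) (by decide), hn₃ 4 (by decide) (by decide)])
      (by rw [hs₄, run_real (by rfl), hs₃, run_real (by rfl)])
  · rw [hn₄ 12 (by decide) (by decide), hn₃ 12 (by decide) (by decide), hroot₂.root]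
  · rw [arcSet_congr (hn₄ 6 (by decide) (by decide)), hroot₃]
  · rw [hn₄ 11 (by decide) (by decide), hn₃ 11 (by decide) (by decide), f11]
  · simp [hn 9]
  · simp [hn 10]
  · simp [hn 7]
  · rcases hfin.2 with h5 | h5 <;> rw [h5]
    · exact h.subset
    · exact h.subset.trans (Finset.subset_insert _ _)
  · rcases hfin.2 with h5 | h5 <;> rw [h5]
    · exact h.disjoint
    · exact Finset.disjoint_insert_left.2 ⟨(hhist.arc_mem hbA).2, h.disjoint⟩

theorem run_reverse {r : Fin n} {c : Fin n × Fin n → ℝ} {E W : ℝ} {S₀ : Finset (Fin n)}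
    {L : List (Step (Fin n))} {B : Finset (Fin n × Fin n)} {s : Store}
    (h : IsReversing k G w T r c E W S₀ L B s) (hT : IsKConnected G (k - 1) T) (hr : r ∈ T)
    (hw : ∀ v, 0 ≤ w v) : ∃ B', IsReversing k G w T r c E W S₀ [] B' (reverse.run s) := by
  let J : ℕ → Store → Prop := fun j s' => ∃ L' B', IsReversing k G w T r c E W S₀ L' B' s' ∧
    (L' = [] ∨ L'.length + j = L.length)
  have hJ : ∀ j s' x y, (x = 39 ∨ x = 40) → J j s' → J j (s'.setNat x 0 0 y) := by
    rintro j s' x y hx ⟨L, B, h1, h2⟩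
    refine ⟨L, B, h1.congr (fun b hb => Store.setNat_nat_of_ne _ _ _ _ ?_) rfl, h2⟩
    simp only [List.mem_cons, List.not_mem_nil, or_false] at hb
    omega
  have hsz := h.rooted.inst.size
  have key := run_loop (x := 39) (P := .loop 40 reverseStep) rfl s (fun i s' => J (i * n) s')
    (hJ _ _ _ _ (Or.inl rfl) ⟨L, B, h, Or.inr (by simp)⟩) (by
      intro i s' _ _ hsz' hi
      have key2 := run_loop (x := 40) (P := reverseStep) rfl s' (fun j s' => J (i * n + j) s')
        (hJ _ _ _ _ (Or.inr rfl) hi) (by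
          rintro j s'' - - - ⟨L', B', h1, h2⟩
          refine hJ _ _ _ _ (Or.inr rfl) ?_
          cases L' with
          | nil =>
            have h0 : reverseStep.run s'' = s'' := by
              rw [reverseStep, Structured.run, if_neg (by simp [Test.Holds, h1.count]),
                Structured.run]
            rw [h0]
            exact ⟨[], B', h1, Or.inl rfl⟩
          | cons b L' =>
            obtain ⟨B'', h3⟩ := run_reverseStep h1 hT hr hw
            refine ⟨L', B'', h3, Or.inr ?_⟩
            have h4 := h2.resolve_left (List.cons_ne_nil _ _)
            rw [List.length_cons] at h4
            omega)
      rw [hsz', hsz] at key2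
      refine hJ _ _ _ _ (Or.inl rfl) ?_
      rw [Nat.succ_mul]
      exact key2)
  rw [hsz, ← reverse] at key
  obtain ⟨L', B', h1, h2⟩ := key
  have h3 := h.deletion.history.length_lt hr
  rw [Fintype.card_fin] at h3
  obtain rfl : L' = [] := h2.resolve_right (by omega)
  exact ⟨B', h1⟩

end Ram

/-! ### The augmentation algorithm -/

/-- The first `k` nodes of `T`. -/
def firstNodes {n : ℕ} (k : ℕ) (T : Finset (Fin n)) : Finset (Fin n) :=
  T.filter fun r => (T.filter fun v => v < r).card < k

theorem firstNodes_subset {n : ℕ} (k : ℕ) (T : Finset (Fin n)) : firstNodes k T ⊆ T :=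
  Finset.filter_subset _ _

theorem card_firstNodes {n k : ℕ} {T : Finset (Fin n)} (h : k ≤ T.card) :
    (firstNodes k T).card = k := by
  let f : Fin n → ℕ := fun r => (T.filter fun v => v < r).card
  have hlt : ∀ a ∈ T, ∀ b, a < b → f a < f b := fun a ha b hab => by
    refine Finset.card_lt_card ⟨fun v hv => ?_, fun hsub => ?_⟩
    · rw [Finset.mem_filter] at hv ⊢
      exact ⟨hv.1, hv.2.trans hab⟩
    · exact lt_irrefl _ (Finset.mem_filter.1 (hsub (Finset.mem_filter.2 ⟨ha, hab⟩))).2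
  have hinj : Set.InjOn f T := fun a ha b hb hab => by
    rcases lt_trichotomy a b with hlt' | rfl | hlt'
    · exact absurd hab (hlt a ha b hlt').ne
    · rfl
    · exact absurd hab (hlt b hb a hlt').ne'
  have himage : T.image f = Finset.range T.card := by
    refine Finset.eq_of_subset_of_card_le (fun i hi => ?_) ?_
    · obtain ⟨a, ha, rfl⟩ := Finset.mem_image.1 hi
      refine Finset.mem_range.2 (Finset.card_lt_card ⟨Finset.filter_subset _ _, fun hsub => ?_⟩)
      exact lt_irrefl _ (Finset.mem_filter.1 (hsub ha)).2
    · rw [Finset.card_image_of_injOn hinj, Finset.card_range]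
  have h1 : (firstNodes k T).image f = Finset.range k := by
    have h2 : (T.image f).filter (fun i => i < k) = (firstNodes k T).image f := by
      rw [Finset.filter_image]
      rfl
    rw [← h2, himage]
    ext i
    simp only [Finset.mem_filter, Finset.mem_range]
    omega
  rw [← Finset.card_image_of_injOn (hinj.mono (Finset.coe_subset.2 (firstNodes_subset k T))), h1,
    Finset.card_range]

namespace Ram

open NExpr Structured

variable {n k : ℕ} {G : SimpleGraph (Fin n)} {w : Fin n → ℝ} {T : Finset (Fin n)}

/-- The memory of the growth phase and of the reverse deletion is cleared. -/
def resetArcs : Structured :=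
  .seq (.loop 41 (.loop 42 (.seq (.setNat 6 (var 41) (var 42) (.const 0))
      (.setNat 8 (var 41) (var 42) (.const 0)))))
    (.seq (.loop 26 (.setReal 1 (var 26) .zero)) (.seq (assign 11 (.const 0))
      (.setReal 2 (.const 0) .zero)))

/-- Whether the value of variable `12` is one of the first `k` nodes of `T`. -/
def isRoot : NExpr :=
  and (row 4 12) (.lt (.sum 38 (var 0) (and (row 4 38) (.lt (var 38) (var 12)))) (var 1))

/-- The treatment of one root. -/
def rootStep : Structured :=
  .ite (.nonzero isRoot) (.seq resetArcs (.seq growth reverse)) .skip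

/-- The augmentation algorithm: a cover of the demand cuts is bought for each of the first `k` nodes
of `T` as the root. -/
def augmentation : Structured := .loop 12 rootStep

theorem run_resetArcs {s : Store} (hs : s.nat 0 0 0 = n) :
    (resetArcs.run s).nat 11 0 0 = 0 ∧ (resetArcs.run s).real 2 0 = 0 ∧
    (∀ v : Fin n, (resetArcs.run s).real 1 v = 0) ∧
    ∀ p : Fin n × Fin n,
      (resetArcs.run s).nat 6 p.1 p.2 = 0 ∧ (resetArcs.run s).nat 8 p.1 p.2 = 0 := by
  simp only [resetArcs, Structured.run.eq_4]
  set body := Structured.seq (.setNat 6 (var 41) (var 42) (.const 0))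
      (.setNat 8 (var 41) (var 42) (.const 0)) with hbody
  have key := run_loop (x := 41) (P := .loop 42 body) rfl s (fun i s' => ∀ p : Fin n × Fin n,
    (p.1 : ℕ) < i → s'.nat 6 p.1 p.2 = 0 ∧ s'.nat 8 p.1 p.2 = 0)
    (fun p hp => absurd hp (Nat.not_lt_zero _)) (by
      intro i s' _ hx hsz hi
      have key2 := run_loop (x := 42) (P := body) rfl s' (fun j s' => s'.nat 41 0 0 = i ∧
        ∀ p : Fin n × Fin n, ((p.1 : ℕ) < i ∨ ((p.1 : ℕ) = i ∧ (p.2 : ℕ) < j)) →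
        s'.nat 6 p.1 p.2 = 0 ∧ s'.nat 8 p.1 p.2 = 0)
        ⟨by rw [Store.setNat_nat_of_ne _ _ _ _ (by decide), hx], fun p hp => by
          rw [Store.setNat_nat_of_ne _ _ _ _ (by decide),
            Store.setNat_nat_of_ne _ _ _ _ (by decide)]
          exact hi p (by omega)⟩ (by
          rintro j s'' - hy - ⟨hx, hj⟩
          refine ⟨?_, fun p hp => ?_⟩
          · rw [Store.setNat_nat_of_ne _ _ _ _ (by decide), run_nat (by rfl), hx]
          · have hstep :
                (∀ a b, (body.run s'').nat 6 a b = if a = i ∧ b = j then 0 else s''.nat 6 a b) ∧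
                ∀ a b, (body.run s'').nat 8 a b = if a = i ∧ b = j then 0 else s''.nat 8 a b := by
              constructor <;> intro a b <;>
                simp [hbody, Structured.run, Store.setNat_nat, hx, hy]
            rw [Store.setNat_nat_of_ne _ _ _ _ (by decide),
              Store.setNat_nat_of_ne _ _ _ _ (by decide), hstep.1, hstep.2]
            split_ifs with h
            · exact ⟨rfl, rfl⟩
            · exact hj p (by omega))
      intro p hp
      rw [Store.setNat_nat_of_ne _ _ _ _ (by decide), Store.setNat_nat_of_ne _ _ _ _ (by decide)]
      refine key2.2 p ?_
      rw [hsz, hs]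
      omega)
  have hsz : ((Structured.loop 41 (.loop 42 body)).run s).nat 0 0 0 = n := by
    rw [run_nat (by rfl), hs]
  rw [hs] at key
  set s₁ := (Structured.loop 41 (.loop 42 body)).run s
  have key2 := run_loop (x := 26) (P := .setReal 1 (var 26) .zero) rfl s₁
    (fun i s' => ∀ v : Fin n, (v : ℕ) < i → s'.real 1 v = 0)
    (fun v hv => absurd hv (Nat.not_lt_zero _)) (by
      intro i s' _ hx _ hi v hv
      rw [Store.setNat_real, Structured.run, Store.setReal_real, eval_var, hx]
      split_ifs with h
      · rfl
      · exact hi v (by omega))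
  rw [hsz] at key2
  refine ⟨rfl, ?_, fun v => ?_, fun p => ?_⟩
  · simp [Structured.run, Store.setReal_real, RExpr.eval]
  · rw [run_real (by rfl), run_real (by rfl)]
    exact key2 v v.2
  · have hn : ∀ b, b ≠ 11 → b ≠ 26 → ((Structured.seq (.loop 26 (.setReal 1 (var 26) .zero))
        (.seq (assign 11 (.const 0)) (.setReal 2 (.const 0) .zero))).run s₁).nat b = s₁.nat b :=
      fun b h1 h2 => run_nat (by simp [assign, writes, h1, h2]) s₁
    rw [← hn 6 (by decide) (by decide), ← hn 8 (by decide) (by decide)] at key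
    exact key p p.1.2

theorem eval_isRoot {s : Store} (h : IsInstance k G w T s) {r : Fin n} (hr : s.nat 12 0 0 = r) :
    isRoot.eval s ≠ 0 ↔ r ∈ firstNodes k T := by
  have h1 : (NExpr.sum 38 (var 0) (and (row 4 38) (.lt (var 38) (var 12)))).eval s =
      (T.filter fun v => v < r).card := by
    have h2 : (T.filter fun v => v < r) = Finset.univ.filter fun v => v ∈ T ∧ v < r := by
      ext v
      simp
    rw [h2]
    refine eval_sum_eq_card h.size fun v => ?_
    have h3 : (s.setNat 38 0 0 v).nat 4 0 v ≠ 0 ↔ v ∈ T := by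
      rw [Store.setNat_nat_of_ne _ _ _ _ (by decide), h.terminal]
    rw [Store.setNat_nat_of_ne _ _ _ _ (by decide)] at h3
    simp only [← h3]
    by_cases hv : s.nat 4 0 v = 0 <;> by_cases hvr : v < r <;>
      simp [NExpr.and, NExpr.eval, Store.setNat_nat_of_ne, hr, hv, hvr, Nat.pos_iff_ne_zero]
  rw [firstNodes, Finset.mem_filter, isRoot, Ne, eval_and_eq_zero, not_or, eval_row, hr,
    ← h.terminal r, eval_lt_eq_zero, h1, eval_var, h.req, not_le]

/-- The cost of a root is at most the dual value of a history, and the bought nodes meet all demand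
cuts for the root. -/
theorem run_rootStep {r : Fin n} {s : Store} (h : IsInstance k G w T s) (hroot : s.nat 12 0 0 = r)
    (hr : r ∈ firstNodes k T) (hT : IsKConnected G (k - 1) T) (hw : ∀ v, 0 ≤ w v)
    {S : Finset (Fin n)} (hS : IsAugmentation G k T S) (hdis : Disjoint (rowSet n 5 s) T) :
    IsInstance k G w T (rootStep.run s) ∧ Disjoint (rowSet n 5 (rootStep.run s)) T ∧
    rowSet n 5 s ⊆ rowSet n 5 (rootStep.run s) ∧
    (∀ X : Finset (Fin n), (X ∩ T).Nonempty → r ∉ closedNbr G X → (nbrSet G X ∩ T).card < k →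
      (nbrSet G X ∩ rowSet n 5 (rootStep.run s)).Nonempty) ∧
    ∃ L, IsHistory G k T w r L ∧
      ∑ v ∈ rowSet n 5 (rootStep.run s), w v ≤ ∑ v ∈ rowSet n 5 s, w v + dualValue L := by
  have hrT := firstNodes_subset k T hr
  rw [rootStep, Structured.run, if_pos (by simpa [Test.Holds] using (eval_isRoot h hroot).2 hr)]
  simp only [Structured.run.eq_4]
  obtain ⟨e11, e2, e1, e68⟩ := run_resetArcs h.size
  have h₁ : IsInstance k G w T (resetArcs.run s) := h.run rfl rfl rfl rfl rfl
  have hgrow : IsGrowing k G w T r [] (resetArcs.run s) := by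
    refine ⟨⟨h₁, by rw [run_nat (by rfl), hroot], ?_⟩, trivial, e11, trivial, fun t _ => e1 t,
      fun p => (e68 p).1.le, e2, by simp⟩
    ext p
    rw [mem_arcSet, (e68 p).1]
    simp [arcs]
  obtain ⟨L, hL, hcov⟩ := run_growth hgrow hT hrT hw hS
  have h5 : rowSet n 5 (growth.run (resetArcs.run s)) = rowSet n 5 s :=
    rowSet_congr (by rw [run_nat (by rfl), run_nat (by rfl)])
  have h8 : needSet n (growth.run (resetArcs.run s)) = ∅ := by
    ext p
    rw [mem_needSet, run_nat (by rfl), (e68 p).2]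
    simp
  obtain ⟨c, hc⟩ := hL.history.exists_cost
  have hrev : IsReversing k G w T r c (dualValue L) (∑ v ∈ rowSet n 5 s, w v) (rowSet n 5 s) L ∅
      (growth.run (resetArcs.run s)) := by
    refine ⟨by rw [Finset.union_empty]; exact hL.rooted, hL.count, hL.recorded,
      hL.history.isReverseDeletion hc hcov, by simp, ⟨by rw [h5, h8]; simp, by simp⟩, by rw [h5],
      by rw [h5]; exact hdis⟩
  obtain ⟨B, hB⟩ := run_reverse hrev hT hrT hw
  refine ⟨hB.rooted.inst, hB.disjoint, hB.subset, fun X hX hrX hlt => ?_, L, hL.history, ?_⟩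
  · have h6 : ∃ b ∈ B, b.2 ∈ X ∧ b.1 ∉ X := by
      by_contra! hne
      refine hB.deletion.cover X ⟨hX, hrX, hlt, fun p hp => ?_⟩
      rw [arcs, Finset.empty_union] at hp
      exact hne p hp
    refine (hB.recovery.cover X h6).resolve_right ?_
    rintro ⟨p, hp, -⟩
    simp [arcs] at hp
  · have h6 := hB.recovery.paid
    have h7 := hB.deletion.price
    simp only [arcs, Finset.inter_empty, Finset.sum_empty, dualValue, List.map_nil, List.sum_nil,
      height, Finset.sum_const_zero] at h6 h7 ⊢
    linarith

/-- The nodes bought by the algorithm meet all demand cuts for each root, and their weight is at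
most the sum of one dual bound `E r` for each root `r`. -/
theorem run_augmentation {m : ℕ} {s : Store} (h : IsInstance k G w T s) (hG : IsUnitDiskGraph G)
    (hT : IsCDS G (k - 1) m T) (hkm : k ≤ m) (hw : ∀ v, 0 ≤ w v) {S : Finset (Fin n)}
    (hS : IsAugmentation G k T S) (h5 : rowSet n 5 s = ∅) :
    Disjoint (rowSet n 5 (augmentation.run s)) T ∧
    (∀ r ∈ firstNodes k T, ∀ X : Finset (Fin n), (X ∩ T).Nonempty → r ∉ closedNbr G X →
      (nbrSet G X ∩ T).card < k → (nbrSet G X ∩ rowSet n 5 (augmentation.run s)).Nonempty) ∧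
    ∃ E : Fin n → ℝ, ∑ v ∈ rowSet n 5 (augmentation.run s), w v ≤ ∑ r ∈ firstNodes k T, E r ∧
      ∀ r ∈ firstNodes k T, ∀ x, IsLPFeasible G k T r x → E r ≤ 81 * k * lpCost w T x := by
  let J : ℕ → Store → Prop := fun i s' => IsInstance k G w T s' ∧ Disjoint (rowSet n 5 s') T ∧
    (∀ r ∈ firstNodes k T, (r : ℕ) < i → ∀ X : Finset (Fin n), (X ∩ T).Nonempty →
      r ∉ closedNbr G X → (nbrSet G X ∩ T).card < k → (nbrSet G X ∩ rowSet n 5 s').Nonempty) ∧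
    ∃ E : Fin n → ℝ, ∑ v ∈ rowSet n 5 s', w v ≤
        ∑ r ∈ (firstNodes k T).filter (fun r : Fin n => (r : ℕ) < i), E r ∧
      ∀ r ∈ firstNodes k T, (r : ℕ) < i → ∀ x, IsLPFeasible G k T r x →
        E r ≤ 81 * k * lpCost w T x
  have hJ : ∀ i s' y, J i s' → J i (s'.setNat 12 0 0 y) := by
    intro i s' y hi
    have h5' : rowSet n 5 (s'.setNat 12 0 0 y) = rowSet n 5 s' :=
      rowSet_congr (Store.setNat_nat_of_ne _ _ _ _ (by decide))
    simp only [J, h5']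
    exact ⟨hi.1.congr (Store.setNat_nat_of_ne _ _ _ _ (by decide))
      (Store.setNat_nat_of_ne _ _ _ _ (by decide)) (Store.setNat_nat_of_ne _ _ _ _ (by decide))
      (Store.setNat_nat_of_ne _ _ _ _ (by decide)) rfl, hi.2⟩
  have key := run_loop (x := 12) (P := rootStep) rfl s J
    (hJ _ _ _ ⟨h, by simp [h5], fun r _ hr => absurd hr (Nat.not_lt_zero _), fun _ => 0,
      by simp [h5],
      fun r _ hr => absurd hr (Nat.not_lt_zero _)⟩) (by
    rintro i s' hi hx - ⟨h1, h2, h3, E, h4, h6⟩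
    refine hJ _ _ _ ?_
    rw [h.size] at hi
    obtain ⟨r, rfl⟩ : ∃ r : Fin n, (r : ℕ) = i := ⟨⟨i, hi⟩, rfl⟩
    have hcases : ∀ q : Fin n, (q : ℕ) < r + 1 → (q : ℕ) < r ∨ q = r := fun q hq => by
      rcases Nat.lt_succ_iff_lt_or_eq.1 hq with hq | hq
      · exact Or.inl hq
      · exact Or.inr (Fin.ext hq)
    by_cases hr : r ∈ firstNodes k T
    · obtain ⟨g1, g2, g3, g4, L, g5, g6⟩ := run_rootStep h1 hx hr hT.1 hw hS h2
      refine ⟨g1, g2, fun q hq hqr X hX hqX hlt => ?_, Function.update E r (dualValue L), ?_,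
        fun q hq hqr x hlpx => ?_⟩
      · rcases hcases q hqr with hqr | rfl
        · exact (h3 q hq hqr X hX hqX hlt).mono (Finset.inter_subset_inter_left g3)
        · exact g4 X hX hqX hlt
      · have e : (firstNodes k T).filter (fun q : Fin n => (q : ℕ) < r + 1) =
            insert r ((firstNodes k T).filter fun q : Fin n => (q : ℕ) < r) := by
          ext q
          simp only [Finset.mem_filter, Finset.mem_insert]
          constructor
          · exact fun hq => (hcases q hq.2).symm.imp id fun hh => ⟨hq.1, hh⟩
          · rintro (rfl | hq)
            · exact ⟨hr, Nat.lt_succ_self _⟩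
            · exact ⟨hq.1, hq.2.trans (Nat.lt_succ_self _)⟩
        have e2 : ∑ q ∈ (firstNodes k T).filter (fun q : Fin n => (q : ℕ) < r),
            Function.update E r (dualValue L) q =
            ∑ q ∈ (firstNodes k T).filter (fun q : Fin n => (q : ℕ) < r), E q :=
          Finset.sum_congr rfl fun q hq => Function.update_of_ne (by rintro rfl; simp at hq) _ _
        rw [e, Finset.sum_insert (by simp), Function.update_self, e2]
        linarith
      · rcases hcases q hqr with hqr | rfl
        · rw [Function.update_of_ne (by rintro rfl; exact lt_irrefl _ hqr)]
          exact h6 q hq hqr x hlpx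
        · rw [Function.update_self]
          exact g5.dualValue_le hT.1 (firstNodes_subset k T hr) hw
            (fun v _ => hG.exists_hitting_set hT.2 hkm q v) hlpx
    · have hskip : rootStep.run s' = s' := by
        rw [rootStep, Structured.run, if_neg, Structured.run]
        simpa [Test.Holds] using fun hh => hr ((eval_isRoot h1 hx).1 hh)
      rw [hskip]
      have hne : ∀ q ∈ firstNodes k T, (q : ℕ) < r + 1 → (q : ℕ) < r := fun q hq hqr =>
        (hcases q hqr).resolve_right fun hh => hr (hh ▸ hq)
      refine ⟨h1, h2, fun q hq hqr => h3 q hq (hne q hq hqr), E, ?_,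
        fun q hq hqr => h6 q hq (hne q hq hqr)⟩
      rwa [Finset.filter_congr fun q hq => ⟨hne q hq, fun hh => hh.trans (Nat.lt_succ_self _)⟩])
  rw [h.size, ← augmentation] at key
  obtain ⟨-, h2, h3, E, h4, h6⟩ := key
  refine ⟨h2, fun r hr => h3 r hr r.2, E, ?_, fun r hr => h6 r hr r.2⟩
  rwa [Finset.filter_true_of_mem fun q _ => q.2] at h4

theorem isInstance_input (n k m : ℕ) (G : SimpleGraph (Fin n)) (w : Fin n → ℝ)
    (T : Finset (Fin n)) : IsInstance k G w T (input n k m G w T) where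
  size := by simp [input]
  req := by simp [input]
  adj u v := by simp [input]
  terminal v := by simp [input]
  weight v := by simp [input]

end Ram

theorem mainTheorem4 :
    ∃ (P : Ram.Program) (p : Polynomial ℕ) (C : ℝ),
      ∀ (n k m : ℕ) (G : SimpleGraph (Fin n)) (w : Fin n → ℝ) (T : Finset (Fin n)),
        0 < n → 1 ≤ k → k ≤ m → IsUnitDiskGraph G → (∀ v, 0 ≤ w v) →
        IsCDS G (k - 1) m T → (∃ S, IsAugmentation G k T S) →
        ∃ (t : ℕ) (s : Ram.Store),
          Ram.Exec P (Ram.input n k m G w T) t s ∧ t ≤ p.eval n ∧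
          IsAugmentation G k T (Ram.output n s) ∧
          (∀ S, IsAugmentation G k T S →
            ∑ v ∈ Ram.output n s, w v ≤ C * (k : ℝ) ^ 2 * ∑ v ∈ S, w v) ∧
          ∃ r ∈ T, ∀ x, IsLPFeasible G k T r x →
            ∑ v ∈ Ram.output n s, w v ≤ C * (k : ℝ) ^ 2 * lpCost w T x := by
  refine ⟨Ram.augmentation.compile, Ram.augmentation.bound, 81, ?_⟩
  rintro n k m G w T hn hk hkm hG hw hT ⟨S₀, hS₀⟩
  have hinst := Ram.isInstance_input n k m G w T
  obtain ⟨t, hexec, ht⟩ := Ram.Structured.exec_run (P := Ram.augmentation) rfl hinst.size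
  obtain ⟨hdis, hcov, E, hE, hlp⟩ := Ram.run_augmentation hinst hG hT hkm hw hS₀
    (by ext v; simp [Ram.mem_rowSet, Ram.input])
  refine ⟨t, _, hexec, ht, ?_⟩
  set out := Ram.output n (Ram.augmentation.run (Ram.input n k m G w T)) with hout
  change Disjoint out T at hdis
  -- The weight of a feasible set is the value of a feasible solution of the linear program.
  suffices hmain : IsAugmentation G k T out ∧ ∃ r ∈ T, ∀ x, IsLPFeasible G k T r x →
      ∑ v ∈ out, w v ≤ 81 * (k : ℝ) ^ 2 * lpCost w T x by
    obtain ⟨h1, r, hr, h2⟩ := hmain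
    refine ⟨h1, fun S hS => ?_, r, hr, h2⟩
    rw [← hS.lpCost_indicator]
    exact h2 _ (hS.isLPFeasible_indicator hr)
  -- A node outside `T` has at least `k` neighbours in `T`.
  have huniv : T.card < k → T = Finset.univ := fun hlt => by
    rw [Finset.eq_univ_iff_forall]
    intro v
    by_contra hv
    have h1 := hT.2 v hv
    have h2 := Finset.card_le_card (Finset.inter_subset_right (s₁ := nbrSet G {v}) (s₂ := T))
    omega
  rcases lt_or_ge T.card k with hlt | hle
  · -- Then `T` consists of all nodes, and the only feasible set is empty.
    have hTu := huniv hlt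
    have hempty : ∀ S : Finset (Fin n), Disjoint S T → S = ∅ := fun S hS => by
      rw [hTu] at hS
      exact Finset.eq_empty_of_forall_notMem fun v hv =>
        Finset.disjoint_left.1 hS hv (Finset.mem_univ v)
    rw [hempty out hdis, ← hempty S₀ hS₀.1]
    refine ⟨hS₀, ⟨0, hn⟩, by rw [hTu]; exact Finset.mem_univ _, fun x _ => ?_⟩
    rw [hempty S₀ hS₀.1, lpCost, hTu]
    simp
  · refine ⟨⟨hdis, isKConnected_union_of_roots hT hkm (firstNodes_subset k T)
      (card_firstNodes hle).ge hdis hcov⟩, ?_⟩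
    obtain ⟨r, hr, hmax⟩ := Finset.exists_max_image (firstNodes k T) E
      (Finset.card_pos.1 (by rw [card_firstNodes hle]; exact hk))
    refine ⟨r, firstNodes_subset k T hr, fun x hx => ?_⟩
    calc ∑ v ∈ out, w v ≤ ∑ q ∈ firstNodes k T, E q := hE
      _ ≤ ∑ q ∈ firstNodes k T, E r := Finset.sum_le_sum hmax
      _ = k * E r := by rw [Finset.sum_const, card_firstNodes hle, nsmul_eq_mul]
      _ ≤ k * (81 * k * lpCost w T x) :=
        mul_le_mul_of_nonneg_left (hlp r hr x hx) (Nat.cast_nonneg k)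
      _ = 81 * (k : ℝ) ^ 2 * lpCost w T x := by ring
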